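/- Let $\mathbb K$ be $\mathbb R$ or $\mathbb C$, and write $C^\infty(M)$ for the $\mathbb K$-valued smooth functions on a real smooth manifold $M$ and $\{f,g\}=P(df,dg)=P^{ij}\partial_if\,\partial_jg$ for the bracket of a Poisson tensor $P$. For a torsionfree linear connection $\nabla$ on $M$ put $\nabla^1f=df$, $\nabla^m f(X_1,\dots,X_m)=(\nabla_{X_1}\nabla^{m-1}f)(X_2,\dots,X_m)$, let $\nabla^m_{\rm sym}f$ be the symmetrisation of $\nabla^mf$, and write $R(\partial_i,\partial_k)\partial_l=R^j_{ikl}\partial_j$ for the curvature $R(X,Y)=[\nabla_X,\nabla_Y]-\nabla_{[X,Y]}$. Repeated indices are summed. A universal Poisson-related bidifferential operator of no-loop type is an association to every $(M,\nabla,P)$ of a bidifferential operator on $C^\infty(M)$ which is given, for all $(M,\nabla,P)$ at once, by one linear combination with constant coefficients of complete contractions of products of tensors $\nabla^mP$, $\nabla^mR$ ($m\ge 0$), $\nabla^{p}_{\rm sym}f$ and $\nabla^{q}_{\rm sym}g$, in which no factor is contracted with itself. It is polynomial of degree $r$ in the Poisson structure if replacing $P$ by $tP$ ($t \in \mathbb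 R$) multiplies it by $t^r$. **Theorem.** There is a universal star product up to order three, which associates to every smooth manifold $M$, Poisson tensor $P$ and torsionfree linear connection $\nabla$ on $M$ $$f*g=f g+\nu\{f,g\}+\nu^2\tilde C_2(f,g)+\nu^3\tilde C_3(f,g),\qquad f,g\in C^\infty(M),$$ where $$\tilde C_2(f,g)=\tfrac12P^{kr}P^{ls}\nabla^2_{kl}f\,\nabla^2_{rs}g+\tfrac13P^{kr}\nabla_rP^{ls}\left(\nabla^2_{kl}f\,\nabla_sg+\nabla_sf\,\nabla^2_{kl}g\right)-\tfrac16\nabla_lP^{kr}\,\nabla_kP^{ls}\,\nabla_rf\,\nabla_sg,$$ $$\tilde C_3(f,g)=-\tfrac16P^{ls}(\mathcal L_{X_f}\nabla)^j_{kl}(\mathcal L_{X_g}\nabla)^k_{js},\qquad X_f=i(df)P,$$ and $\mathcal L_{X_f}\nabla$, the Lie derivative of the connection, $(\mathcal L_X\nabla)(Y,Z)=[X,\nabla_YZ]-\nabla_{[X,Y]}Z-\nabla_Y[X,Z]$, has the components $$(\mathcal L_{X_f}\nabla)^j_{kl}=P^{ij}\nabla^3_{kli}f+\nabla_kP^{ij}\nabla^2_{li}f+\nabla_lP^{ij}\nabla^2_{ki}f+\nabla^2_{kl}P^{ij}\nabla_if+R^j_{ikl}P^{si}\nabla_sf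 .$$ That is, with $C_0(f,g)=fg$, $C_1=\{\cdot,\cdot\}$, $C_2=\tilde C_2$, $C_3=\tilde C_3$: (a) for every $(M,\nabla,P)$ the $\mathbb K[[\nu]]$-bilinear extension of $*$ to $C^\infty(M)[[\nu]]$ is associative modulo $\nu^4$; $C_1(f,g)-C_1(g,f)=2\{f,g\}$; and each $C_r$, $r=1,2,3$, is a (globally well defined) bidifferential operator $C^\infty(M)\times C^\infty(M)\to C^\infty(M)$ vanishing on constants; (b) for $r=1,2,3$, $C_r$ is a universal Poisson-related bidifferential operator of no-loop type, polynomial of degree $r$ in the Poisson structure. -/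

import Mathlib

open scoped Manifold ContDiff

universe u v

noncomputable section

namespace UnivStar

/-! ### Charts, connections, Poisson tensors, smooth functions -/

/-- The smooth atlas of a `d`-dimensional smooth manifold. -/
abbrev Charts (d : ℕ) (M : Type u) [TopologicalSpace M]
    [ChartedSpace (EuclideanSpace ℝ (Fin d)) M] :
    Set (OpenPartialHomeomorph M (EuclideanSpace ℝ (Fin d))) :=
  IsManifold.maximalAtlas (𝓡 d) ∞ M

/-- A smooth torsionfree linear connection on the manifold `M`. -/
structure TorsionFreeConnection (d : ℕ) (M : Type u) [TopologicalSpace M]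
    [ChartedSpace (EuclideanSpace ℝ (Fin d)) M] [IsManifold (𝓡 d) ∞ M] where
  /-- `cov Z x (Y x)` is `(∇_Y Z)(x)`. -/
  cov : CovariantDerivative (𝓡 d) (EuclideanSpace ℝ (Fin d))
    (TangentSpace (𝓡 d) : M → Type _)
  smooth : cov.ContMDiffCovariantDerivative ∞
  torsion_eq_zero : cov.torsion = 0

section Tangent

variable {d : ℕ} {M : Type u} [TopologicalSpace M] [ChartedSpace (EuclideanSpace ℝ (Fin d)) M]

instance (x : M) : Module.Finite ℝ (TangentSpace (𝓡 d) x) :=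
  inferInstanceAs (Module.Finite ℝ (EuclideanSpace ℝ (Fin d)))

/-- The differential at `x` of a real function, as an element of the cotangent space. -/
def dAt (f : M → ℝ) (x : M) : Module.Dual ℝ (TangentSpace (𝓡 d) x) :=
  (mvfderiv (𝓡 d) f x).toLinearMap

end Tangent

/-- A Poisson tensor: a smooth bivector field `P` such that `{f, g} = P(df, dg)` satisfies the
Jacobi identity. Smoothness is expressed by: `P(df, dg)` is smooth for all smooth `f`, `g`. -/
structure PoissonTensor (d : ℕ) (M : Type u) [TopologicalSpace M]
    [ChartedSpace (EuclideanSpace ℝ (Fin d)) M] where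
  toFun : ∀ x : M, Module.Dual ℝ (TangentSpace (𝓡 d) x) →ₗ[ℝ]
    Module.Dual ℝ (TangentSpace (𝓡 d) x) →ₗ[ℝ] ℝ
  skew : ∀ x α β, toFun x α β = -toFun x β α
  smooth : ∀ f g : M → ℝ, ContMDiff (𝓡 d) 𝓘(ℝ, ℝ) ∞ f → ContMDiff (𝓡 d) 𝓘(ℝ, ℝ) ∞ g →
    ContMDiff (𝓡 d) 𝓘(ℝ, ℝ) ∞ fun x => toFun x (dAt f x) (dAt g x)
  jacobi : ∀ f g h : M → ℝ, ContMDiff (𝓡 d) 𝓘(ℝ, ℝ) ∞ f → ContMDiff (𝓡 d) 𝓘(ℝ, ℝ) ∞ g →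
    ContMDiff (𝓡 d) 𝓘(ℝ, ℝ) ∞ h → ∀ x,
      toFun x (dAt f x) (dAt (fun y => toFun y (dAt g y) (dAt h y)) x) +
      toFun x (dAt g x) (dAt (fun y => toFun y (dAt h y) (dAt f y)) x) +
      toFun x (dAt h x) (dAt (fun y => toFun y (dAt f y) (dAt g y)) x) = 0

/-- The algebra `C^∞(M)` of `𝕜`-valued smooth functions on the real manifold `M`. -/
abbrev SmoothFun (𝕜 : Type v) [RCLike 𝕜] (d : ℕ) (M : Type u) [TopologicalSpace M]
    [ChartedSpace (EuclideanSpace ℝ (Fin d)) M] : Type (max u v) :=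
  C^∞⟮𝓡 d, M; 𝓘(ℝ, 𝕜), 𝕜⟯

instance (𝕜 : Type v) [RCLike 𝕜] : ContMDiffRing 𝓘(ℝ, 𝕜) ∞ 𝕜 :=
  { (inferInstance : LieAddGroup 𝓘(ℝ, 𝕜) ∞ 𝕜) with
    contMDiff_mul := by
      rw [← modelWithCornersSelf_prod, chartedSpaceSelf_prod]
      exact contDiff_mul.contMDiff }

section Operations

variable {d : ℕ} {M : Type u} [TopologicalSpace M] [ChartedSpace (EuclideanSpace ℝ (Fin d)) M]
  {𝕜 : Type v} [RCLike 𝕜]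

/-- The Poisson bracket `P(df, dg)` of real functions. -/
def PoissonTensor.realBracket (P : PoissonTensor d M) (f g : M → ℝ) (x : M) : ℝ :=
  P.toFun x (dAt f x) (dAt g x)

/-- The Poisson bracket of `𝕜`-valued functions: the `𝕜`-bilinear extension of the bracket of
real functions. -/
def PoissonTensor.bracket (P : PoissonTensor d M) (f g : M → 𝕜) (x : M) : 𝕜 :=
  let fr : M → ℝ := fun y => RCLike.re (f y)
  let fi : M → ℝ := fun y => RCLike.im (f y)
  let gr : M → ℝ := fun y => RCLike.re (g y)
  let gi : M → ℝ := fun y => RCLike.im (g y)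
  ((P.realBracket fr gr x - P.realBracket fi gi x : ℝ) : 𝕜) +
    RCLike.I * ((P.realBracket fr gi x + P.realBracket fi gr x : ℝ) : 𝕜)

/-- The Poisson tensor `t P`, `t` real. -/
def PoissonTensor.scale (t : ℝ) (P : PoissonTensor d M) : PoissonTensor d M where
  toFun x := t • P.toFun x
  skew x α β := by simp [P.skew x α β]
  smooth f g hf hg := by
    exact (contMDiff_const (c := t)).mul (P.smooth f g hf hg)
  jacobi f g h hf hg hh x := by
    have key : ∀ a b : M → ℝ, ContMDiff (𝓡 d) 𝓘(ℝ, ℝ) ∞ a → ContMDiff (𝓡 d) 𝓘(ℝ, ℝ) ∞ b →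
        dAt (d := d) (fun y => (t • P.toFun y) (dAt a y) (dAt b y)) x =
          t • dAt (d := d) (fun y => P.toFun y (dAt a y) (dAt b y)) x := by
      intro a b ha hb
      have h1 := ((P.smooth a b ha hb).mdifferentiable (by simp)) x
      refine LinearMap.ext fun w => ?_
      have h2 := congrArg (fun L => L w) (mvfderiv_mul (mdifferentiableAt_const (c := t)) h1)
      simp only [mvfderiv_const] at h2
      simpa [dAt, Pi.mul_def] using h2
    rw [key g h hg hh, key h f hh hf, key f g hf hg]
    have := P.jacobi f g h hf hg hh x
    simp only [LinearMap.smul_apply, map_smul, smul_eq_mul]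
    linear_combination (t * t) * this

/-- The vector field dual to the linear form `α ↦ P(df, α)`, i.e. `X_f = i(df) P`. -/
def PoissonTensor.hamiltonian (P : PoissonTensor d M) (f : M → ℝ) (x : M) :
    TangentSpace (𝓡 d) x :=
  (Module.evalEquiv ℝ (TangentSpace (𝓡 d) x)).symm (P.toFun x (dAt f x))

/-! ### Components in a chart -/

/-- The partial derivative `∂_i F` with respect to the coordinates of the chart `e`. -/
def pd {V : Type*} [NormedAddCommGroup V] [NormedSpace ℝ V]
    (e : OpenPartialHomeomorph M (EuclideanSpace ℝ (Fin d))) (i : Fin d) (F : M → V) (x : M) : V :=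
  fderiv ℝ (F ∘ e.symm) (e x) (EuclideanSpace.single i 1)

/-- The coordinate covector `dx^i` of the chart `e`. -/
def coordCovector (e : OpenPartialHomeomorph M (EuclideanSpace ℝ (Fin d))) (i : Fin d) (x : M) :
    Module.Dual ℝ (TangentSpace (𝓡 d) x) :=
  dAt (fun y => e y i) x

/-- The coordinate vector field `∂_i` of the chart `e` (meaningful on the source of `e`). -/
def coordVector (e : OpenPartialHomeomorph M (EuclideanSpace ℝ (Fin d))) (i : Fin d) (x : M) :
    TangentSpace (𝓡 d) x :=
  (mvfderiv (𝓡 d) e x).inverse (EuclideanSpace.single i 1)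

/-- The components `P^{ij} = P(dx^i, dx^j)`. -/
def PoissonTensor.comp (P : PoissonTensor d M)
    (e : OpenPartialHomeomorph M (EuclideanSpace ℝ (Fin d))) (i j : Fin d) (x : M) : ℝ :=
  P.toFun x (coordCovector e i x) (coordCovector e j x)

/-- A family of components `T^{u_0 … u_{p-1}}_{l_0 … l_{q-1}}` of a tensor field with `q` lower and
`p` upper indices, in some fixed chart. -/
abbrev CompTensor (d : ℕ) (M : Type u) (V : Type*) (q p : ℕ) :=
  (Fin q → Fin d) → (Fin p → Fin d) → M → V

variable [IsManifold (𝓡 d) ∞ M]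

/-- The Christoffel symbols `Γ^k_{ij}`, where `∇_{∂_i} ∂_j = Γ^k_{ij} ∂_k`. -/
def christoffel (D : TorsionFreeConnection d M)
    (e : OpenPartialHomeomorph M (EuclideanSpace ℝ (Fin d))) (k i j : Fin d) (x : M) : ℝ :=
  coordCovector e k x (D.cov (coordVector e j) x (coordVector e i x))

/-- The covariant derivative of a tensor field in components; the new lower index, the direction
of differentiation, is put first. -/
def covD {V : Type*} [NormedAddCommGroup V] [NormedSpace ℝ V] (D : TorsionFreeConnection d M)
    (e : OpenPartialHomeomorph M (EuclideanSpace ℝ (Fin d))) {q p : ℕ}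
    (T : CompTensor d M V q p) : CompTensor d M V (q + 1) p :=
  fun l u x =>
    pd e (l 0) (T (Fin.tail l) u) x
    - ∑ a : Fin q, ∑ m : Fin d,
        christoffel D e m (l 0) (l a.succ) x • T (Function.update (Fin.tail l) a m) u x
    + ∑ b : Fin p, ∑ m : Fin d,
        christoffel D e (u b) (l 0) m x • T (Fin.tail l) (Function.update u b m) x

/-- The components `∇^m_{l_0 … l_{m-1}} f` of the iterated covariant derivatives of a function. -/
def covFun (D : TorsionFreeConnection d M)
    (e : OpenPartialHomeomorph M (EuclideanSpace ℝ (Fin d))) (f : M → 𝕜) :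
    ∀ m : ℕ, CompTensor d M 𝕜 m 0
  | 0 => fun _ _ => f
  | m + 1 => covD D e (covFun D e f m)

/-- The symmetrised covariant derivatives `∇^{sym} f` of order `m`. -/
def symCovFun (D : TorsionFreeConnection d M)
    (e : OpenPartialHomeomorph M (EuclideanSpace ℝ (Fin d))) (f : M → 𝕜) (m : ℕ)
    (l : Fin m → Fin d) (x : M) : 𝕜 :=
  (m.factorial : 𝕜)⁻¹ * ∑ σ : Equiv.Perm (Fin m), covFun D e f m (l ∘ σ) ![] x

/-- The components `(∇^m_{l_0 … l_{m-1}} P)^{u_0 u_1}`. -/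
def covPoisson (D : TorsionFreeConnection d M) (P : PoissonTensor d M)
    (e : OpenPartialHomeomorph M (EuclideanSpace ℝ (Fin d))) :
    ∀ m : ℕ, CompTensor d M ℝ m 2
  | 0 => fun _ u => P.comp e (u 0) (u 1)
  | m + 1 => covD D e (covPoisson D P e m)

/-- The components of the curvature: `R(∂_i, ∂_k) ∂_l = R_{ikl}^j ∂_j`, where
`R(X, Y) Z = ∇_X ∇_Y Z - ∇_Y ∇_X Z - ∇_{[X, Y]} Z`. -/
def curvature (D : TorsionFreeConnection d M)
    (e : OpenPartialHomeomorph M (EuclideanSpace ℝ (Fin d))) (i k l j : Fin d) (x : M) : ℝ :=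
  pd e i (christoffel D e j k l) x - pd e k (christoffel D e j i l) x
  + ∑ m : Fin d, (christoffel D e j i m x * christoffel D e m k l x
      - christoffel D e j k m x * christoffel D e m i l x)

/-- The components of the iterated covariant derivatives of the curvature tensor. -/
def covCurvature (D : TorsionFreeConnection d M)
    (e : OpenPartialHomeomorph M (EuclideanSpace ℝ (Fin d))) :
    ∀ m : ℕ, CompTensor d M ℝ (m + 3) 1
  | 0 => fun l u => curvature D e (l 0) (l 1) (l 2) (u 0)
  | m + 1 => covD D e (covCurvature D e m)

/-! ### The explicit formulas -/

/-- The operator `C₂` in a chart: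
`½ P^{kr} P^{ls} ∇²_{kl} f ∇²_{rs} g + ⅓ P^{kr} ∇_r P^{ls} (∇²_{kl} f ∇_s g + ∇_s f ∇²_{kl} g)
  - ⅙ ∇_l P^{kr} ∇_k P^{ls} ∇_r f ∇_s g`. -/
def formulaC2 (D : TorsionFreeConnection d M) (P : PoissonTensor d M)
    (e : OpenPartialHomeomorph M (EuclideanSpace ℝ (Fin d))) (f g : M → 𝕜) (x : M) : 𝕜 :=
  (1 / 2) * ∑ k : Fin d, ∑ r : Fin d, ∑ l : Fin d, ∑ s : Fin d,
    ((P.comp e k r x * P.comp e l s x : ℝ) : 𝕜) *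
      (covFun D e f 2 ![k, l] ![] x * covFun D e g 2 ![r, s] ![] x)
  + (1 / 3) * ∑ k : Fin d, ∑ r : Fin d, ∑ l : Fin d, ∑ s : Fin d,
    ((P.comp e k r x * covPoisson D P e 1 ![r] ![l, s] x : ℝ) : 𝕜) *
      (covFun D e f 2 ![k, l] ![] x * covFun D e g 1 ![s] ![] x
        + covFun D e f 1 ![s] ![] x * covFun D e g 2 ![k, l] ![] x)
  - (1 / 6) * ∑ k : Fin d, ∑ r : Fin d, ∑ l : Fin d, ∑ s : Fin d,
    ((covPoisson D P e 1 ![l] ![k, r] x * covPoisson D P e 1 ![k] ![l, s] x : ℝ) : 𝕜) *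
      (covFun D e f 1 ![r] ![] x * covFun D e g 1 ![s] ![] x)

/-- The components of the Lie derivative of the connection in the direction of `X_f`:
`(L_{X_f} ∇)^j_{kl} = P^{ij} ∇³_{kli} f + ∇_k P^{ij} ∇²_{li} f + ∇_l P^{ij} ∇²_{ki} f
  + ∇²_{kl} P^{ij} ∇_i f + R_{ikl}^j P^{si} ∇_s f`. -/
def lieConn (D : TorsionFreeConnection d M) (P : PoissonTensor d M)
    (e : OpenPartialHomeomorph M (EuclideanSpace ℝ (Fin d))) (f : M → 𝕜) (j k l : Fin d)
    (x : M) : 𝕜 :=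
  ∑ i : Fin d,
    ((P.comp e i j x : 𝕜) * covFun D e f 3 ![k, l, i] ![] x
      + (covPoisson D P e 1 ![k] ![i, j] x : 𝕜) * covFun D e f 2 ![l, i] ![] x
      + (covPoisson D P e 1 ![l] ![i, j] x : 𝕜) * covFun D e f 2 ![k, i] ![] x
      + (covPoisson D P e 2 ![k, l] ![i, j] x : 𝕜) * covFun D e f 1 ![i] ![] x)
  + ∑ i : Fin d, ∑ s : Fin d,
    ((curvature D e i k l j x * P.comp e s i x : ℝ) : 𝕜) * covFun D e f 1 ![s] ![] x

/-- The operator `C₃` in a chart: `-⅙ P^{ls} (L_{X_f} ∇)^j_{kl} (L_{X_g} ∇)^k_{js}`. -/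
def formulaC3 (D : TorsionFreeConnection d M) (P : PoissonTensor d M)
    (e : OpenPartialHomeomorph M (EuclideanSpace ℝ (Fin d))) (f g : M → 𝕜) (x : M) : 𝕜 :=
  -(1 / 6) * ∑ l : Fin d, ∑ s : Fin d, ∑ j : Fin d, ∑ k : Fin d,
    (P.comp e l s x : 𝕜) * (lieConn D P e f j k l x * lieConn D P e g k j s x)

/-- The Lie derivative of the connection, as an operation on vector fields:
`(L_X ∇)(Y, Z) = [X, ∇_Y Z] - ∇_{[X, Y]} Z - ∇_Y [X, Z]`. -/
def lieDerivConnection (D : TorsionFreeConnection d M)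
    (X Y Z : ∀ x : M, TangentSpace (𝓡 d) x) (x : M) : TangentSpace (𝓡 d) x :=
  VectorField.mlieBracket (𝓡 d) X (fun y => D.cov Z y (Y y)) x
    - D.cov Z x (VectorField.mlieBracket (𝓡 d) X Y x)
    - D.cov (VectorField.mlieBracket (𝓡 d) X Z) x (Y x)

end Operations

/-! ### Universal polynomials in `P`, `R`, their covariant derivatives and `∇^{sym} f_i` -/

/-- The vertices of a monomial with `nP` factors `P`, `nR` factors `R` and `n` functions. -/
abbrev Vertex (nP nR n : ℕ) := Fin nP ⊕ Fin nR ⊕ Fin n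

/-- The number of lower indices of a factor: `∇^m P` has `m`, `∇^m R` has `m + 3`, and the
symmetrised covariant derivative of order `m` of a function has `m`. -/
def lowerArity {nP nR n : ℕ} (derP : Fin nP → ℕ) (derR : Fin nR → ℕ) (ord : Fin n → ℕ) :
    Vertex nP nR n → ℕ
  | .inl a => derP a
  | .inr (.inl b) => derR b + 3
  | .inr (.inr c) => ord c

/-- The number of upper indices of a factor. -/
def upperArity {nP nR n : ℕ} : Vertex nP nR n → ℕ
  | .inl _ => 2
  | .inr (.inl _) => 1
  | .inr (.inr _) => 0

/-- A universal monomial in `n` functions: a product of factors `∇^m P`, `∇^m R` and one factor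
`∇^{sym} f_c` for each function, all of whose indices are contracted: every lower index is paired
with an upper index. -/
structure UnivMonomial (n : ℕ) where
  nP : ℕ
  nR : ℕ
  derP : Fin nP → ℕ
  derR : Fin nR → ℕ
  ord : Fin n → ℕ
  contraction : ((w : Vertex nP nR n) × Fin (lowerArity derP derR ord w)) ≃
    ((w : Vertex nP nR n) × Fin (upperArity w))

/-- No factor is contracted with itself. -/
def UnivMonomial.NoLoop {n : ℕ} (W : UnivMonomial n) : Prop :=
  ∀ s, (W.contraction s).1 ≠ s.1

/-- A universal polynomial, with constant real coefficients. -/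
abbrev UnivPoly (n : ℕ) := List (ℝ × UnivMonomial n)

section Eval

variable {d : ℕ} {M : Type u} [TopologicalSpace M] [ChartedSpace (EuclideanSpace ℝ (Fin d)) M]
  [IsManifold (𝓡 d) ∞ M] {𝕜 : Type v} [RCLike 𝕜]

/-- The component of a factor with prescribed lower and upper indices. -/
def UnivMonomial.factor {n : ℕ} (W : UnivMonomial n) (D : TorsionFreeConnection d M)
    (P : PoissonTensor d M) (e : OpenPartialHomeomorph M (EuclideanSpace ℝ (Fin d)))
    (f : Fin n → M → 𝕜) (x : M) :
    ∀ w : Vertex W.nP W.nR n, (Fin (lowerArity W.derP W.derR W.ord w) → Fin d) →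
      (Fin (upperArity w) → Fin d) → 𝕜
  | .inl a => fun l u => (covPoisson D P e (W.derP a) l u x : 𝕜)
  | .inr (.inl b) => fun l u => (covCurvature D e (W.derR b) l u x : 𝕜)
  | .inr (.inr c) => fun l _ => symCovFun D e (f c) (W.ord c) l x

/-- The value of a monomial: the sum over all values of the contracted indices. -/
def UnivMonomial.eval {n : ℕ} (W : UnivMonomial n) (D : TorsionFreeConnection d M)
    (P : PoissonTensor d M) (e : OpenPartialHomeomorph M (EuclideanSpace ℝ (Fin d)))
    (f : Fin n → M → 𝕜) (x : M) : 𝕜 :=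
  ∑ idx : ((w : Vertex W.nP W.nR n) × Fin (lowerArity W.derP W.derR W.ord w)) → Fin d,
    ∏ w : Vertex W.nP W.nR n, W.factor D P e f x w
      (fun a => idx ⟨w, a⟩) (fun b => idx (W.contraction.symm ⟨w, b⟩))

/-- The value of a universal polynomial, computed in the chart `e`. -/
def UnivPoly.eval {n : ℕ} (U : UnivPoly n) (D : TorsionFreeConnection d M)
    (P : PoissonTensor d M) (e : OpenPartialHomeomorph M (EuclideanSpace ℝ (Fin d)))
    (f : Fin n → M → 𝕜) (x : M) : 𝕜 :=
  (U.map fun c => (c.1 : 𝕜) * c.2.eval D P e f x).sum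

end Eval

/-! ### Universal bidifferential operators and universal star products -/

/-- An association, to every smooth manifold `M` with a torsionfree connection and a Poisson
tensor, of a map `C^∞(M) × C^∞(M) → C^∞(M)`. -/
abbrev BidiffFamily (𝕜 : Type v) [RCLike 𝕜] : Type (max (u + 1) v) :=
  ∀ (d : ℕ) (M : Type u) [TopologicalSpace M] [T2Space M]
    [ChartedSpace (EuclideanSpace ℝ (Fin d)) M] [IsManifold (𝓡 d) ∞ M],
    TorsionFreeConnection d M → PoissonTensor d M →
      SmoothFun 𝕜 d M → SmoothFun 𝕜 d M → SmoothFun 𝕜 d M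

/-- `C` is a universal Poisson-related bidifferential operator of no-loop type: it is given by one
universal polynomial of no-loop type, on all manifolds and in all charts. -/
def IsUniversalNoLoop {𝕜 : Type v} [RCLike 𝕜] (C : BidiffFamily.{u} 𝕜) : Prop :=
  ∃ U : UnivPoly 2, (∀ c ∈ U, c.2.NoLoop) ∧
    ∀ (d : ℕ) (M : Type u) [TopologicalSpace M] [T2Space M]
      [ChartedSpace (EuclideanSpace ℝ (Fin d)) M] [IsManifold (𝓡 d) ∞ M]
      (D : TorsionFreeConnection d M) (P : PoissonTensor d M) (f g : SmoothFun 𝕜 d M),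
      ∀ e ∈ Charts d M, ∀ x ∈ e.source, C d M D P f g x = U.eval D P e ![f, g] x

/-- `C` is a polynomial of degree `r` in the Poisson structure. -/
def IsPolynomialOfDegree {𝕜 : Type v} [RCLike 𝕜] (r : ℕ) (C : BidiffFamily.{u} 𝕜) : Prop :=
  ∀ (d : ℕ) (M : Type u) [TopologicalSpace M] [T2Space M]
    [ChartedSpace (EuclideanSpace ℝ (Fin d)) M] [IsManifold (𝓡 d) ∞ M]
    (D : TorsionFreeConnection d M) (P : PoissonTensor d M) (t : ℝ) (f g : SmoothFun 𝕜 d M)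
    (x : M), C d M D (P.scale t) f g x = (t : 𝕜) ^ r * C d M D P f g x

section Star

variable {d : ℕ} {M : Type u} [TopologicalSpace M] [ChartedSpace (EuclideanSpace ℝ (Fin d)) M]
  {𝕜 : Type v} [RCLike 𝕜]

/-- The iterated partial derivative `∂_{I_0} … ∂_{I_{m-1}} F` in the chart `e`. -/
def iterPd (e : OpenPartialHomeomorph M (EuclideanSpace ℝ (Fin d))) {m : ℕ} (I : Fin m → Fin d)
    (F : M → 𝕜) (x : M) : 𝕜 :=
  iteratedFDeriv ℝ m (F ∘ e.symm) (e x) fun a => EuclideanSpace.single (I a) 1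

/-- `B` is a bidifferential operator (of some finite order `N` in each argument). -/
def IsBidifferential (B : SmoothFun 𝕜 d M → SmoothFun 𝕜 d M → SmoothFun 𝕜 d M) : Prop :=
  ∃ N : ℕ, ∀ e ∈ Charts d M,
    ∃ a : ∀ p q : ℕ, (Fin p → Fin d) → (Fin q → Fin d) → M → 𝕜,
      (∀ p q I J, ContMDiffOn (𝓡 d) 𝓘(ℝ, 𝕜) ∞ (a p q I J) e.source) ∧
      ∀ f g : SmoothFun 𝕜 d M, ∀ x ∈ e.source,
        B f g x = ∑ p ∈ Finset.range (N + 1), ∑ q ∈ Finset.range (N + 1),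
          ∑ I : Fin p → Fin d, ∑ J : Fin q → Fin d,
            a p q I J x * (iterPd e I f x * iterPd e J g x)

/-- The `𝕜[[ν]]`-bilinear extension of `f * g = ∑_r ν^r C_r(f, g)` to `C^∞(M)[[ν]]`. -/
def star (C : ℕ → SmoothFun 𝕜 d M → SmoothFun 𝕜 d M → SmoothFun 𝕜 d M)
    (F G : PowerSeries (SmoothFun 𝕜 d M)) : PowerSeries (SmoothFun 𝕜 d M) :=
  PowerSeries.mk fun n => ∑ a ∈ Finset.HasAntidiagonal.antidiagonal n, ∑ b ∈ Finset.HasAntidiagonal.antidiagonal a.2,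
    C a.1 (PowerSeries.coeff b.1 F) (PowerSeries.coeff b.2 G)

/-- `∑_{r ≤ N} ν^r C_r` is a differential star product up to order `N` on the Poisson manifold
`(M, P)`. -/
structure IsStarProductUpTo (N : ℕ) (P : PoissonTensor d M)
    (C : ℕ → SmoothFun 𝕜 d M → SmoothFun 𝕜 d M → SmoothFun 𝕜 d M) : Prop where
  zero_order : ∀ f g, C 0 f g = f * g
  assoc : ∀ F G H : PowerSeries (SmoothFun 𝕜 d M), ∀ n ≤ N,
    PowerSeries.coeff n (star C (star C F G) H) = PowerSeries.coeff n (star C F (star C G H))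
  first_order : ∀ f g x, C 1 f g x - C 1 g f x = 2 * P.bracket f g x
  bidifferential : ∀ r, 1 ≤ r → r ≤ N → IsBidifferential (C r)
  const_left : ∀ r, 1 ≤ r → r ≤ N → ∀ (c : 𝕜) (g : SmoothFun 𝕜 d M),
    C r (ContMDiffMap.const c) g = 0
  const_right : ∀ r, 1 ≤ r → r ≤ N → ∀ (c : 𝕜) (f : SmoothFun 𝕜 d M),
    C r f (ContMDiffMap.const c) = 0

end Star

/-- A universal star product up to order `N`: a differential star product up to order `N` for every
`(M, ∇, P)`, whose `r`-th cochain is a universal Poisson-related bidifferential operator of no-loop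
type which is a polynomial of degree `r` in the Poisson structure. -/
structure IsUniversalStarProductUpTo {𝕜 : Type v} [RCLike 𝕜] (N : ℕ)
    (C : ℕ → BidiffFamily.{u} 𝕜) : Prop where
  isStarProduct : ∀ (d : ℕ) (M : Type u) [TopologicalSpace M] [T2Space M]
    [ChartedSpace (EuclideanSpace ℝ (Fin d)) M] [IsManifold (𝓡 d) ∞ M]
    (D : TorsionFreeConnection d M) (P : PoissonTensor d M),
    IsStarProductUpTo N P fun r => C r d M D P
  universal : ∀ r, 1 ≤ r → r ≤ N → IsUniversalNoLoop (C r)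
  degree : ∀ r, 1 ≤ r → r ≤ N → IsPolynomialOfDegree r (C r)

end UnivStar

end

open UnivStar

/-! In a chart all objects live over a commutative ring of smooth functions with commuting
derivations, symmetric Christoffel symbols and a Poisson matrix; `PoissonFrame` isolates this
algebra. Denominators are avoided: `c2` and `c3` are six times the cochains. `c2` is written with
traces of products of the Hessian, `P` and `gradP` (∇P contracted with a differential); the skewness
of `P` accounts for the signs.

Order two (`assoc_two`). The Hessian violates the Leibniz rule by df ⊗ dg + dg ⊗ df, while `gradP`
obeys it. Hence the deviation of C₂ from a derivation consists of terms ∇²h(X_f, X_g) and (∇_{X_f}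
P)(dg, dh) (`c2_mul`), and the double brackets expand into terms of the same two kinds (`ad_ad`). In
the associator the Hessian terms cancel, and a multiple of the cyclic sum of (∇_{X_f} P)(dg, dh)
remains, which vanishes by the Jacobi identity.

Order three (`assoc_three`). A Hamiltonian field X_h preserves P, so the Lie derivative of the
operator C₂ along X_h sees only the change L_{X_h} ∇ of the connection: {h, ·} fails to be a
derivation of C₂ by -`variation` (`along_c2`). On the other side, f ↦ L_{X_f} ∇ fails to be a
derivation by the terms `cross`, and pairing these with L_{X_h} ∇ produces the same -`variation`
(`pair_cross_add`, `c3_mul`). Since C₂ is symmetric and C₃ is antisymmetric, the two defects cancel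
in the third-order associator. Associativity modulo ν⁴ of the bilinear extension is then formal
(`star_assoc_of_hochschild`).

Globalisation. The cochains agree on overlaps of charts because each factor is tensorial
(`Transition`). For L_X ∇ this needs no separate computation: its contraction with df is the defect
in the Lie derivative of the Hessian, all of whose ingredients have known transformation laws. The
five-term formula (`lie_ham`) is ∇²X + R·X for X = X_f, and it agrees with the geometric Lie
derivative of the connection by a computation on coordinate vector fields.

Universality. Only symmetrised derivatives are admitted as factors. First and second derivatives are
already symmetric, and the Ricci identity expresses ∇³f through its symmetrisation and a curvature
term, so that L_{X_f} ∇ becomes a combination of seven tensor contractions with three free indices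
(`lieDiagram`). Joining two of them by a further factor P never contracts a factor with itself, and
C₃ is the resulting sum over 49 pairs. -/

set_option linter.unusedSectionVars false

noncomputable section

namespace UnivStar

/-! ### Poisson calculus with a connection over a commutative ring with commuting derivations -/

/-- Coordinate derivations, Christoffel symbols and a Poisson matrix over a commutative ring. -/
structure PoissonFrame (ι : Type*) [Fintype ι] (A : Type*) [CommRing A] [Algebra ℝ A] where
  del : ι → Derivation ℝ A A
  del_comm : ∀ i j f, del i (del j f) = del j (del i f)
  Γ : ι → ι → ι → A
  Γ_symm : ∀ k i j, Γ k i j = Γ k j i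
  P : Matrix ι ι A
  skew : ∀ i j, P i j = -P j i
  jacobi : ∀ a b c, ∑ i, (P a i * del i (P b c) + P b i * del i (P c a)
    + P c i * del i (P a b)) = 0

namespace PoissonFrame

open Matrix

variable {ι : Type*} [Fintype ι] {A : Type*} [CommRing A] [Algebra ℝ A]

/-! ### Derivations acting on matrices and traces -/

section Derivations

theorem map_derivation_mul (D : Derivation ℝ A A) (M N : Matrix ι ι A) :
    (M * N).map D = M.map D * N + M * N.map D := by
  ext i j
  simp only [Matrix.map_apply, Matrix.mul_apply, Matrix.add_apply, map_sum, Derivation.leibniz,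
    smul_eq_mul, ← Finset.sum_add_distrib]
  exact Finset.sum_congr rfl fun k _ => by ring

theorem derivation_trace (D : Derivation ℝ A A) (M : Matrix ι ι A) :
    D M.trace = (M.map D).trace := by
  simp [Matrix.trace]

end Derivations

/-! ### Hamiltonian fields, covariant derivatives and Lie derivatives in a frame -/

variable (F : PoissonFrame ι A)

/-- The derivation `X^i ∂_i`. -/
def along (X : ι → A) : Derivation ℝ A A := ∑ i, X i • F.del i

theorem along_apply (X : ι → A) (f : A) : F.along X f = ∑ i, X i * F.del i f := by
  have : ∀ s : Finset ι, (∑ i ∈ s, X i • F.del i) f = ∑ i ∈ s, X i * F.del i f := by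
    intro s
    classical
    induction s using Finset.induction_on with
    | empty => simp
    | insert a s ha ih => simp [Finset.sum_insert ha, ih]
  exact this _

/-- The components `P^{ij} ∂_i f` of the Hamiltonian vector field. -/
def ham (f : A) (j : ι) : A := ∑ i, F.P i j * F.del i f

/-- The derivation along the Hamiltonian vector field of `f`, i.e. `{f, ·}`. -/
def ad (f : A) : Derivation ℝ A A := F.along (F.ham f)

/-- The matrix `∂_k X^i`. -/
def jac (X : ι → A) : Matrix ι ι A := of fun k i => F.del k (X i)

/-- The covariant Hessian. -/
def hess (f : A) : Matrix ι ι A :=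
  of fun k l => F.del k (F.del l f) - ∑ m, F.Γ m k l * F.del m f

/-- The components `∇_r P^{ls}`. -/
def covP (r l s : ι) : A :=
  F.del r (F.P l s) + ∑ m, F.Γ l r m * F.P m s + ∑ m, F.Γ s r m * F.P l m

/-- The matrix `(l, r) ↦ ∇_r P^{ls} ∂_s g`. -/
def gradP (g : A) : Matrix ι ι A := of fun l r => ∑ s, F.covP r l s * F.del s g

/-- The components `(L_X ∇)^j_{kl}` in terms of the Christoffel symbols. -/
def lie (X : ι → A) (j k l : ι) : A :=
  F.del k (F.del l (X j)) + ∑ i, (X i * F.del i (F.Γ j k l) - F.Γ i k l * F.del i (X j)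
    + F.Γ j i l * F.del k (X i) + F.Γ j k i * F.del l (X i))

/-- The matrix `(k, l) ↦ S^m_{kl} ∂_m f` for `S = L_X ∇`. -/
def lieGrad (X : ι → A) (f : A) : Matrix ι ι A := of fun k l => ∑ m, F.lie X m k l * F.del m f

/-- The matrix `(l, r) ↦ S^l_{rm} Y^m` for `S = L_X ∇`. -/
def lieContr (X Y : ι → A) : Matrix ι ι A := of fun l r => ∑ m, F.lie X l r m * Y m

/-- Six times the second cochain. -/
def c2 (f g : A) : A :=
  -3 * (F.hess f * F.P * F.hess g * F.P).trace - 2 * (F.hess f * F.gradP g * F.P).trace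
    - 2 * (F.hess g * F.gradP f * F.P).trace - (F.gradP f * F.gradP g).trace

/-- The pairing `-P^{ls} S^j_{kl} T^k_{js}`. -/
def pair (S T : ι → ι → ι → A) : A :=
  -∑ l, ∑ s, ∑ j, ∑ k, F.P l s * (S j k l * T k j s)

/-- Six times the third cochain. -/
def c3 (f g : A) : A := F.pair (F.lie (F.ham f)) (F.lie (F.ham g))

theorem hess_symm (f : A) : (F.hess f)ᵀ = F.hess f := by
  ext k l
  simp [hess, F.del_comm l k, F.Γ_symm _ l k]

theorem P_transpose : F.Pᵀ = -F.P := by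
  ext k l
  simp [F.skew l k]

/-- This is where torsionfreeness enters: with symmetric Christoffel symbols the two terms
containing first derivatives of X along k and l are exchanged. -/
theorem lie_symm (X : ι → A) (j k l : ι) : F.lie X j k l = F.lie X j l k := by
  simp only [lie, F.del_comm k l, F.Γ_symm j k, F.Γ_symm _ k l]
  congr 1
  refine Finset.sum_congr rfl fun i _ => ?_
  rw [F.Γ_symm j i k, F.Γ_symm j i l]; ring

/-- The coordinate derivations commute, so the commutator of ∂_k with X only differentiates the
coefficients of X. -/
theorem del_along (X : ι → A) (k : ι) (f : A) :
    F.del k (F.along X f) = F.along X (F.del k f) + ∑ i, F.jac X k i * F.del i f := by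
  simp only [along_apply, map_sum, Derivation.leibniz, smul_eq_mul, jac, of_apply,
    ← Finset.sum_add_distrib]
  exact Finset.sum_congr rfl fun i _ => by rw [F.del_comm k i]; ring

theorem lie_eq (X : ι → A) (m k l : ι) :
    F.lie X m k l = F.del k (F.del l (X m)) + F.along X (F.Γ m k l)
      - ∑ i, F.Γ i k l * F.jac X i m + ∑ i, F.jac X k i * F.Γ m i l
      + ∑ i, F.jac X l i * F.Γ m k i := by
  simp only [lie, along_apply, jac, of_apply, add_assoc, sub_eq_add_neg,
    ← Finset.sum_neg_distrib, ← Finset.sum_add_distrib]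
  congr 1
  exact Finset.sum_congr rfl fun i _ => by ring

/-- The Lie derivative of the Hessian. -/
theorem hess_map_along (X : ι → A) (f : A) :
    (F.hess f).map (F.along X) = F.hess (F.along X f) - F.jac X * F.hess f
      - F.hess f * (F.jac X)ᵀ - F.lieGrad X f := by
  -- Moving X out of two derivatives leaves the Jacobian terms and ∂_k ∂_l X^i; the latter is the
  -- leading term of `lie`.
  have h1 : ∀ k l, F.del k (F.del l (F.along X f)) = F.along X (F.del k (F.del l f))
      + ∑ i, (F.jac X k i * F.del i (F.del l f) + F.jac X l i * F.del i (F.del k f)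
      + F.del k (F.del l (X i)) * F.del i f) := by
    intro k l
    rw [del_along, map_add, del_along, map_sum, add_assoc, ← Finset.sum_add_distrib]
    congr 1
    refine Finset.sum_congr rfl fun i _ => ?_
    simp only [Derivation.leibniz, smul_eq_mul, jac, of_apply]
    rw [F.del_comm k i]; ring
  ext k l
  simp only [hess, lieGrad, Matrix.map_apply, Matrix.sub_apply, Matrix.mul_apply, of_apply,
    transpose_apply, h1, map_sub, map_sum, Derivation.leibniz, smul_eq_mul]
  simp only [del_along, lie_eq, add_mul, sub_mul, mul_add, mul_sub, Finset.sum_add_distrib,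
    Finset.sum_sub_distrib, Finset.mul_sum, Finset.sum_mul]
  -- What is left are double sums that differ only in the order of summation and the names of the
  -- bound indices.
  have e1 := Finset.sum_comm (s := Finset.univ) (t := Finset.univ)
    (f := fun i m => F.jac X k i * (F.Γ m i l * F.del m f))
  have e2 := Finset.sum_comm (s := Finset.univ) (t := Finset.univ)
    (f := fun i m => F.Γ m k i * F.del m f * F.jac X l i)
  have e3 := Finset.sum_comm (s := Finset.univ) (t := Finset.univ)
    (f := fun i m => F.Γ i k l * F.jac X i m * F.del m f)
  simp only [mul_assoc, mul_comm, mul_left_comm, F.del_comm _ k] at e1 e2 e3 ⊢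
  linear_combination e3 - e1 - e2

/-- A vector field preserves the Poisson matrix. -/
def IsPoisson (X : ι → A) : Prop :=
  F.P.map (F.along X) = (F.jac X)ᵀ * F.P + F.P * F.jac X

/-- The Lie derivative of `∇P` along a vector field that preserves `P`. -/
theorem along_covP {X : ι → A} (hX : F.IsPoisson X) (r l s : ι) :
    F.along X (F.covP r l s) = -∑ i, F.jac X r i * F.covP i l s
      + ∑ i, F.jac X i l * F.covP r i s + ∑ i, F.jac X i s * F.covP r l i
      + ∑ m, (F.lie X l r m * F.P m s + F.lie X s r m * F.P l m) := by
  have hP : ∀ l s, F.along X (F.P l s) = ∑ i, F.jac X i l * F.P i s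
      + ∑ i, F.P l i * F.jac X i s := fun l s => by
    simpa [Matrix.mul_apply] using congrFun (congrFun hX l) s
  have h1 : F.along X (F.del r (F.P l s)) = F.del r (F.along X (F.P l s))
      - ∑ i, F.jac X r i * F.del i (F.P l s) := by
    rw [del_along]; ring
  have h2 : ∀ i j, F.del r (F.jac X i j) = F.del r (F.del i (X j)) := fun i j => rfl
  simp only [covP, map_add, map_sum, Derivation.leibniz, smul_eq_mul, h1, hP, lie_eq, h2,
    mul_add, add_mul, sub_mul, Finset.sum_add_distrib, Finset.sum_sub_distrib,
    Finset.mul_sum, Finset.sum_mul]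
  have e1 := Finset.sum_comm (s := Finset.univ) (t := Finset.univ)
    (f := fun i m => F.jac X r i * (F.Γ l i m * F.P m s))
  have e2 := Finset.sum_comm (s := Finset.univ) (t := Finset.univ)
    (f := fun i m => F.jac X r i * (F.Γ s i m * F.P l m))
  have e3 := Finset.sum_comm (s := Finset.univ) (t := Finset.univ)
    (f := fun i m => F.jac X i l * (F.Γ i r m * F.P m s))
  have e4 := Finset.sum_comm (s := Finset.univ) (t := Finset.univ)
    (f := fun i m => F.jac X i s * (F.Γ i r m * F.P l m))
  have e5 := Finset.sum_comm (s := Finset.univ) (t := Finset.univ)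
    (f := fun i m => F.jac X i l * (F.Γ s r m * F.P i m))
  have e6 := Finset.sum_comm (s := Finset.univ) (t := Finset.univ)
    (f := fun i m => F.jac X i s * (F.Γ l r m * F.P m i))
  have e7 := Finset.sum_comm (s := Finset.univ) (t := Finset.univ)
    (f := fun i m => F.jac X i m * (F.Γ l r m * F.P i s))
  have e8 := Finset.sum_comm (s := Finset.univ) (t := Finset.univ)
    (f := fun i m => F.jac X i m * (F.Γ s r m * F.P l i))
  simp only [mul_assoc, mul_comm, mul_left_comm] at e1 e2 e3 e4 e5 e6 e7 e8 ⊢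
  linear_combination e1 + e2 - e3 - e4 - e5 - e6 - e7 - e8

theorem along_del (X : ι → A) (f : A) (s : ι) :
    F.along X (F.del s f) = F.del s (F.along X f) - ∑ i, F.jac X s i * F.del i f := by
  rw [del_along]; ring

/-- The Lie derivative of `∇P` contracted with a differential. -/
theorem gradP_map_along {X : ι → A} (hX : F.IsPoisson X) (g : A) :
    (F.gradP g).map (F.along X) = F.gradP (F.along X g) + (F.jac X)ᵀ * F.gradP g
      - F.gradP g * (F.jac X)ᵀ + F.P * F.lieGrad X g - F.lieContr X (F.ham g) := by
  ext l r
  have hY : ∀ m, F.ham g m = -∑ s, F.P m s * F.del s g := fun m => by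
    simp only [ham, ← Finset.sum_neg_distrib, F.skew m, neg_mul, neg_neg]
  simp only [gradP, lieGrad, lieContr, Matrix.map_apply, Matrix.sub_apply, Matrix.add_apply,
    Matrix.mul_apply, of_apply, transpose_apply, map_sum, Derivation.leibniz, smul_eq_mul,
    along_covP F hX, along_del, hY]
  simp only [mul_add, mul_sub, Finset.sum_add_distrib, mul_neg,
    Finset.sum_sub_distrib, Finset.mul_sum, Finset.sum_mul, Finset.sum_neg_distrib]
  have e1 := Finset.sum_comm (s := Finset.univ) (t := Finset.univ)
    (f := fun i m => F.jac X r i * (F.covP i l m * F.del m g))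
  have e2 := Finset.sum_comm (s := Finset.univ) (t := Finset.univ)
    (f := fun i m => F.jac X i l * (F.covP r i m * F.del m g))
  have e3 := Finset.sum_comm (s := Finset.univ) (t := Finset.univ)
    (f := fun i m => F.jac X i m * (F.covP r l i * F.del m g))
  have e4 := Finset.sum_comm (s := Finset.univ) (t := Finset.univ)
    (f := fun i m => F.lie X l r i * (F.P i m * F.del m g))
  have e5 := Finset.sum_comm (s := Finset.univ) (t := Finset.univ)
    (f := fun i m => F.lie X m r i * (F.P l i * F.del m g))
  -- The index r is the first lower index of S in `along_covP` and the second one in `lieGrad`; the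
  -- symmetry of S aligns them.
  simp only [F.lie_symm X _ _ r] at e5 ⊢
  simp only [mul_assoc, mul_comm, mul_left_comm] at e1 e2 e3 e4 e5 ⊢
  linear_combination e1 - e2 - e3 - e4 - e5

theorem isPoisson_ham (h : A) : F.IsPoisson (F.ham h) := by
  ext l s
  -- The Jacobi identity of the matrix, contracted with dh, supplies all terms with a derivative of
  -- P.
  have key : ∑ a, F.del a h * ∑ i, (F.P a i * F.del i (F.P l s) + F.P l i * F.del i (F.P s a)
      + F.P s i * F.del i (F.P a l)) = 0 := by simp [F.jacobi]
  -- The terms with second derivatives of h cancel, the second derivatives being symmetric and P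
  -- skew.
  have e0 : ∑ i, ∑ a, F.P a l * F.P i s * F.del i (F.del a h)
      = -∑ i, ∑ a, F.P l i * F.P a s * F.del i (F.del a h) := by
    rw [Finset.sum_comm, ← Finset.sum_neg_distrib]
    refine Finset.sum_congr rfl fun i _ => ?_
    rw [← Finset.sum_neg_distrib]
    refine Finset.sum_congr rfl fun a _ => ?_
    rw [F.del_comm a i, F.skew i l]; ring
  simp only [Matrix.map_apply, along_apply, ham, Matrix.add_apply, Matrix.mul_apply, jac,
    of_apply, transpose_apply, map_sum, Derivation.leibniz, smul_eq_mul]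
  simp only [mul_add, add_mul, Finset.sum_add_distrib, Finset.mul_sum, Finset.sum_mul]
    at key e0 ⊢
  simp only [F.skew s, Derivation.map_neg, mul_neg, neg_mul, Finset.sum_neg_distrib] at key
  have e1 := Finset.sum_comm (s := Finset.univ) (t := Finset.univ)
    (f := fun i a => F.P a i * F.del a h * F.del i (F.P l s))
  have e2 := Finset.sum_comm (s := Finset.univ) (t := Finset.univ)
    (f := fun i a => F.P i s * F.del a h * F.del i (F.P a l))
  have e3 := Finset.sum_comm (s := Finset.univ) (t := Finset.univ)
    (f := fun i a => F.P l i * F.del a h * F.del i (F.P a s))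
  simp only [mul_assoc, mul_comm, mul_left_comm] at key e0 e1 e2 e3 ⊢
  linear_combination key - e0 + e1 - e2 - e3

end PoissonFrame
-- The second cochain under a vector field preserving P
namespace PoissonFrame

open Matrix

variable {ι : Type*} [Fintype ι] {A : Type*} [CommRing A] [Algebra ℝ A] (F : PoissonFrame ι A)

/-- The trace form of the variation of the second cochain under a variation of the connection by
`L_X ∇`. -/
def variation (X : ι → A) (f g : A) : A :=
  -2 * (F.lieContr X (F.ham g) * F.P * F.hess f).trace
    - 2 * (F.lieContr X (F.ham f) * F.P * F.hess g).trace
    - (F.gradP g * F.P * F.lieGrad X f).trace - (F.gradP f * F.P * F.lieGrad X g).trace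
    - (F.lieGrad X f * F.P * F.hess g * F.P).trace - (F.lieGrad X g * F.P * F.hess f * F.P).trace
    - (F.lieContr X (F.ham f) * F.gradP g).trace - (F.lieContr X (F.ham g) * F.gradP f).trace

omit [Algebra ℝ A] in
/-- The variation of the traces in the second cochain. -/
theorem trace_variation (P B H K Q R σ τ V W : Matrix ι ι A) :
    -3 * ((((-(B * H) - H * Bᵀ - σ) * P * K * P).trace + (H * (Bᵀ * P + P * B) * K * P).trace
        + (H * P * (-(B * K) - K * Bᵀ - τ) * P).trace + (H * P * K * (Bᵀ * P + P * B)).trace))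
      - 2 * (((-(B * H) - H * Bᵀ - σ) * R * P).trace
        + (H * (Bᵀ * R - R * Bᵀ + P * τ - W) * P).trace + (H * R * (Bᵀ * P + P * B)).trace)
      - 2 * (((-(B * K) - K * Bᵀ - τ) * Q * P).trace
        + (K * (Bᵀ * Q - Q * Bᵀ + P * σ - V) * P).trace + (K * Q * (Bᵀ * P + P * B)).trace)
      - (((Bᵀ * Q - Q * Bᵀ + P * σ - V) * R).trace + (Q * (Bᵀ * R - R * Bᵀ + P * τ - W)).trace)
      = -(-2 * (W * P * H).trace - 2 * (V * P * K).trace - (R * P * σ).trace - (Q * P * τ).trace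
        - (σ * P * K * P).trace - (τ * P * H * P).trace - (V * R).trace - (W * Q).trace) := by
  -- B acts as an infinitesimal linear change of coordinates, under which complete contractions are
  -- invariant: a1 to a4 are the cyclic rotations that cancel every term with B. The rotations a5 to
  -- a12 bring the surviving words in σ, τ, V, W to the form on the right.
  have a1 := trace_mul_comm B (H * (P * (K * P)))
  have a2 := trace_mul_comm B (H * (R * P))
  have a3 := trace_mul_comm B (K * (Q * P))
  have a4 := trace_mul_comm Bᵀ (Q * R)
  have a5 := trace_mul_comm (H * P) (τ * P)
  have a6 := trace_mul_comm (K * P) (σ * P)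
  have a7 := trace_mul_comm σ (R * P)
  have a8 := trace_mul_comm τ (Q * P)
  have a9 := trace_mul_comm H (W * P)
  have a10 := trace_mul_comm K (V * P)
  have a11 := trace_mul_comm (P * σ) R
  have a12 := trace_mul_comm Q W
  simp only [Matrix.mul_add, Matrix.add_mul, Matrix.mul_sub, Matrix.sub_mul, Matrix.trace_add,
    Matrix.trace_sub, Matrix.neg_mul, Matrix.mul_neg, Matrix.trace_neg, Matrix.mul_assoc] at *
  linear_combination 3 * a1 + 2 * a2 + 2 * a3 - a4 + a5 - 2 * a6 + 2 * a7 + 2 * a8 + 2 * a9 + 2 * a10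
    - a11 + a12

theorem c2_eq (f g : A) : F.c2 f g =
  -3 * (F.hess f * F.P * F.hess g * F.P).trace - 2 * (F.hess f * F.gradP g * F.P).trace
    - 2 * (F.hess g * F.gradP f * F.P).trace - (F.gradP f * F.gradP g).trace := rfl

theorem hess_add (f g : A) : F.hess (f + g) = F.hess f + F.hess g := by
  ext k l
  simp only [hess, of_apply, map_add, Matrix.add_apply, mul_add, Finset.sum_add_distrib]
  ring

theorem gradP_add (f g : A) : F.gradP (f + g) = F.gradP f + F.gradP g := by
  ext k l
  simp only [gradP, of_apply, map_add, Matrix.add_apply, mul_add, Finset.sum_add_distrib]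

/-- A vector field preserving `P` acts on the second cochain through the Lie derivative of the
connection only. -/
theorem along_c2 {X : ι → A} (hX : F.IsPoisson X) (f g : A) :
    F.along X (F.c2 f g) = F.c2 (F.along X f) g + F.c2 f (F.along X g) - F.variation X f g := by
  have key := trace_variation F.P (F.jac X) (F.hess f) (F.hess g) (F.gradP f) (F.gradP g)
    (F.lieGrad X f) (F.lieGrad X g) (F.lieContr X (F.ham f)) (F.lieContr X (F.ham g))
  have hP : F.P.map (F.along X) = _ := hX
  have d3 : (F.along X) 3 = 0 := Derivation.map_natCast _ 3
  have d2 : (F.along X) 2 = 0 := Derivation.map_natCast _ 2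
  simp only [c2_eq, variation, map_sub, Derivation.leibniz, smul_eq_mul, derivation_trace,
    map_derivation_mul, hess_map_along, gradP_map_along F hX, hP, neg_mul, Derivation.map_neg, d2, d3]
  -- Split off the matrix belonging to the function X f; it produces `c2 (X f) g`, and the remainder
  -- has the shape required by `trace_variation`.
  have h1 : ∀ f, F.hess (F.along X f) - F.jac X * F.hess f - F.hess f * (F.jac X)ᵀ - F.lieGrad X f
    = F.hess (F.along X f) + (-(F.jac X * F.hess f) - F.hess f * (F.jac X)ᵀ - F.lieGrad X f) := by
    intro f; abel
  have h2 : ∀ f, F.gradP (F.along X f) + (F.jac X)ᵀ * F.gradP f - F.gradP f * (F.jac X)ᵀ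
      + F.P * F.lieGrad X f - F.lieContr X (F.ham f)
    = F.gradP (F.along X f) + ((F.jac X)ᵀ * F.gradP f - F.gradP f * (F.jac X)ᵀ
      + F.P * F.lieGrad X f - F.lieContr X (F.ham f)) := by
    intro f; abel
  simp only [h1, h2]
  simp only [Matrix.add_mul (F.hess _), Matrix.mul_add _ (F.hess _), Matrix.add_mul (F.gradP _),
    Matrix.mul_add _ (F.gradP _), Matrix.trace_add, Matrix.mul_add, Matrix.add_mul]
  simp only [Matrix.mul_add, Matrix.add_mul, Matrix.trace_add] at key
  linear_combination key

/-! ### Product rules -/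

theorem hess_mul (f g : A) : F.hess (f * g) = f • F.hess g + g • F.hess f
    + of (fun k l => F.del k f * F.del l g + F.del k g * F.del l f) := by
  ext k l
  simp only [hess, of_apply, Matrix.add_apply, Matrix.smul_apply, Derivation.leibniz, smul_eq_mul,
    map_add, mul_add, Finset.sum_add_distrib, mul_sub, Finset.mul_sum]
  simp only [mul_comm, mul_left_comm]
  ring

theorem gradP_mul (f g : A) : F.gradP (f * g) = f • F.gradP g + g • F.gradP f := by
  ext k l
  simp only [gradP, of_apply, Matrix.add_apply, Matrix.smul_apply, Derivation.leibniz, smul_eq_mul,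
    mul_add, Finset.sum_add_distrib, Finset.mul_sum]
  simp only [mul_left_comm]

theorem ham_mul (f g : A) : F.ham (f * g) = f • F.ham g + g • F.ham f := by
  ext k
  simp only [ham, Pi.add_apply, Pi.smul_apply, Derivation.leibniz, smul_eq_mul,
    mul_add, Finset.sum_add_distrib, Finset.mul_sum]
  simp only [mul_left_comm]

theorem lie_add (X Y : ι → A) (j k l : ι) :
    F.lie (X + Y) j k l = F.lie X j k l + F.lie Y j k l := by
  simp only [lie, Pi.add_apply, map_add, add_mul, mul_add, sub_eq_add_neg, neg_add,
    Finset.sum_add_distrib, Finset.sum_neg_distrib]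
  ring

/-- The matrix `(j, l) ↦ ∇_l X^j`. -/
def nab (X : ι → A) : Matrix ι ι A := of fun j l => F.del l (X j) + ∑ m, F.Γ j l m * X m

/-- L_X ∇ is ∇²X plus a curvature term that is linear in X over functions, so the deviation from
linearity is that of the second covariant derivative of a product: df ⊗ ∇X symmetrised, and Hess f ⊗
X. -/
theorem lie_smul (f : A) (X : ι → A) (j k l : ι) :
    F.lie (f • X) j k l = f * F.lie X j k l + F.del k f * F.nab X j l + F.del l f * F.nab X j k
      + F.hess f k l * X j := by
  simp only [lie, nab, hess, of_apply, Pi.smul_apply, Derivation.leibniz, smul_eq_mul,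
    map_add, mul_add, sub_mul, mul_sub, Finset.sum_add_distrib, Finset.sum_sub_distrib,
    Finset.mul_sum, Finset.sum_mul, F.Γ_symm j _ l]
  simp only [mul_assoc, mul_comm, mul_left_comm]
  ring

/-- The Leibniz rule for the contraction of P with dg. The sign appears because `ham` contracts the
first index of P, whereas `gradP` and the matrix product contract the second. -/
theorem nab_ham (g : A) : F.nab (F.ham g) = -(F.gradP g + F.P * F.hess g) := by
  ext j l
  have hY : ∀ m, F.ham g m = -∑ s, F.P m s * F.del s g := fun m => by
    simp only [ham, ← Finset.sum_neg_distrib, F.skew m, neg_mul, neg_neg]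
  simp only [nab, gradP, hess, covP, of_apply, hY, Matrix.neg_apply, Matrix.add_apply,
    Matrix.mul_apply, map_sum, Derivation.leibniz, smul_eq_mul, Derivation.map_neg]
  simp only [add_mul, mul_sub, mul_neg, Finset.sum_add_distrib,
    Finset.sum_sub_distrib, Finset.sum_neg_distrib, Finset.mul_sum, Finset.sum_mul]
  have e1 := Finset.sum_comm (s := Finset.univ) (t := Finset.univ)
    (f := fun i m => F.Γ j l i * (F.P i m * F.del m g))
  have e2 := Finset.sum_comm (s := Finset.univ) (t := Finset.univ)
    (f := fun i m => F.P j i * (F.Γ m i l * F.del m g))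
  simp only [F.Γ_symm _ _ l] at e1 e2 ⊢
  simp only [mul_assoc, mul_comm, mul_left_comm, F.del_comm _ l] at e1 e2 ⊢
  linear_combination -e1 - e2

end PoissonFrame
-- Associativity identities of orders two and three
namespace PoissonFrame

open Matrix

variable {ι : Type*} [Fintype ι] {A : Type*} [CommRing A] [Algebra ℝ A] (F : PoissonFrame ι A)

theorem c2_symm (f g : A) : F.c2 f g = F.c2 g f := by
  simp only [c2]
  rw [trace_mul_comm (F.gradP f) (F.gradP g), Matrix.mul_assoc, trace_mul_comm,
    ← Matrix.mul_assoc]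
  ring

theorem ad_apply (f g : A) : F.ad f g = ∑ i, F.ham f i * F.del i g := along_apply ..

theorem ad_eq_sum (f g : A) : F.ad f g = ∑ i, ∑ j, F.P i j * (F.del i f * F.del j g) := by
  rw [ad_apply, Finset.sum_comm]
  simp only [ham, Finset.sum_mul, mul_assoc]

theorem ad_skew (f g : A) : F.ad f g = -F.ad g f := by
  rw [ad_eq_sum, ad_eq_sum, Finset.sum_comm, ← Finset.sum_neg_distrib]
  refine Finset.sum_congr rfl fun i _ => ?_
  rw [← Finset.sum_neg_distrib]
  refine Finset.sum_congr rfl fun j _ => ?_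
  rw [F.skew j i]; ring

theorem ham_add (f g : A) : F.ham (f + g) = F.ham f + F.ham g := by
  ext k
  simp only [ham, Pi.add_apply, map_add, mul_add, Finset.sum_add_distrib]

theorem ad_add (f g h : A) : F.ad (f + g) h = F.ad f h + F.ad g h := by
  simp only [ad_apply, ham_add, Pi.add_apply, add_mul, Finset.sum_add_distrib]

theorem ad_mul (f g h : A) : F.ad (f * g) h = f * F.ad g h + g * F.ad f h := by
  rw [ad_skew, Derivation.leibniz, F.ad_skew h, F.ad_skew h]
  simp only [smul_eq_mul]; ring

/-- The Jacobi identity for functions: X_h preserves P, and its Jacobian terms on P cancel those on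
df and dg. -/
theorem ad_leibniz (h f g : A) : F.ad h (F.ad f g) = F.ad (F.ad h f) g + F.ad f (F.ad h g) := by
  have hX := F.isPoisson_ham h
  have hP : ∀ l s, F.ad h (F.P l s) = ∑ i, F.jac (F.ham h) i l * F.P i s
      + ∑ i, F.P l i * F.jac (F.ham h) i s := fun l s => by
    simpa [Matrix.mul_apply, ad] using congrFun (congrFun hX l) s
  have hd : ∀ f s, F.ad h (F.del s f) = F.del s (F.ad h f)
      - ∑ i, F.jac (F.ham h) s i * F.del i f := fun f s => F.along_del _ f s
  rw [F.ad_eq_sum f, F.ad_eq_sum _ g, F.ad_eq_sum f]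
  simp only [map_sum, Derivation.leibniz, smul_eq_mul, hP, hd, mul_add, mul_sub,
    Finset.sum_add_distrib, Finset.sum_sub_distrib, Finset.mul_sum]
  have e1 : ∑ i, ∑ j, ∑ k, F.P i j * (F.del i f * (F.jac (F.ham h) j k * F.del k g))
      = ∑ i, ∑ j, ∑ k, F.del i f * F.del j g * (F.P i k * F.jac (F.ham h) k j) := by
    refine Finset.sum_congr rfl fun i _ => ?_
    rw [Finset.sum_comm]
    exact Finset.sum_congr rfl fun j _ => Finset.sum_congr rfl fun k _ => by ring
  have e2 : ∑ i, ∑ j, ∑ k, F.P i j * (F.del j g * (F.jac (F.ham h) i k * F.del k f))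
      = ∑ i, ∑ j, ∑ k, F.del i f * F.del j g * (F.jac (F.ham h) k i * F.P k j) := by
    calc _ = ∑ i, ∑ k, ∑ j, F.P i j * (F.del j g * (F.jac (F.ham h) i k * F.del k f)) :=
          Finset.sum_congr rfl fun i _ => Finset.sum_comm
      _ = ∑ k, ∑ i, ∑ j, F.P i j * (F.del j g * (F.jac (F.ham h) i k * F.del k f)) :=
          Finset.sum_comm
      _ = _ := by
          refine Finset.sum_congr rfl fun i _ => ?_
          rw [Finset.sum_comm]
          exact Finset.sum_congr rfl fun j _ => Finset.sum_congr rfl fun k _ => by ring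
  simp only [mul_assoc, mul_comm, mul_left_comm] at e1 e2 ⊢
  linear_combination -e1 - e2

/-- `(∇_{X_f} P)(dg, dh)`. -/
def nablaP (f g h : A) : A := ∑ l, ∑ r, F.ham f r * (F.del l g * F.gradP h l r)

/-- `∇²h(X_f, X_g)`. -/
def hessHam (h f g : A) : A := ∑ k, ∑ l, F.ham f k * F.ham g l * F.hess h k l

theorem covP_skew (r l s : ι) : F.covP r l s = -F.covP r s l := by
  simp only [covP, F.skew l, F.skew _ s, map_neg, mul_neg, Finset.sum_neg_distrib]
  ring

theorem nablaP_skew (f g h : A) : F.nablaP f g h = -F.nablaP f h g := by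
  simp only [nablaP, gradP, of_apply, Finset.mul_sum, ← Finset.sum_neg_distrib]
  rw [Finset.sum_comm]
  calc _ = ∑ r, ∑ s, ∑ l, F.ham f r * (F.del l g * (F.covP r l s * F.del s h)) :=
        Finset.sum_congr rfl fun r _ => Finset.sum_comm
    _ = ∑ r, ∑ l, ∑ s, -(F.ham f r * (F.del l h * (F.covP r l s * F.del s g))) := by
        refine Finset.sum_congr rfl fun r _ => Finset.sum_congr rfl fun l _ =>
          Finset.sum_congr rfl fun s _ => ?_
        rw [F.covP_skew r s l]; ring
    _ = _ := Finset.sum_comm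

/-- The derivative of P(dg, dh) is computed covariantly, with one term for each of the three
factors; the Christoffel symbols cancel because the contraction is complete. -/
theorem del_ad (k : ι) (g h : A) : F.del k (F.ad g h) = ∑ j, (F.ham g j * F.hess h k j
    - F.del j h * F.gradP g j k) - ∑ l, F.ham h l * F.hess g k l := by
  have h1 : ∀ j, F.del k (F.ham g j) = -(F.gradP g j k + ∑ l, F.P j l * F.hess g l k)
      - ∑ m, F.Γ j k m * F.ham g m := by
    intro j
    have := congrFun (congrFun (F.nab_ham g) j) k
    simp only [nab, of_apply, Matrix.neg_apply, Matrix.add_apply, Matrix.mul_apply] at this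
    linear_combination this
  have h2 : ∀ j, F.del k (F.del j h) = F.hess h k j + ∑ m, F.Γ m k j * F.del m h := by
    intro j
    simp [hess]
  rw [ad_apply]
  simp only [map_sum, Derivation.leibniz, smul_eq_mul, h1, h2]
  simp only [mul_add, mul_sub, mul_neg, Finset.sum_add_distrib, Finset.sum_sub_distrib,
    Finset.sum_neg_distrib, Finset.mul_sum]
  have e1 : ∑ j, ∑ l, F.del j h * (F.P j l * F.hess g l k) = ∑ l, F.ham h l * F.hess g k l := by
    rw [Finset.sum_comm]
    refine Finset.sum_congr rfl fun l _ => ?_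
    rw [← Matrix.transpose_apply (F.hess g), hess_symm, ham, Finset.sum_mul]
    exact Finset.sum_congr rfl fun j _ => by ring
  have e2 : ∑ j, ∑ m, F.ham g j * (F.Γ m k j * F.del m h)
      = ∑ j, ∑ m, F.del j h * (F.Γ j k m * F.ham g m) := by
    rw [Finset.sum_comm]
    exact Finset.sum_congr rfl fun j _ => Finset.sum_congr rfl fun m _ => by ring
  linear_combination e2 - e1

/-- Together with `c2_mul` this puts the whole second-order associator into two kinds of terms, ∇P
and Hessians evaluated on Hamiltonian fields. -/
theorem ad_ad (f g h : A) :
    F.ad f (F.ad g h) = F.nablaP f g h - F.hessHam g f h + F.hessHam h f g := by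
  rw [nablaP_skew, ad_apply]
  simp only [del_ad, nablaP, hessHam, mul_sub, Finset.sum_sub_distrib, Finset.mul_sum]
  rw [Finset.sum_comm (f := fun l r => F.ham f r * (F.del l h * F.gradP g l r))]
  simp only [mul_assoc]
  ring

/-- The components of the differential. -/
def grad (f : A) (k : ι) : A := F.del k f

theorem trace_vecMulVec_mul {R : Type*} [CommRing R] (u v : ι → R) (M : Matrix ι ι R) :
    (vecMulVec u v * M).trace = v ⬝ᵥ M *ᵥ u := by
  rw [vecMulVec_eq Unit, Matrix.mul_assoc, trace_mul_comm, Matrix.mul_assoc,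
    ← replicateCol_mulVec]
  simp [Matrix.trace, Matrix.mul_apply, dotProduct]

theorem grad_vecMul_P (f : A) : F.grad f ᵥ* F.P = F.ham f := by
  ext j
  simp [vecMul, dotProduct, ham, grad, mul_comm]

theorem P_mulVec_grad (f : A) : F.P *ᵥ F.grad f = -F.ham f := by
  rw [← neg_neg F.P, ← P_transpose, neg_mulVec, mulVec_transpose, grad_vecMul_P]

theorem hessHam_eq (f g h : A) : F.hessHam h f g = F.ham f ⬝ᵥ F.hess h *ᵥ F.ham g := by
  simp only [hessHam, dotProduct, mulVec, Finset.mul_sum]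
  exact Finset.sum_congr rfl fun k _ => Finset.sum_congr rfl fun l _ => by ring

theorem hessHam_symm (f g h : A) : F.hessHam h f g = F.hessHam h g f := by
  rw [hessHam_eq, hessHam_eq, dotProduct_mulVec, ← mulVec_transpose, hess_symm, dotProduct_comm]

theorem nablaP_eq (f g h : A) : F.nablaP f g h = F.grad g ⬝ᵥ F.gradP h *ᵥ F.ham f := by
  simp only [nablaP, dotProduct, mulVec, Finset.mul_sum, grad]
  exact Finset.sum_congr rfl fun k _ => Finset.sum_congr rfl fun l _ => by ring

/-- A rank-one factor turns the trace into a bilinear form. Multiplying a gradient by P gives X_f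
from the left and -X_f from the right, hence the sign. -/
theorem trace_P_hess_P (f g h : A) :
    (vecMulVec (F.grad f) (F.grad g) * F.P * F.hess h * F.P).trace = -F.hessHam h f g := by
  rw [hessHam_symm, hessHam_eq, Matrix.mul_assoc, Matrix.mul_assoc, trace_vecMulVec_mul,
    dotProduct_mulVec, ← vecMul_vecMul, ← dotProduct_mulVec, ← mulVec_mulVec, P_mulVec_grad,
    grad_vecMul_P, mulVec_neg, dotProduct_neg]

theorem trace_gradP_P (f g h : A) :
    (vecMulVec (F.grad f) (F.grad g) * F.gradP h * F.P).trace = -F.nablaP f g h := by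
  rw [nablaP_eq, Matrix.mul_assoc, trace_vecMulVec_mul, ← mulVec_mulVec, P_mulVec_grad,
    mulVec_neg, dotProduct_neg]

theorem hess_mul' (f g : A) : F.hess (f * g) = f • F.hess g + g • F.hess f
    + vecMulVec (F.grad f) (F.grad g) + vecMulVec (F.grad g) (F.grad f) := by
  rw [hess_mul]
  ext k l
  simp [vecMulVec, grad]; ring

theorem c2_mul (f g h : A) : F.c2 (f * g) h = f * F.c2 g h + g * F.c2 f h
    + 6 * F.hessHam h f g + 2 * (F.nablaP f g h + F.nablaP g f h) := by
  have e1 := F.trace_P_hess_P f g h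
  have e2 := F.trace_P_hess_P g f h
  have e3 := F.trace_gradP_P f g h
  have e4 := F.trace_gradP_P g f h
  rw [F.hessHam_symm g f] at e2
  simp only [c2, hess_mul', gradP_mul, Matrix.add_mul, Matrix.mul_add, Matrix.smul_mul,
    Matrix.mul_smul, Matrix.trace_add, Matrix.trace_smul, smul_eq_mul]
  linear_combination -3 * e1 - 3 * e2 - 2 * e3 - 2 * e4

/-- Associativity at the second order. -/
theorem assoc_two (f g h : A) :
    F.c2 (f * g) h + 6 * F.ad (F.ad f g) h + F.c2 f g * h
      = F.c2 f (g * h) + 6 * F.ad f (F.ad g h) + f * F.c2 g h := by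
  -- After `ad_ad` and the symmetry of Hessians, Jacobi says that the cyclic sum of (∇_{X_f} P)(dg,
  -- dh) is zero. In the associator this cyclic sum occurs with coefficient 2 - 6 = -4: the 2 comes
  -- from `c2_mul` and the 6 from the double brackets.
  have j := F.ad_leibniz f g h
  rw [F.ad_skew (F.ad f g) h, F.ad_skew f g, Derivation.map_neg, F.ad_skew f h,
    Derivation.map_neg, F.ad_ad f g h, F.ad_ad h g f, F.ad_ad g h f] at j
  rw [F.c2_symm f (g * h), c2_mul, c2_mul, F.ad_skew (F.ad f g) h, F.ad_ad f g h, F.ad_ad h f g,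
    F.c2_symm h f, F.c2_symm g f]
  rw [F.nablaP_skew h g f, F.nablaP_skew g h f] at *
  have s1 := F.hessHam_symm f g h
  have s2 := F.hessHam_symm h f g
  have s3 := F.hessHam_symm g h f
  linear_combination -4 * j + 4 * s1 - 2 * s2 - 2 * s3

/-- `H_f ⊗ X_g + df ∇X_g`, one half of the deviation of `L_{X_{fg}} ∇` from a derivation. -/
def cross (f g : A) (j k l : ι) : A :=
  F.del k f * F.nab (F.ham g) j l + F.del l f * F.nab (F.ham g) j k + F.hess f k l * F.ham g j

theorem lie_ham_mul (f g : A) (j k l : ι) : F.lie (F.ham (f * g)) j k l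
    = f * F.lie (F.ham g) j k l + g * F.lie (F.ham f) j k l + F.cross f g j k l
      + F.cross g f j k l := by
  rw [ham_mul, lie_add, lie_smul, lie_smul, cross, cross]
  ring

/-- Exchanging S and T amounts to renaming j, k and l, s, and P is skew in l, s. -/
theorem pair_skew (S T : ι → ι → ι → A) : F.pair S T = -F.pair T S := by
  have h : ∑ l, ∑ s, ∑ j, ∑ k, F.P l s * (T j k l * S k j s)
      = ∑ l, ∑ s, ∑ j, ∑ k, -(F.P l s * (S j k l * T k j s)) := by
    calc _ = ∑ s, ∑ l, ∑ j, ∑ k, F.P l s * (T j k l * S k j s) := Finset.sum_comm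
      _ = ∑ s, ∑ l, ∑ k, ∑ j, F.P l s * (T j k l * S k j s) :=
          Finset.sum_congr rfl fun s _ => Finset.sum_congr rfl fun l _ => Finset.sum_comm
      _ = _ := by
          refine Finset.sum_congr rfl fun s _ => Finset.sum_congr rfl fun l _ =>
            Finset.sum_congr rfl fun k _ => Finset.sum_congr rfl fun j _ => ?_
          rw [F.skew l s]; ring
  simp only [pair, h, Finset.sum_neg_distrib, neg_neg]

theorem pair_add (S S' T : ι → ι → ι → A) : F.pair (S + S') T = F.pair S T + F.pair S' T := by
  simp only [pair, Pi.add_apply, add_mul, mul_add, Finset.sum_add_distrib]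
  ring

theorem pair_smul (a : A) (S T : ι → ι → ι → A) : F.pair (a • S) T = a * F.pair S T := by
  simp only [pair, Pi.smul_apply, smul_eq_mul, Finset.mul_sum, mul_neg]
  congr 1
  exact Finset.sum_congr rfl fun l _ => Finset.sum_congr rfl fun s _ =>
    Finset.sum_congr rfl fun j _ => Finset.sum_congr rfl fun k _ => by ring

/-- The three summands of `cross` give one trace each; in this form they can be compared with
`variation`. -/
theorem pair_cross (f g : A) (X : ι → A) : F.pair (F.cross f g) (F.lie X)
    = (F.lieContr X (F.ham g) * F.P * F.hess f).trace
      - (F.nab (F.ham g) * F.P * F.lieGrad X f).trace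
      - (F.nab (F.ham g) * F.lieContr X (F.ham f)).trace := by
  have e1 : ∑ l, ∑ s, ∑ j, ∑ k, F.P l s * (F.hess f k l * F.ham g j * F.lie X k j s)
      = -(F.lieContr X (F.ham g) * F.P * F.hess f).trace := by
    -- Transposing reverses the word, fixes the Hessian and changes the sign of P.
    have h : (F.lieContr X (F.ham g) * F.P * F.hess f).trace
      = -(F.hess f * F.P * (F.lieContr X (F.ham g))ᵀ).trace := by
      rw [← trace_transpose, transpose_mul, transpose_mul, hess_symm, P_transpose]
      simp [Matrix.mul_assoc]
    rw [h, neg_neg]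
    simp only [Matrix.trace, Matrix.diag, Matrix.mul_apply, transpose_apply, lieContr, of_apply,
      Finset.mul_sum, Finset.sum_mul]
    calc _ = ∑ l, ∑ s, ∑ k, ∑ j, F.P l s * (F.hess f k l * F.ham g j * F.lie X k j s) :=
          Finset.sum_congr rfl fun l _ => Finset.sum_congr rfl fun s _ => Finset.sum_comm
      _ = ∑ l, ∑ k, ∑ s, ∑ j, F.P l s * (F.hess f k l * F.ham g j * F.lie X k j s) :=
          Finset.sum_congr rfl fun l _ => Finset.sum_comm
      _ = ∑ k, ∑ l, ∑ s, ∑ j, F.P l s * (F.hess f k l * F.ham g j * F.lie X k j s) :=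
          Finset.sum_comm
      _ = ∑ k, ∑ s, ∑ l, ∑ j, F.P l s * (F.hess f k l * F.ham g j * F.lie X k j s) :=
          Finset.sum_congr rfl fun k _ => Finset.sum_comm
      _ = ∑ k, ∑ s, ∑ j, ∑ l, F.P l s * (F.hess f k l * F.ham g j * F.lie X k j s) :=
          Finset.sum_congr rfl fun k _ => Finset.sum_congr rfl fun s _ => Finset.sum_comm
      _ = _ := by
          refine Finset.sum_congr rfl fun k _ => Finset.sum_congr rfl fun s _ =>
            Finset.sum_congr rfl fun j _ => Finset.sum_congr rfl fun l _ => ?_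
          rw [F.lie_symm X k j s]; ring
  have e2 : ∑ l, ∑ s, ∑ j, ∑ k, F.P l s * (F.del k f * F.nab (F.ham g) j l * F.lie X k j s)
      = (F.nab (F.ham g) * F.P * F.lieGrad X f).trace := by
    simp only [Matrix.trace, Matrix.diag, Matrix.mul_apply, lieGrad, of_apply,
      Finset.mul_sum, Finset.sum_mul]
    calc _ = ∑ s, ∑ l, ∑ j, ∑ k, F.P l s * (F.del k f * F.nab (F.ham g) j l * F.lie X k j s) :=
          Finset.sum_comm
      _ = ∑ s, ∑ j, ∑ l, ∑ k, F.P l s * (F.del k f * F.nab (F.ham g) j l * F.lie X k j s) :=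
          Finset.sum_congr rfl fun s _ => Finset.sum_comm
      _ = ∑ j, ∑ s, ∑ l, ∑ k, F.P l s * (F.del k f * F.nab (F.ham g) j l * F.lie X k j s) :=
          Finset.sum_comm
      _ = ∑ j, ∑ s, ∑ k, ∑ l, F.P l s * (F.del k f * F.nab (F.ham g) j l * F.lie X k j s) :=
          Finset.sum_congr rfl fun j _ => Finset.sum_congr rfl fun s _ => Finset.sum_comm
      _ = _ := by
          refine Finset.sum_congr rfl fun j _ => Finset.sum_congr rfl fun s _ =>
            Finset.sum_congr rfl fun k _ => Finset.sum_congr rfl fun l _ => ?_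
          rw [F.lie_symm X k j s]; ring
  have e3 : ∑ l, ∑ s, ∑ j, ∑ k, F.P l s * (F.del l f * F.nab (F.ham g) j k * F.lie X k j s)
      = (F.nab (F.ham g) * F.lieContr X (F.ham f)).trace := by
    simp only [Matrix.trace, Matrix.diag, Matrix.mul_apply, lieContr, ham, of_apply,
      Finset.mul_sum]
    calc _ = ∑ s, ∑ l, ∑ j, ∑ k, F.P l s * (F.del l f * F.nab (F.ham g) j k * F.lie X k j s) :=
          Finset.sum_comm
      _ = ∑ s, ∑ j, ∑ l, ∑ k, F.P l s * (F.del l f * F.nab (F.ham g) j k * F.lie X k j s) :=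
          Finset.sum_congr rfl fun s _ => Finset.sum_comm
      _ = ∑ j, ∑ s, ∑ l, ∑ k, F.P l s * (F.del l f * F.nab (F.ham g) j k * F.lie X k j s) :=
          Finset.sum_comm
      _ = ∑ j, ∑ s, ∑ k, ∑ l, F.P l s * (F.del l f * F.nab (F.ham g) j k * F.lie X k j s) :=
          Finset.sum_congr rfl fun j _ => Finset.sum_congr rfl fun s _ => Finset.sum_comm
      _ = ∑ j, ∑ k, ∑ s, ∑ l, F.P l s * (F.del l f * F.nab (F.ham g) j k * F.lie X k j s) :=
          Finset.sum_congr rfl fun j _ => Finset.sum_comm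
      _ = _ := by
          refine Finset.sum_congr rfl fun j _ => Finset.sum_congr rfl fun k _ =>
            Finset.sum_congr rfl fun s _ => Finset.sum_congr rfl fun l _ => ?_
          ring
  simp only [pair, cross, add_mul, mul_add, Finset.sum_add_distrib, e1, e2, e3]
  ring

/-- The heart of the third order. Replacing ∇X_g by -(∇P dg + P Hess g) splits two of the traces.
The traces of `lieContr` with P and a Hessian then arise twice, from the Hessian part of `cross` and
from this substitution, which accounts for the coefficient 2 in `variation`. -/
theorem pair_cross_add (f g : A) (X : ι → A) :
    F.pair (F.cross f g) (F.lie X) + F.pair (F.cross g f) (F.lie X) = -F.variation X f g := by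
  have a1 := trace_mul_comm (F.gradP g) (F.lieContr X (F.ham f))
  have a2 := trace_mul_comm (F.gradP f) (F.lieContr X (F.ham g))
  have a3 := trace_mul_comm (F.P * F.hess g) (F.P * F.lieGrad X f)
  have a4 := trace_mul_comm (F.P * F.hess f) (F.P * F.lieGrad X g)
  have a5 := trace_mul_comm (F.P * F.hess g) (F.lieContr X (F.ham f))
  have a6 := trace_mul_comm (F.P * F.hess f) (F.lieContr X (F.ham g))
  have a7 := trace_mul_comm F.P (F.lieGrad X f * (F.P * F.hess g))
  have a8 := trace_mul_comm F.P (F.lieGrad X g * (F.P * F.hess f))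
  rw [pair_cross, pair_cross, variation, nab_ham, nab_ham]
  simp only [Matrix.neg_mul, Matrix.add_mul, Matrix.trace_add, Matrix.trace_neg,
    Matrix.mul_assoc] at *
  linear_combination a1 + a2 + a3 + a4 + a5 + a6 + a7 + a8

theorem c3_skew (f g : A) : F.c3 f g = -F.c3 g f := F.pair_skew _ _

/-- The defect of C₃ in its first argument is the same -`variation` by which {h, ·} fails to be a
derivation of C₂. -/
theorem c3_mul (f g h : A) :
    F.c3 (f * g) h = f * F.c3 g h + g * F.c3 f h - F.variation (F.ham h) f g := by
  have e : F.lie (F.ham (f * g)) = f • F.lie (F.ham g) + g • F.lie (F.ham f) + F.cross f g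
      + F.cross g f := by
    ext j k l
    exact F.lie_ham_mul f g j k l
  rw [c3, e, pair_add, pair_add, pair_add, pair_smul, pair_smul, add_assoc, pair_cross_add, ← sub_eq_add_neg]
  rfl

theorem ad_c2 (h f g : A) :
    F.ad h (F.c2 f g) = F.c2 (F.ad h f) g + F.c2 f (F.ad h g) - F.variation (F.ham h) f g :=
  F.along_c2 (F.isPoisson_ham h) f g

theorem c2_neg (f g : A) : F.c2 (-f) g = -F.c2 f g := by
  have h1 : F.hess (-f) = -F.hess f := by
    ext k l
    simp [hess, sub_eq_add_neg, Finset.sum_neg_distrib, add_comm]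
  have h2 : F.gradP (-f) = -F.gradP f := by
    ext k l
    simp [gradP]
  simp only [c2, h1, h2, Matrix.neg_mul, Matrix.mul_neg, Matrix.trace_neg]
  ring

/-- Associativity at the third order. -/
theorem assoc_three (f g h : A) :
    F.c3 (f * g) h + F.c2 (F.ad f g) h + F.ad (F.c2 f g) h + F.c3 f g * h
      = F.c3 f (g * h) + F.c2 f (F.ad g h) + F.ad f (F.c2 g h) + f * F.c3 g h := by
  -- On the left the variations along X_h from `c3 (f * g) h` and from the bracket of `c2 f g` with
  -- h cancel; on the right so do the variations along X_f. Only the symmetry of `c2` and the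
  -- skewness of `c3` and of the bracket are needed afterwards.
  rw [F.c3_skew f (g * h), c3_mul, c3_mul, F.ad_skew (F.c2 f g), ad_c2, ad_c2, F.c3_skew h f,
    F.c3_skew g f, F.ad_skew h f, F.ad_skew h g, c2_neg, F.c2_symm f (-_), c2_neg,
    F.c2_symm (F.ad f h) g, F.c2_symm (F.ad g h) f]
  ring

theorem c2_add (f g h : A) : F.c2 (f + g) h = F.c2 f h + F.c2 g h := by
  simp only [c2, hess_add, gradP_add, Matrix.add_mul, Matrix.mul_add, Matrix.trace_add]
  ring

theorem c3_add (f g h : A) : F.c3 (f + g) h = F.c3 f h + F.c3 g h := by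
  have : F.lie (F.ham (f + g)) = F.lie (F.ham f) + F.lie (F.ham g) := by
    ext j k l
    rw [ham_add, lie_add]; rfl
  rw [c3, this, pair_add]
  rfl

end PoissonFrame
-- Independence of the cochains of the coordinates
namespace PoissonFrame

open Matrix

variable {ι : Type*} [Fintype ι] [DecidableEq ι] {A : Type*} [CommRing A] [Algebra ℝ A]

/-- Two frames that describe the same Poisson tensor and connection in coordinates whose
differentials are related by the Jacobian matrix `∂_k y^a`. -/
structure Transition (F F' : PoissonFrame ι A) where
  y : ι → A
  K : Matrix ι ι A
  del_eq : ∀ k f, F.del k f = ∑ a, F.del k (y a) * F'.del a f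
  del'_y : ∀ a b, F'.del a (y b) = if a = b then 1 else 0
  inv : (of fun k a => F.del k (y a)) * K = 1
  P_eq : F'.P = (of fun k a => F.del k (y a))ᵀ * F.P * of fun k a => F.del k (y a)
  Γ_eq : ∀ k l c, ∑ a, ∑ b, F.del k (y a) * (F.del l (y b) * F'.Γ c a b)
    = ∑ j, F.del j (y c) * F.Γ j k l - F.del k (F.del l (y c))

namespace Transition

variable {F F' : PoissonFrame ι A} (t : Transition F F')

/-- The Jacobian matrix. -/
def J : Matrix ι ι A := of fun k a => F.del k (t.y a)

theorem grad_eq (f : A) : F.grad f = t.J *ᵥ F'.grad f := by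
  ext k
  exact t.del_eq k f

/-- The second derivatives of y produced by the chain rule cancel against the inhomogeneous term in
the transformation law of the Christoffel symbols. -/
theorem hess_eq (f : A) : F.hess f = t.J * F'.hess f * t.Jᵀ := by
  ext k l
  have h1 : F.del k (F.del l f) = ∑ b, (F'.del b f * F.del k (F.del l (t.y b)))
      + ∑ b, ∑ a, F.del l (t.y b) * (F.del k (t.y a) * F'.del a (F'.del b f)) := by
    rw [t.del_eq l f, map_sum, ← Finset.sum_add_distrib]
    refine Finset.sum_congr rfl fun b _ => ?_
    rw [Derivation.leibniz, smul_eq_mul, smul_eq_mul, t.del_eq k (F'.del b f), Finset.mul_sum,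
      add_comm]
  have h2 : ∑ m, F.Γ m k l * F.del m f
      = ∑ c, F'.del c f * ∑ a, ∑ b, F.del k (t.y a) * (F.del l (t.y b) * F'.Γ c a b)
      + ∑ b, (F'.del b f * F.del k (F.del l (t.y b))) := by
    simp only [t.Γ_eq, mul_sub, Finset.sum_sub_distrib, sub_add_cancel, Finset.mul_sum]
    rw [Finset.sum_comm]
    refine Finset.sum_congr rfl fun m _ => ?_
    rw [t.del_eq m f, Finset.mul_sum]
    exact Finset.sum_congr rfl fun c _ => by ring
  simp only [hess, J, mul_apply, of_apply, transpose_apply, h1, h2, Finset.sum_mul, mul_sub,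
    sub_mul, Finset.sum_sub_distrib, Finset.mul_sum]
  have e1 : ∑ c, ∑ a, ∑ b, F'.del c f * (F.del k (t.y a) * (F.del l (t.y b) * F'.Γ c a b))
      = ∑ b, ∑ a, ∑ c, F.del k (t.y a) * (F'.Γ c a b * F'.del c f) * F.del l (t.y b) := by
    calc _ = ∑ c, ∑ b, ∑ a, F'.del c f * (F.del k (t.y a) * (F.del l (t.y b) * F'.Γ c a b)) :=
          Finset.sum_congr rfl fun c _ => Finset.sum_comm
      _ = ∑ b, ∑ c, ∑ a, F'.del c f * (F.del k (t.y a) * (F.del l (t.y b) * F'.Γ c a b)) :=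
          Finset.sum_comm
      _ = ∑ b, ∑ a, ∑ c, F'.del c f * (F.del k (t.y a) * (F.del l (t.y b) * F'.Γ c a b)) :=
          Finset.sum_congr rfl fun b _ => Finset.sum_comm
      _ = _ := Finset.sum_congr rfl fun b _ => Finset.sum_congr rfl fun a _ =>
          Finset.sum_congr rfl fun c _ => by ring
  rw [e1]
  have e2 : ∑ b, ∑ a, F.del l (t.y b) * (F.del k (t.y a) * F'.del a (F'.del b f))
      = ∑ b, ∑ a, F.del k (t.y a) * F'.del a (F'.del b f) * F.del l (t.y b) :=
    Finset.sum_congr rfl fun b _ => Finset.sum_congr rfl fun a _ => by ring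
  rw [e2]
  ring

/-- The matrix `(j, m) ↦ Γ^j_{rm}`. -/
def _root_.UnivStar.PoissonFrame.ΓMat (F : PoissonFrame ι A) (r : ι) : Matrix ι ι A :=
  of fun j m => F.Γ j r m

omit [DecidableEq ι] in
theorem _root_.UnivStar.PoissonFrame.covP_eq (F : PoissonFrame ι A) (r : ι) :
    (of fun l s => F.covP r l s) = F.P.map (F.del r) + F.ΓMat r * F.P + F.P * (F.ΓMat r)ᵀ := by
  ext l s
  simp [covP, ΓMat, Matrix.mul_apply, mul_comm]

theorem Γ_mul_J (r : ι) : (∑ c, t.J r c • F'.ΓMat c) * t.Jᵀ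
    = t.Jᵀ * F.ΓMat r - t.Jᵀ.map (F.del r) := by
  ext a n
  have h := t.Γ_eq r n a
  simp only [Matrix.sub_apply, Matrix.mul_apply, Matrix.sum_apply, Matrix.smul_apply, ΓMat, J,
    of_apply, transpose_apply, smul_eq_mul, Matrix.map_apply, Finset.sum_mul]
  rw [← h, Finset.sum_comm]
  exact Finset.sum_congr rfl fun c _ => Finset.sum_congr rfl fun b _ => by ring

/-- Differentiating Jᵀ P J gives two terms with a derivative of J; `Γ_mul_J` and its transpose
supply their negatives. -/
theorem covP_eq (r : ι) : ∑ c, t.J r c • (of fun a b => F'.covP c a b)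
    = t.Jᵀ * (of fun l s => F.covP r l s) * t.J := by
  have h := t.Γ_mul_J r
  have h' := congrArg Matrix.transpose h
  simp only [transpose_mul, transpose_sub, transpose_transpose, transpose_map] at h'
  have hd : ∑ c, t.J r c • F'.P.map (F'.del c) = F'.P.map (F.del r) := by
    ext a b
    simp only [Matrix.sum_apply, Matrix.smul_apply, Matrix.map_apply, smul_eq_mul]
    exact (t.del_eq r _).symm
  have hP : F'.P = t.Jᵀ * F.P * t.J := t.P_eq
  simp only [PoissonFrame.covP_eq, smul_add, Finset.sum_add_distrib, hd]
  have h1 : ∑ c, t.J r c • (F'.ΓMat c * F'.P) = (∑ c, t.J r c • F'.ΓMat c) * F'.P := by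
    simp [Finset.sum_mul]
  have h2 : ∑ c, t.J r c • (F'.P * (F'.ΓMat c)ᵀ) = F'.P * (∑ c, t.J r c • F'.ΓMat c)ᵀ := by
    simp [Finset.mul_sum, transpose_sum]
  rw [h1, h2, hP]
  have h3 : (∑ c, t.J r c • F'.ΓMat c) * (t.Jᵀ * F.P * t.J)
      = (t.Jᵀ * F.ΓMat r - t.Jᵀ.map (F.del r)) * F.P * t.J := by
    rw [← h]; simp only [Matrix.mul_assoc]
  have h4 : (t.Jᵀ * F.P * t.J) * (∑ c, t.J r c • F'.ΓMat c)ᵀ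
      = t.Jᵀ * F.P * ((F.ΓMat r)ᵀ * t.J - t.J.map (F.del r)) := by
    rw [← h']; simp only [Matrix.mul_assoc]
  rw [h3, h4, map_derivation_mul, map_derivation_mul]
  noncomm_ring

/-- The mixed indices of `gradP` make its law a conjugation. Stated as an intertwining relation it
does not involve the inverse of J. -/
theorem gradP_eq (f : A) : F'.gradP f * t.Jᵀ = t.Jᵀ * F.gradP f := by
  ext a r
  have h1 : ∀ b, ∑ c, t.J r c * F'.covP c a b
      = (t.Jᵀ * (of fun l s => F.covP r l s) * t.J) a b := fun b => by
    rw [← t.covP_eq r]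
    simp [Matrix.sum_apply]
  calc _ = ∑ b, (∑ c, t.J r c * F'.covP c a b) * F'.grad f b := by
        simp only [Matrix.mul_apply, gradP, of_apply, Finset.sum_mul, transpose_apply, grad]
        rw [Finset.sum_comm]
        exact Finset.sum_congr rfl fun c _ => Finset.sum_congr rfl fun b _ => by ring
    _ = ((t.Jᵀ * (of fun l s => F.covP r l s) * t.J) *ᵥ F'.grad f) a := by
        simp only [h1, mulVec, dotProduct]
    _ = (t.Jᵀ *ᵥ ((of fun l s => F.covP r l s) *ᵥ F.grad f)) a := by
        rw [← mulVec_mulVec, ← mulVec_mulVec, ← t.grad_eq]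
    _ = _ := by
        simp [mulVec, dotProduct, Matrix.mul_apply, gradP, grad]

theorem J_mul_K : t.J * t.K = 1 := t.inv

theorem K_mul_J : t.K * t.J = 1 := mul_eq_one_comm.mp t.J_mul_K

theorem gradP_conj (f : A) : F.gradP f = t.Kᵀ * F'.gradP f * t.Jᵀ := by
  rw [Matrix.mul_assoc, t.gradP_eq, ← Matrix.mul_assoc, ← transpose_mul, t.J_mul_K]
  simp

/-- The Hessian and P transform with J on opposite sides and `gradP` by conjugation, so all factors
J cancel under the trace. -/
theorem c2_eq (t : Transition F F') (f g : A) : F.c2 f g = F'.c2 f g := by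
  have hP : F'.P = t.Jᵀ * F.P * t.J := t.P_eq
  have hK : t.Jᵀ * t.Kᵀ = 1 := by rw [← transpose_mul, t.K_mul_J, transpose_one]
  have a1 : (F.hess f * F.P * F.hess g * F.P).trace
      = (F'.hess f * F'.P * F'.hess g * F'.P).trace := by
    rw [t.hess_eq, t.hess_eq, hP]
    have := trace_mul_comm t.J (F'.hess f * t.Jᵀ * F.P * t.J * F'.hess g * t.Jᵀ * F.P)
    simpa only [Matrix.mul_assoc] using this
  have a2 : ∀ f g, (F.hess f * F.gradP g * F.P).trace
      = (F'.hess f * F'.gradP g * F'.P).trace := by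
    intro f g
    rw [t.hess_eq, hP]
    have := trace_mul_comm t.J (F'.hess f * (t.Jᵀ * F.gradP g) * F.P)
    rw [← t.gradP_eq] at this
    rw [Matrix.mul_assoc t.J, Matrix.mul_assoc t.J, Matrix.mul_assoc (F'.hess f), ← t.gradP_eq]
    simpa only [Matrix.mul_assoc] using this
  have a3 : (F.gradP f * F.gradP g).trace = (F'.gradP f * F'.gradP g).trace := by
    rw [t.gradP_conj f, t.gradP_conj g]
    have : t.Kᵀ * F'.gradP f * t.Jᵀ * (t.Kᵀ * F'.gradP g * t.Jᵀ)
        = t.Kᵀ * (F'.gradP f * (t.Jᵀ * t.Kᵀ) * F'.gradP g * t.Jᵀ) := by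
      simp only [Matrix.mul_assoc]
    rw [this, trace_mul_comm, hK, Matrix.mul_one, Matrix.mul_assoc, hK, Matrix.mul_one]
  simp only [c2, a1, a2, a3]

theorem ham_eq (f : A) : F'.ham f = F.ham f ᵥ* t.J := by
  have hP : F'.P = t.Jᵀ * F.P * t.J := t.P_eq
  rw [← grad_vecMul_P, hP, ← grad_vecMul_P, ← vecMul_vecMul, ← vecMul_vecMul, t.grad_eq,
    vecMul_transpose]

theorem along_eq (X : ι → A) (f : A) : F'.along (X ᵥ* t.J) f = F.along X f := by
  have h1 : ∀ (F : PoissonFrame ι A) X, F.along X f = X ⬝ᵥ F.grad f := fun F X => along_apply ..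
  rw [h1, h1, t.grad_eq, dotProduct_mulVec]

/-- The function X y^a is the a-th component of X in the second frame, and X commutes with ∂_k up to
the Jacobian of X. -/
theorem J_map_along (X : ι → A) :
    t.J.map (F.along X) = t.J * F'.jac (X ᵥ* t.J) - F.jac X * t.J := by
  ext k a
  have h : F.along X (t.y a) = (X ᵥ* t.J) a := by
    simp [along_apply, vecMul, dotProduct, J]
  simp only [Matrix.map_apply, J, of_apply, along_del, h, Matrix.sub_apply, Matrix.mul_apply, jac]
  rw [t.del_eq k]

/-- By `hess_map_along`, S·df is Hess(X f) minus the Lie derivative of Hess f. Everything in that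
expression has a known law, and the derivatives of J are absorbed by the change of the Jacobian of
X. -/
theorem lieGrad_eq (X : ι → A) (f : A) :
    F.lieGrad X f = t.J * F'.lieGrad (X ᵥ* t.J) f * t.Jᵀ := by
  have h1 := F.hess_map_along X f
  have h2 := F'.hess_map_along (X ᵥ* t.J) f
  have h3 : F.lieGrad X f = F.hess (F.along X f) - F.jac X * F.hess f
      - F.hess f * (F.jac X)ᵀ - (F.hess f).map (F.along X) := by rw [h1]; abel
  have h4 : F'.lieGrad (X ᵥ* t.J) f = F'.hess (F.along X f) - F'.jac (X ᵥ* t.J) * F'.hess f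
      - F'.hess f * (F'.jac (X ᵥ* t.J))ᵀ - (F'.hess f).map (F.along X) := by
    have : (F'.hess f).map (F'.along (X ᵥ* t.J)) = (F'.hess f).map (F.along X) := by
      ext; simp [t.along_eq]
    rw [← t.along_eq X f, ← this, h2]; abel
  rw [h3, h4, t.hess_eq f, t.hess_eq (F.along X f), map_derivation_mul, map_derivation_mul,
    transpose_map, J_map_along]
  simp only [transpose_sub, transpose_mul]
  noncomm_ring

/-- The matrix `(j, k) ↦ S^j_{kl}`. -/
def _root_.UnivStar.PoissonFrame.lieMat (F : PoissonFrame ι A) (X : ι → A) (l : ι) :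
    Matrix ι ι A :=
  of fun j k => F.lie X j k l

theorem lieMat_eq (X : ι → A) (l : ι) :
    F.lieMat X l = t.Kᵀ * (∑ b, t.J l b • F'.lieMat (X ᵥ* t.J) b) * t.Jᵀ := by
  have h : t.Jᵀ * F.lieMat X l = (∑ b, t.J l b • F'.lieMat (X ᵥ* t.J) b) * t.Jᵀ := by
    ext c k
    -- For f = y^c the differential is a basis covector of the second frame, so S' itself can be
    -- read off from S'·df.
    have h1 := congrFun (congrFun (t.lieGrad_eq X (t.y c)) k) l
    have h2 : F'.lieGrad (X ᵥ* t.J) (t.y c) = of fun a b => F'.lie (X ᵥ* t.J) c a b := by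
      ext a b
      simp [lieGrad, t.del'_y]
    rw [h2] at h1
    simp only [lieGrad, Matrix.mul_apply, of_apply, transpose_apply] at h1
    simp only [lieMat, Matrix.mul_apply, of_apply, transpose_apply, Matrix.sum_apply,
      Matrix.smul_apply, smul_eq_mul, Finset.sum_mul] at h1 ⊢
    rw [Finset.sum_comm]
    calc _ = ∑ m, F.lie X m k l * F.del m (t.y c) :=
          Finset.sum_congr rfl fun m _ => mul_comm _ _
      _ = _ := by
        rw [h1]
        exact Finset.sum_congr rfl fun m _ => Finset.sum_congr rfl fun b _ => by ring
  rw [Matrix.mul_assoc, ← h, ← Matrix.mul_assoc, ← transpose_mul, t.J_mul_K]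
  simp

omit [DecidableEq ι] in
theorem _root_.UnivStar.PoissonFrame.pair_lie (F : PoissonFrame ι A) (X Y : ι → A) :
    F.pair (F.lie X) (F.lie Y) = -∑ l, ∑ s, F.P l s * (F.lieMat X l * F.lieMat Y s).trace := by
  simp [pair, lieMat, Matrix.trace, Matrix.mul_apply, Finset.mul_sum]

/-- For fixed l and s the contraction over j and k is a trace, invariant under conjugation by J; the
two remaining factors J are absorbed by P. -/
theorem c3_eq (t : Transition F F') (f g : A) : F.c3 f g = F'.c3 f g := by
  have hP : F'.P = t.Jᵀ * F.P * t.J := t.P_eq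
  have hK : t.Jᵀ * t.Kᵀ = 1 := by rw [← transpose_mul, t.K_mul_J, transpose_one]
  rw [c3, c3, pair_lie, pair_lie, t.ham_eq, t.ham_eq, hP]
  congr 1
  have h1 : ∀ l s, (F.lieMat (F.ham f) l * F.lieMat (F.ham g) s).trace
      = ∑ b, ∑ c, t.J l b * (t.J s c * (F'.lieMat (F.ham f ᵥ* t.J) b
        * F'.lieMat (F.ham g ᵥ* t.J) c).trace) := by
    intro l s
    rw [t.lieMat_eq, t.lieMat_eq]
    set U := ∑ b, t.J l b • F'.lieMat (F.ham f ᵥ* t.J) b with hU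
    set V := ∑ b, t.J s b • F'.lieMat (F.ham g ᵥ* t.J) b with hV
    have : t.Kᵀ * U * t.Jᵀ * (t.Kᵀ * V * t.Jᵀ) = t.Kᵀ * (U * (t.Jᵀ * t.Kᵀ) * V * t.Jᵀ) := by
      simp only [Matrix.mul_assoc]
    rw [this, trace_mul_comm, hK, Matrix.mul_one, Matrix.mul_assoc, hK, Matrix.mul_one, hU, hV]
    simp only [Finset.sum_mul, Finset.mul_sum, trace_sum, Matrix.smul_mul, Matrix.mul_smul,
      trace_smul, smul_eq_mul]
    rw [Finset.sum_comm]
    exact Finset.sum_congr rfl fun b _ => Finset.sum_congr rfl fun c _ => by ring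
  simp only [h1, Matrix.mul_apply, transpose_apply, Finset.mul_sum, Finset.sum_mul]
  generalize F'.lieMat (F.ham f ᵥ* t.J) = U
  generalize F'.lieMat (F.ham g ᵥ* t.J) = V
  let T : ι → ι → ι → ι → A := fun l s b c =>
    F.P l s * (t.J l b * (t.J s c * (U b * V c).trace))
  calc ∑ l, ∑ s, ∑ b, ∑ c, T l s b c = ∑ s, ∑ l, ∑ b, ∑ c, T l s b c := Finset.sum_comm
    _ = ∑ s, ∑ b, ∑ l, ∑ c, T l s b c := Finset.sum_congr rfl fun s _ => Finset.sum_comm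
    _ = ∑ b, ∑ s, ∑ l, ∑ c, T l s b c := Finset.sum_comm
    _ = ∑ b, ∑ s, ∑ c, ∑ l, T l s b c :=
        Finset.sum_congr rfl fun b _ => Finset.sum_congr rfl fun s _ => Finset.sum_comm
    _ = ∑ b, ∑ c, ∑ s, ∑ l, T l s b c := Finset.sum_congr rfl fun b _ => Finset.sum_comm
    _ = _ := by
        refine Finset.sum_congr rfl fun b _ => Finset.sum_congr rfl fun c _ =>
          Finset.sum_congr rfl fun s _ => Finset.sum_congr rfl fun l _ => ?_
        simp only [T, Matrix.trace, Matrix.diag, Matrix.mul_apply]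
        ring

end Transition
end PoissonFrame
end UnivStar

namespace UnivStar

open Set Filter Topology

section Calculus

variable {d : ℕ} {M : Type u} [TopologicalSpace M] [ChartedSpace (EuclideanSpace ℝ (Fin d)) M]
  {V : Type*} [NormedAddCommGroup V] [NormedSpace ℝ V]
  {e : OpenPartialHomeomorph M (EuclideanSpace ℝ (Fin d))} {U : Set M}

/-! ### Calculus in a chart -/

theorem contDiffOn_comp_symm (he : e ∈ Charts d M) {F : M → V}
    (hF : ContMDiffOn (𝓡 d) 𝓘(ℝ, V) ∞ F U) :
    ContDiffOn ℝ ∞ (F ∘ e.symm) (e.target ∩ e.symm ⁻¹' U) := by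
  rw [← contMDiffOn_iff_contDiffOn]
  exact hF.comp ((contMDiffOn_symm_of_mem_maximalAtlas he).mono inter_subset_left)
    fun x hx => hx.2

theorem contDiffAt_comp_symm (he : e ∈ Charts d M) {F : M → V} {x : M} (hU : IsOpen U)
    (hF : ContMDiffOn (𝓡 d) 𝓘(ℝ, V) ∞ F U) (hx : x ∈ e.source) (hxU : x ∈ U) :
    ContDiffAt ℝ ∞ (F ∘ e.symm) (e x) := by
  refine (contDiffOn_comp_symm he hF).contDiffAt
    ((e.isOpen_inter_preimage_symm hU).mem_nhds ⟨e.map_source hx, ?_⟩)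
  simpa [e.left_inv hx] using hxU

theorem differentiableAt_comp_symm (he : e ∈ Charts d M) {F : M → V} {x : M} (hU : IsOpen U)
    (hF : ContMDiffOn (𝓡 d) 𝓘(ℝ, V) ∞ F U) (hx : x ∈ e.source) (hxU : x ∈ U) :
    DifferentiableAt ℝ (F ∘ e.symm) (e x) :=
  (contDiffAt_comp_symm he hU hF hx hxU).differentiableAt (by simp)

theorem contMDiffOn_pd (he : e ∈ Charts d M) (hU : IsOpen U) (hUe : U ⊆ e.source) {F : M → V}
    (hF : ContMDiffOn (𝓡 d) 𝓘(ℝ, V) ∞ F U) (i : Fin d) :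
    ContMDiffOn (𝓡 d) 𝓘(ℝ, V) ∞ (pd e i F) U := by
  have h1 : ContDiffOn ℝ ∞ (fun y => fderiv ℝ (F ∘ e.symm) y (EuclideanSpace.single i 1))
      (e.target ∩ e.symm ⁻¹' U) :=
    ((contDiffOn_comp_symm he hF).fderiv_of_isOpen (e.isOpen_inter_preimage_symm hU)
      (by simp)).clm_apply contDiffOn_const
  exact (contMDiffOn_iff_contDiffOn.mpr h1).comp
    ((contMDiffOn_of_mem_maximalAtlas he).mono hUe)
    fun x hx => ⟨e.map_source (hUe hx), by simpa [e.left_inv (hUe hx)] using hx⟩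

theorem eventuallyEq_comp_symm {W : Type*} {F G : M → W} {x : M} (hx : x ∈ e.source)
    (h : F =ᶠ[𝓝 x] G) : F ∘ e.symm =ᶠ[𝓝 (e x)] G ∘ e.symm := by
  have h1 : Tendsto e.symm (𝓝 (e x)) (𝓝 x) := by
    simpa [e.left_inv hx] using (e.continuousAt_symm (e.map_source hx)).tendsto
  exact h1.eventually h

theorem pd_congr {F G : M → V} {x : M} (hx : x ∈ e.source) (h : F =ᶠ[𝓝 x] G) (i : Fin d) :
    pd e i F x = pd e i G x := by
  rw [pd, pd, (eventuallyEq_comp_symm hx h).fderiv_eq]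

theorem pd_congr_on {F G : M → V} {x : M} (hU : IsOpen U) (hUe : U ⊆ e.source) (hx : x ∈ U)
    (h : EqOn F G U) (i : Fin d) : pd e i F x = pd e i G x :=
  pd_congr (hUe hx) (h.eventuallyEq_of_mem (hU.mem_nhds hx)) i

theorem pd_const (c : V) (i : Fin d) (x : M) : pd e i (fun _ => c) x = 0 := by
  simp [pd, Function.comp_def]

theorem pd_add {F G : M → V} {x : M} (hF : DifferentiableAt ℝ (F ∘ e.symm) (e x))
    (hG : DifferentiableAt ℝ (G ∘ e.symm) (e x)) (i : Fin d) :
    pd e i (F + G) x = pd e i F x + pd e i G x := by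
  have : (F + G) ∘ e.symm = F ∘ e.symm + G ∘ e.symm := rfl
  rw [pd, this, fderiv_add hF hG]
  rfl

theorem pd_clm {W : Type*} [NormedAddCommGroup W] [NormedSpace ℝ W] (L : V →L[ℝ] W) {F : M → V}
    {x : M} (hF : DifferentiableAt ℝ (F ∘ e.symm) (e x)) (i : Fin d) :
    pd e i (fun y => L (F y)) x = L (pd e i F x) := by
  have : (fun y => L (F y)) ∘ e.symm = L ∘ (F ∘ e.symm) := rfl
  rw [pd, this, fderiv_comp _ L.differentiableAt hF, L.fderiv]
  rfl

theorem pd_mul {𝕜 : Type*} [RCLike 𝕜] {F G : M → 𝕜} {x : M}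
    (hF : DifferentiableAt ℝ (F ∘ e.symm) (e x))
    (hG : DifferentiableAt ℝ (G ∘ e.symm) (e x)) (i : Fin d) :
    pd e i (F * G) x = F (e.symm (e x)) * pd e i G x + G (e.symm (e x)) * pd e i F x := by
  have : (F * G) ∘ e.symm = F ∘ e.symm * G ∘ e.symm := rfl
  rw [pd, this, fderiv_mul hF hG]
  simp [pd]

theorem pd_comm (he : e ∈ Charts d M) (hU : IsOpen U) (hUe : U ⊆ e.source) {F : M → V}
    (hF : ContMDiffOn (𝓡 d) 𝓘(ℝ, V) ∞ F U) {x : M} (hx : x ∈ U) (i j : Fin d) :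
    pd e i (pd e j F) x = pd e j (pd e i F) x := by
  have hxe := hUe hx
  have hs : IsSymmSndFDerivAt ℝ (F ∘ e.symm) (e x) :=
    (contDiffAt_comp_symm he hU hF hxe hx).isSymmSndFDerivAt (by simp; norm_cast)
  have h2 : DifferentiableAt ℝ (fderiv ℝ (F ∘ e.symm)) (e x) :=
    ((contDiffAt_comp_symm he hU hF hxe hx).fderiv_right (m := 1) (by norm_cast)).differentiableAt
      (by simp)
  have h1 : ∀ i j, pd e i (pd e j F) x = fderiv ℝ (fderiv ℝ (F ∘ e.symm)) (e x)
      (EuclideanSpace.single i 1) (EuclideanSpace.single j 1) := by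
    intro i j
    have : pd e j F ∘ e.symm =ᶠ[𝓝 (e x)]
        fun y => fderiv ℝ (F ∘ e.symm) y (EuclideanSpace.single j 1) := by
      filter_upwards [e.open_target.mem_nhds (e.map_source hxe)] with y hy
      simp [pd, e.right_inv hy]
    rw [pd, this.fderiv_eq, fderiv_clm_apply h2 (differentiableAt_const _)]
    simp
  rw [h1, h1]
  exact hs _ _

theorem pd_coord {x : M} (hx : x ∈ e.source) (i j : Fin d) :
    pd e i (fun y => e y j) x = if i = j then (1 : ℝ) else 0 := by
  have : (fun y => e y j) ∘ e.symm =ᶠ[𝓝 (e x)] fun y => y j := by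
    filter_upwards [e.open_target.mem_nhds (e.map_source hx)] with y hy
    simp [e.right_inv hy]
  rw [pd, this.fderiv_eq]
  have h : (fun y : EuclideanSpace ℝ (Fin d) => y j) = EuclideanSpace.proj (𝕜 := ℝ) j := rfl
  rw [h, ContinuousLinearMap.fderiv]
  simp [eq_comm]

theorem contMDiffOn_coord (he : e ∈ Charts d M) (j : Fin d) :
    ContMDiffOn (𝓡 d) 𝓘(ℝ, ℝ) ∞ (fun y => e y j) e.source :=
  (EuclideanSpace.proj (𝕜 := ℝ) j).contMDiff.comp_contMDiffOn
    (contMDiffOn_of_mem_maximalAtlas he)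

/-! ### Coordinate vectors and covectors -/

theorem mdifferentiable_of_mem_charts (he : e ∈ Charts d M) :
    e.MDifferentiable (𝓡 d) (𝓡 d) :=
  ⟨(contMDiffOn_of_mem_maximalAtlas he).mdifferentiableOn (by simp),
    (contMDiffOn_symm_of_mem_maximalAtlas he).mdifferentiableOn (by simp)⟩

theorem coordVector_eq (he : e ∈ Charts d M) {x : M} (hx : x ∈ e.source) (i : Fin d) :
    coordVector e i x = mfderiv (𝓡 d) (𝓡 d) e.symm (e x) (EuclideanSpace.single i (1 : ℝ)) := by
  have hm := mdifferentiable_of_mem_charts he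
  have h := ContinuousLinearMap.inverse_eq (f := mvfderiv (𝓡 d) e x)
    (g := mfderiv (𝓡 d) (𝓡 d) e.symm (e x))
    (ContinuousLinearMap.ext fun v => (hm.mfderiv hx).apply_symm_apply v)
    (ContinuousLinearMap.ext fun v => (hm.mfderiv hx).symm_apply_apply v)
  rw [coordVector, h]
  rfl

/-- The link between intrinsic differentials and partial derivatives: the chain rule for F composed
with the inverse chart. -/
theorem mvfderiv_coordVector (he : e ∈ Charts d M) {x : M} (hx : x ∈ e.source) {F : M → V}
    (hF : MDifferentiableAt (𝓡 d) 𝓘(ℝ, V) F x) (i : Fin d) :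
    mvfderiv (𝓡 d) F x (coordVector e i x) = pd e i F x := by
  have hm := mdifferentiable_of_mem_charts he
  have h := mfderiv_comp_of_eq (I := 𝓡 d) (I' := 𝓡 d) (I'' := 𝓘(ℝ, V)) (x := e x) (f := e.symm)
    (g := F) hF (hm.mdifferentiableAt_symm (e.map_source hx)) (e.left_inv hx)
  rw [mfderiv_eq_fderiv] at h
  rw [coordVector_eq he hx, pd, h]
  simp only [mvfderiv]
  -- The tangent spaces at x and at `e.symm (e x)` are distinct types. Both derivatives are regarded
  -- as maps on the model space before the points are identified.
  have key : ∀ z, z = x → (mfderiv (𝓡 d) 𝓘(ℝ, V) F x : EuclideanSpace ℝ (Fin d) →L[ℝ] V)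
    = (mfderiv (𝓡 d) 𝓘(ℝ, V) F z : EuclideanSpace ℝ (Fin d) →L[ℝ] V) := by
    rintro z rfl; rfl
  exact congrArg (fun L : EuclideanSpace ℝ (Fin d) →L[ℝ] V =>
    L (mfderiv (𝓡 d) (𝓡 d) e.symm (e x) (EuclideanSpace.single i (1 : ℝ)))) (key _ (e.left_inv hx))

theorem contMDiffOn_mdifferentiableAt {F : M → V} {x : M} (hU : IsOpen U) (hx : x ∈ U)
    (hF : ContMDiffOn (𝓡 d) 𝓘(ℝ, V) ∞ F U) : MDifferentiableAt (𝓡 d) 𝓘(ℝ, V) F x :=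
  (hF.contMDiffAt (hU.mem_nhds hx)).mdifferentiableAt (by simp)

theorem dAt_coordVector (he : e ∈ Charts d M) {x : M} (hx : x ∈ e.source) {F : M → ℝ}
    (hF : MDifferentiableAt (𝓡 d) 𝓘(ℝ, ℝ) F x) (i : Fin d) :
    dAt F x (coordVector e i x) = pd e i F x := mvfderiv_coordVector he hx hF i

theorem coordCovector_coordVector (he : e ∈ Charts d M) {x : M} (hx : x ∈ e.source)
    (i j : Fin d) : coordCovector e j x (coordVector e i x) = if i = j then 1 else 0 := by
  rw [coordCovector, dAt_coordVector he hx
    (contMDiffOn_mdifferentiableAt e.open_source hx (contMDiffOn_coord he j)), pd_coord hx]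

theorem coordCovector_apply (he : e ∈ Charts d M) {x : M} (hx : x ∈ e.source)
    (j : Fin d) (v : TangentSpace (𝓡 d) x) :
    coordCovector e j x v = EuclideanSpace.proj (𝕜 := ℝ) j (mfderiv (𝓡 d) (𝓡 d) e x v) := by
  have hm := mdifferentiable_of_mem_charts he
  have h := mfderiv_comp (I := 𝓡 d) (I' := 𝓡 d) (I'' := 𝓘(ℝ, ℝ)) x (f := e)
    (g := EuclideanSpace.proj (𝕜 := ℝ) j)
    ((EuclideanSpace.proj (𝕜 := ℝ) j).differentiableAt.mdifferentiableAt)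
    (hm.mdifferentiableAt hx)
  rw [mfderiv_eq_fderiv, ContinuousLinearMap.fderiv] at h
  exact congrArg (fun L : EuclideanSpace ℝ (Fin d) →L[ℝ] ℝ => L v) h

/-- Every tangent vector is the combination of the coordinate vectors with its coordinates. -/
theorem eq_sum_coordVector (he : e ∈ Charts d M) {x : M} (hx : x ∈ e.source)
    (v : TangentSpace (𝓡 d) x) : v = ∑ i, coordCovector e i x v • coordVector e i x := by
  have hm := mdifferentiable_of_mem_charts he
  -- The derivative of the chart is injective, so it suffices to compare its coordinates, which are
  -- the coordinate covectors.
  apply (hm.mfderiv hx).injective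
  refine PiLp.ext (p := 2) (α := fun _ : Fin d => ℝ) fun j => ?_
  refine (coordCovector_apply he hx j v).symm.trans (.trans ?_ (coordCovector_apply he hx j _))
  simp [coordCovector_coordVector he hx]

theorem dAt_eq_sum (he : e ∈ Charts d M) {x : M} (hx : x ∈ e.source) {F : M → ℝ}
    (hF : MDifferentiableAt (𝓡 d) 𝓘(ℝ, ℝ) F x) :
    dAt F x = ∑ i, pd e i F x • coordCovector e i x := by
  refine LinearMap.ext fun v => ?_
  conv_lhs => rw [eq_sum_coordVector he hx v]
  simp [dAt_coordVector he hx hF, mul_comm]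

theorem dAt_congr {F G : M → ℝ} {x : M} (h : F =ᶠ[𝓝 x] G) : dAt (d := d) F x = dAt G x := by
  have : mfderiv (𝓡 d) 𝓘(ℝ, ℝ) F x = mfderiv (𝓡 d) 𝓘(ℝ, ℝ) G x := h.mfderiv_eq
  unfold dAt mvfderiv
  refine LinearMap.ext fun v => ?_
  exact congrArg (fun L : EuclideanSpace ℝ (Fin d) →L[ℝ] ℝ => L v) this

end Calculus
end UnivStar

namespace UnivStar

open Set Filter Topology Bundle

section Local

variable {d : ℕ} {M : Type u} [TopologicalSpace M] [T2Space M]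
  [ChartedSpace (EuclideanSpace ℝ (Fin d)) M] [IsManifold (𝓡 d) ∞ M]
  {e : OpenPartialHomeomorph M (EuclideanSpace ℝ (Fin d))} {U : Set M}

/-! ### Localisation -/

theorem exists_cutoff {x : M} (hU : IsOpen U) (hx : x ∈ U) :
    ∃ χ : M → ℝ, ContMDiff (𝓡 d) 𝓘(ℝ, ℝ) ∞ χ ∧ χ =ᶠ[𝓝 x] 1 ∧ tsupport χ ⊆ U := by
  obtain ⟨f, -, hf⟩ :=
    (SmoothBumpFunction.nhds_basis_tsupport (I := 𝓡 d) x).mem_iff.1 (hU.mem_nhds hx)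
  exact ⟨f, f.contMDiff, f.eventuallyEq_one, hf⟩

/-- Smoothness and the Jacobi identity of a Poisson tensor are postulated for global functions.
Every local germ, in particular that of a coordinate, extends to a global smooth function. -/
theorem exists_contMDiff_eventuallyEq {F : M → ℝ} {x : M} (hU : IsOpen U) (hx : x ∈ U)
    (hF : ContMDiffOn (𝓡 d) 𝓘(ℝ, ℝ) ∞ F U) :
    ∃ G : M → ℝ, ContMDiff (𝓡 d) 𝓘(ℝ, ℝ) ∞ G ∧ G =ᶠ[𝓝 x] F := by
  obtain ⟨χ, hχ, h1, h2⟩ := exists_cutoff (d := d) hU hx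
  refine ⟨χ * F, contMDiff_of_tsupport fun y hy => ?_, ?_⟩
  · exact (hχ y).mul (hF.contMDiffAt (hU.mem_nhds (h2 (tsupport_mul_subset_left hy))))
  · filter_upwards [h1] with y hy
    simp [hy]

/-! ### The Poisson tensor in a chart -/

variable (P : PoissonTensor d M)

theorem PoissonTensor.realBracket_congr {f f' g g' : M → ℝ} {x : M} (hf : f =ᶠ[𝓝 x] f')
    (hg : g =ᶠ[𝓝 x] g') : P.realBracket f g =ᶠ[𝓝 x] P.realBracket f' g' := by
  filter_upwards [hf.eventually_nhds, hg.eventually_nhds] with y h1 h2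
  rw [PoissonTensor.realBracket, PoissonTensor.realBracket, dAt_congr h1, dAt_congr h2]

theorem PoissonTensor.contMDiffOn_realBracket {f g : M → ℝ} (hU : IsOpen U)
    (hf : ContMDiffOn (𝓡 d) 𝓘(ℝ, ℝ) ∞ f U) (hg : ContMDiffOn (𝓡 d) 𝓘(ℝ, ℝ) ∞ g U) :
    ContMDiffOn (𝓡 d) 𝓘(ℝ, ℝ) ∞ (P.realBracket f g) U := by
  intro x hx
  obtain ⟨f', hf', h1⟩ := exists_contMDiff_eventuallyEq hU hx hf
  obtain ⟨g', hg', h2⟩ := exists_contMDiff_eventuallyEq hU hx hg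
  exact ((P.smooth f' g' hf' hg' x).congr_of_eventuallyEq
    (P.realBracket_congr h1 h2).symm).contMDiffWithinAt

theorem PoissonTensor.jacobi_local {f g h : M → ℝ} (hU : IsOpen U)
    (hf : ContMDiffOn (𝓡 d) 𝓘(ℝ, ℝ) ∞ f U) (hg : ContMDiffOn (𝓡 d) 𝓘(ℝ, ℝ) ∞ g U)
    (hh : ContMDiffOn (𝓡 d) 𝓘(ℝ, ℝ) ∞ h U) {x : M} (hx : x ∈ U) :
    P.realBracket f (P.realBracket g h) x + P.realBracket g (P.realBracket h f) x
      + P.realBracket h (P.realBracket f g) x = 0 := by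
  obtain ⟨f', hf', h1⟩ := exists_contMDiff_eventuallyEq hU hx hf
  obtain ⟨g', hg', h2⟩ := exists_contMDiff_eventuallyEq hU hx hg
  obtain ⟨h', hh', h3⟩ := exists_contMDiff_eventuallyEq hU hx hh
  have := P.jacobi f' g' h' hf' hg' hh' x
  have e1 := (P.realBracket_congr h1 (P.realBracket_congr h2 h3)).eq_of_nhds
  have e2 := (P.realBracket_congr h2 (P.realBracket_congr h3 h1)).eq_of_nhds
  have e3 := (P.realBracket_congr h3 (P.realBracket_congr h1 h2)).eq_of_nhds
  rw [← e1, ← e2, ← e3]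
  exact this

theorem PoissonTensor.comp_eq_realBracket (i j : Fin d) :
    P.comp e i j = P.realBracket (fun y => e y i) fun y => e y j := rfl

theorem PoissonTensor.contMDiffOn_comp (he : e ∈ Charts d M) (i j : Fin d) :
    ContMDiffOn (𝓡 d) 𝓘(ℝ, ℝ) ∞ (P.comp e i j) e.source :=
  P.contMDiffOn_realBracket e.open_source (contMDiffOn_coord he i) (contMDiffOn_coord he j)

theorem PoissonTensor.comp_skew (i j : Fin d) (x : M) : P.comp e i j x = -P.comp e j i x :=
  P.skew _ _ _

theorem PoissonTensor.realBracket_eq_sum (he : e ∈ Charts d M) {x : M} (hx : x ∈ e.source)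
    {f g : M → ℝ} (hf : MDifferentiableAt (𝓡 d) 𝓘(ℝ, ℝ) f x)
    (hg : MDifferentiableAt (𝓡 d) 𝓘(ℝ, ℝ) g x) :
    P.realBracket f g x = ∑ i, ∑ j, P.comp e i j x * (pd e i f x * pd e j g x) := by
  rw [PoissonTensor.realBracket, dAt_eq_sum he hx hf, dAt_eq_sum he hx hg]
  simp only [map_sum, map_smul, LinearMap.sum_apply, LinearMap.smul_apply, smul_eq_mul,
    Finset.mul_sum, PoissonTensor.comp]
  refine (Finset.sum_comm).trans ?_
  exact Finset.sum_congr rfl fun i _ => Finset.sum_congr rfl fun j _ => by ring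

/-- The local Jacobi identity for three coordinate functions. -/
theorem PoissonTensor.comp_jacobi (he : e ∈ Charts d M) {x : M} (hx : x ∈ e.source)
    (a b c : Fin d) :
    ∑ i, (P.comp e a i x * pd e i (P.comp e b c) x + P.comp e b i x * pd e i (P.comp e c a) x
      + P.comp e c i x * pd e i (P.comp e a b) x) = 0 := by
  have key : ∀ a b c : Fin d, P.realBracket (fun y => e y a) (P.comp e b c) x
      = ∑ i, P.comp e a i x * pd e i (P.comp e b c) x := by
    intro a b c
    rw [P.realBracket_eq_sum he hx
      (contMDiffOn_mdifferentiableAt e.open_source hx (contMDiffOn_coord he a))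
      (contMDiffOn_mdifferentiableAt e.open_source hx (P.contMDiffOn_comp he b c))]
    simp [pd_coord hx]
  have := P.jacobi_local e.open_source (contMDiffOn_coord he a) (contMDiffOn_coord he b)
    (contMDiffOn_coord he c) hx
  simp only [← PoissonTensor.comp_eq_realBracket, key] at this
  simpa only [Finset.sum_add_distrib] using this

/-! ### Vector fields in a chart -/

/-- The constant vector field on the model space with value the `i`-th basis vector. -/
def constVector (i : Fin d) (y : EuclideanSpace ℝ (Fin d)) : TangentSpace (𝓡 d) y :=
  (EuclideanSpace.single i (1 : ℝ) : EuclideanSpace ℝ (Fin d))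

theorem contMDiffAt_constVector (i : Fin d) (y : EuclideanSpace ℝ (Fin d)) :
    ContMDiffAt (𝓡 d) (𝓡 d).tangent ∞ (T% (constVector i)) y :=
  contMDiffAt_vectorSpace_iff_contDiffAt.mpr contDiffAt_const

/-- The coordinate field is the pullback of a constant field along the chart. -/
theorem contMDiffAt_coordVector (he : e ∈ Charts d M) {x : M} (hx : x ∈ e.source) (i : Fin d) :
    ContMDiffAt (𝓡 d) (𝓡 d).tangent ∞ (T% (coordVector e i)) x := by
  refine ContMDiffAt.mpullback_vectorField_preimage (n := ∞) (f := e)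
    (contMDiffAt_constVector i _)
    ((contMDiffOn_of_mem_maximalAtlas he).contMDiffAt (e.open_source.mem_nhds hx)) ?_ (by simp)
  exact ⟨(mdifferentiable_of_mem_charts he).mfderiv hx, rfl⟩

theorem mdifferentiableAt_coordVector (he : e ∈ Charts d M) {x : M} (hx : x ∈ e.source)
    (i : Fin d) : MDifferentiableAt (𝓡 d) (𝓡 d).tangent (T% (coordVector e i)) x :=
  (contMDiffAt_coordVector he hx i).mdifferentiableAt (by simp)

/-- The Lie bracket is natural under pullback, and constant fields commute. -/
theorem mlieBracket_coordVector (he : e ∈ Charts d M) {x : M} (hx : x ∈ e.source) (i j : Fin d) :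
    VectorField.mlieBracket (𝓡 d) (coordVector e i) (coordVector e j) x = 0 := by
  have hV : ∀ i : Fin d, MDifferentiableAt (𝓡 d) (𝓡 d).tangent (T% (constVector i)) (e x) :=
    fun i => (contMDiffAt_constVector i _).mdifferentiableAt (by simp)
  have h2 : minSmoothness ℝ 2 ≤ (∞ : WithTop ℕ∞) := by
    rw [minSmoothness_of_isRCLikeNormedField]
    exact WithTop.coe_le_coe.mpr le_top
  have : IsManifold (𝓡 d) (minSmoothness ℝ 2) M := IsManifold.of_le h2
  have := VectorField.mpullback_mlieBracket (n := ∞) (f := e) (hV i) (hV j)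
    ((contMDiffOn_of_mem_maximalAtlas he).contMDiffAt (e.open_source.mem_nhds hx)) h2
  refine this.symm.trans ?_
  rw [VectorField.mpullback_apply, ← VectorField.mlieBracketWithin_univ,
    VectorField.mlieBracketWithin_eq_lieBracketWithin]
  have h0 : VectorField.lieBracketWithin ℝ
      (fun _ : EuclideanSpace ℝ (Fin d) => EuclideanSpace.single i (1 : ℝ))
      (fun _ : EuclideanSpace ℝ (Fin d) => EuclideanSpace.single j (1 : ℝ)) univ
      (e x) = 0 := by
    simp [VectorField.lieBracketWithin]
  exact (congrArg _ h0).trans (map_zero _)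

/-! ### The Christoffel symbols -/

variable (D : TorsionFreeConnection d M)

theorem christoffel_symm (he : e ∈ Charts d M) {x : M} (hx : x ∈ e.source) (k i j : Fin d) :
    christoffel D e k i j x = christoffel D e k j i x := by
  have h := (D.cov.torsion_eq_zero_iff.mp D.torsion_eq_zero)
    (mdifferentiableAt_coordVector he hx i) (mdifferentiableAt_coordVector he hx j)
  rw [mlieBracket_coordVector he hx, sub_eq_zero] at h
  rw [christoffel, christoffel, h]

theorem cov_congr {Y Z : ∀ x : M, TangentSpace (𝓡 d) x} {x : M}
    (hY : MDifferentiableAt (𝓡 d) (𝓡 d).tangent (T% Y) x)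
    (hZ : MDifferentiableAt (𝓡 d) (𝓡 d).tangent (T% Z) x) (h : ∀ᶠ y in 𝓝 x, Y y = Z y) :
    D.cov Y x = D.cov Z x :=
  (D.cov.isCovariantDerivativeOn (s := univ)).congr_of_eventuallyEq hY hZ univ_mem h

theorem contMDiff_cov {Y Z : ∀ x : M, TangentSpace (𝓡 d) x}
    (hY : ContMDiff (𝓡 d) (𝓡 d).tangent ∞ (T% Y)) (hZ : ContMDiff (𝓡 d) (𝓡 d).tangent ∞ (T% Z)) :
    ContMDiff (𝓡 d) (𝓡 d).tangent ∞ (T% (fun x => D.cov Z x (Y x))) := by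
  have h := D.smooth.contMDiff.contMDiff (σ := Z) (contMDiffOn_univ.mpr hZ)
  exact (contMDiffOn_univ.mp h).clm_bundle_apply hY

theorem contMDiff_dAt {F : M → ℝ} {Y : ∀ x : M, TangentSpace (𝓡 d) x}
    (hF : ContMDiff (𝓡 d) 𝓘(ℝ, ℝ) ∞ F) (hY : ContMDiff (𝓡 d) (𝓡 d).tangent ∞ (T% Y)) :
    ContMDiff (𝓡 d) 𝓘(ℝ, ℝ) ∞ (fun x => dAt F x (Y x)) :=
  (contMDiff_snd_tangentBundle_modelSpace ℝ 𝓘(ℝ, ℝ)).comp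
    ((hF.contMDiff_tangentMap (m := ∞) (by simp)).comp hY)

/-- The connection is applied to global fields: the coordinate fields are cut off near x and the
k-th coordinate is extended. By locality of ∇ and of the differential, the Christoffel symbol is
unchanged near x. -/
theorem contMDiffOn_christoffel (he : e ∈ Charts d M) (k i j : Fin d) :
    ContMDiffOn (𝓡 d) 𝓘(ℝ, ℝ) ∞ (christoffel D e k i j) e.source := by
  intro x hx
  obtain ⟨χ, hχ, h1, h2⟩ := exists_cutoff (d := d) e.open_source hx
  obtain ⟨G, hG, h3⟩ := exists_contMDiff_eventuallyEq e.open_source hx (contMDiffOn_coord he k)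
  have hσ : ∀ i, ContMDiff (𝓡 d) (𝓡 d).tangent ∞ (T% (χ • coordVector e i)) := fun i =>
    ContMDiffOn.smul_section_of_tsupport hχ.contMDiffOn e.open_source h2
      fun y hy => (contMDiffAt_coordVector he hy i).contMDiffWithinAt
  have hs := contMDiff_dAt hG (contMDiff_cov D (hσ i) (hσ j))
  refine ((hs x).congr_of_eventuallyEq ?_).contMDiffWithinAt
  filter_upwards [h1.eventually_nhds, h3.eventually_nhds, e.open_source.mem_nhds hx]
    with y hy1 hy3 hye
  have hv : ∀ i, ∀ᶠ z in 𝓝 y, (χ • coordVector e i) z = coordVector e i z := by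
    intro i
    filter_upwards [hy1] with z hz
    simp [hz]
  have hc : D.cov (χ • coordVector e j) y = D.cov (coordVector e j) y :=
    cov_congr D ((hσ j y).mdifferentiableAt (by simp)) (mdifferentiableAt_coordVector he hye j)
      (hv j)
  simp only [hc, (hv i).self_of_nhds, dAt_congr hy3]
  rfl

theorem cov_coordVector (he : e ∈ Charts d M) {x : M} (hx : x ∈ e.source) (i j : Fin d) :
    D.cov (coordVector e j) x (coordVector e i x)
      = ∑ k, christoffel D e k i j x • coordVector e k x :=
  eq_sum_coordVector he hx _

end Local

/-! ### The algebra of functions on an open subset of a chart domain -/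

section LocalFun

variable {d : ℕ} {M : Type u} [TopologicalSpace M]
  [ChartedSpace (EuclideanSpace ℝ (Fin d)) M] (𝕜 : Type v) [RCLike 𝕜]

/-- The algebra of `𝕜`-valued smooth functions on an open subset `U` of `M`. -/
def LocalFun (d : ℕ) {M : Type u} [TopologicalSpace M]
    [ChartedSpace (EuclideanSpace ℝ (Fin d)) M] (U : Set M) : Subalgebra ℝ (U → 𝕜) where
  carrier := {F | ∃ G : M → 𝕜, ContMDiffOn (𝓡 d) 𝓘(ℝ, 𝕜) ∞ G U ∧ ∀ x : U, F x = G x}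
  mul_mem' := by
    rintro _ _ ⟨G, hG, h⟩ ⟨G', hG', h'⟩
    exact ⟨G * G', hG.mul hG', fun x => by simp [h, h']⟩
  add_mem' := by
    rintro _ _ ⟨G, hG, h⟩ ⟨G', hG', h'⟩
    exact ⟨G + G', hG.add hG', fun x => by simp [h, h']⟩
  algebraMap_mem' r := ⟨fun _ => algebraMap ℝ 𝕜 r, contMDiffOn_const, fun _ => rfl⟩

variable {𝕜} {U : Set M}

namespace LocalFun

/-- The restriction to `U` of a function which is smooth on `U`. -/
def of (G : M → 𝕜) (hG : ContMDiffOn (𝓡 d) 𝓘(ℝ, 𝕜) ∞ G U) : LocalFun 𝕜 d U :=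
  ⟨fun x => G x, G, hG, fun _ => rfl⟩

/-- An extension to `M` of a function on `U`. -/
def extend (F : LocalFun 𝕜 d U) : M → 𝕜 := F.2.choose

theorem contMDiffOn_extend (F : LocalFun 𝕜 d U) :
    ContMDiffOn (𝓡 d) 𝓘(ℝ, 𝕜) ∞ (extend F) U := F.2.choose_spec.1

/-- Evaluation at a point of `U`. -/
def ev {x : M} (hx : x ∈ U) : LocalFun 𝕜 d U →ₐ[ℝ] 𝕜 :=
  (Pi.evalAlgHom ℝ (fun _ : U => 𝕜) ⟨x, hx⟩).comp (LocalFun 𝕜 d U).val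

theorem ev_eq_extend {x : M} (hx : x ∈ U) (F : LocalFun 𝕜 d U) : ev hx F = (extend F) x :=
  F.2.choose_spec.2 ⟨x, hx⟩

@[simp]
theorem ev_of {x : M} (hx : x ∈ U) {G : M → 𝕜} (hG : ContMDiffOn (𝓡 d) 𝓘(ℝ, 𝕜) ∞ G U) :
    ev hx (of G hG) = G x := rfl

theorem ext_ev {F G : LocalFun 𝕜 d U} (h : ∀ (x : M) (hx : x ∈ U), ev hx F = ev hx G) : F = G :=
  Subtype.ext (funext fun x => h x x.2)

theorem of_congr {G G' : M → 𝕜} (hG : ContMDiffOn (𝓡 d) 𝓘(ℝ, 𝕜) ∞ G U)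
    (hG' : ContMDiffOn (𝓡 d) 𝓘(ℝ, 𝕜) ∞ G' U) (h : EqOn G G' U) : of G hG = of G' hG' :=
  ext_ev fun _ hx => h hx

end LocalFun

open LocalFun

variable {e : OpenPartialHomeomorph M (EuclideanSpace ℝ (Fin d))}

variable (𝕜) in
/-- The coordinate derivations on the functions on an open subset of a chart domain. -/
def chartDer (he : e ∈ Charts d M) (hU : IsOpen U) (hUe : U ⊆ e.source) (i : Fin d) :
    Derivation ℝ (LocalFun 𝕜 d U) (LocalFun 𝕜 d U) :=
  have hd : ∀ (F : LocalFun 𝕜 d U) {x : M}, x ∈ U →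
      DifferentiableAt ℝ ((extend F) ∘ e.symm) (e x) := fun F x hx =>
    differentiableAt_comp_symm he hU (contMDiffOn_extend F) (hUe hx) hx
  Derivation.mk'
    { toFun F := of (pd e i (extend F)) (contMDiffOn_pd he hU hUe (contMDiffOn_extend F) i)
      map_add' F G := ext_ev fun x hx => by
        rw [map_add, ev_of, ev_of, ev_of, ← pd_add (hd F hx) (hd G hx)]
        -- The extension chosen for F + G and the sum of the chosen extensions agree only on U,
        -- which suffices because U is open.
        refine pd_congr_on hU hUe hx (fun y hy => ?_) i
        rw [← ev_eq_extend hy, map_add, ev_eq_extend, ev_eq_extend]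
        rfl
      map_smul' r F := ext_ev fun x hx => by
        rw [RingHom.id_apply, map_smul, ev_of, ev_of]
        refine (pd_congr_on hU hUe hx (fun y hy => ?_) i).trans
          (pd_clm (r • ContinuousLinearMap.id ℝ 𝕜) (hd F hx) i)
        rw [← ev_eq_extend hy, map_smul, ev_eq_extend]
        rfl }
    fun F G => ext_ev fun x hx => by
      simp only [LinearMap.coe_mk, AddHom.coe_mk, ev_of, map_add, smul_eq_mul, map_mul]
      rw [ev_eq_extend hx F, ev_eq_extend hx G]
      refine (pd_congr_on hU hUe hx (fun y hy => ?_) i).trans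
        ((pd_mul (hd F hx) (hd G hx) i).trans (by rw [e.left_inv (hUe hx)]))
      rw [← ev_eq_extend hy, map_mul, ev_eq_extend, ev_eq_extend]
      rfl

/-- The derivation does not depend on the chosen extension, so any representative G may be
differentiated. -/
theorem ev_chartDer (he : e ∈ Charts d M) (hU : IsOpen U) (hUe : U ⊆ e.source) (i : Fin d)
    (F : LocalFun 𝕜 d U) {x : M} (hx : x ∈ U) {G : M → 𝕜}
    (hG : ∀ (y : M) (hy : y ∈ U), ev hy F = G y) :
    ev hx (chartDer 𝕜 he hU hUe i F) = pd e i G x :=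
  pd_congr_on hU hUe hx (fun y hy => by rw [← ev_eq_extend hy, hG]) i

theorem chartDer_of (he : e ∈ Charts d M) (hU : IsOpen U) (hUe : U ⊆ e.source) (i : Fin d)
    {G : M → 𝕜} (hG : ContMDiffOn (𝓡 d) 𝓘(ℝ, 𝕜) ∞ G U) :
    chartDer 𝕜 he hU hUe i (of G hG) = of (pd e i G) (contMDiffOn_pd he hU hUe hG i) :=
  ext_ev fun _ hx => ev_chartDer he hU hUe i _ hx fun _ _ => rfl

theorem contMDiffOn_ofReal {F : M → ℝ} (hF : ContMDiffOn (𝓡 d) 𝓘(ℝ, ℝ) ∞ F U) :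
    ContMDiffOn (𝓡 d) 𝓘(ℝ, 𝕜) ∞ (fun x => (F x : 𝕜)) U :=
  (RCLike.ofRealCLM (K := 𝕜)).contMDiff.comp_contMDiffOn hF

/-- The `𝕜`-valued function on `U` given by a real function. -/
def ofR (F : M → ℝ) (hF : ContMDiffOn (𝓡 d) 𝓘(ℝ, ℝ) ∞ F U) : LocalFun 𝕜 d U :=
  of (fun x => (F x : 𝕜)) (contMDiffOn_ofReal hF)

@[simp]
theorem ev_ofR {x : M} (hx : x ∈ U) {F : M → ℝ} (hF : ContMDiffOn (𝓡 d) 𝓘(ℝ, ℝ) ∞ F U) :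
    ev hx (ofR (𝕜 := 𝕜) F hF) = (F x : 𝕜) := rfl

theorem pd_ofReal {F : M → ℝ} {x : M} (hF : DifferentiableAt ℝ (F ∘ e.symm) (e x)) (i : Fin d) :
    pd e i (fun x => (F x : 𝕜)) x = ((pd e i F x : ℝ) : 𝕜) :=
  pd_clm (RCLike.ofRealCLM (K := 𝕜)) hF i

theorem chartDer_ofR (he : e ∈ Charts d M) (hU : IsOpen U) (hUe : U ⊆ e.source) (i : Fin d)
    {F : M → ℝ} (hF : ContMDiffOn (𝓡 d) 𝓘(ℝ, ℝ) ∞ F U) :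
    chartDer 𝕜 he hU hUe i (ofR (𝕜 := 𝕜) F hF)
      = ofR (pd e i F) (contMDiffOn_pd he hU hUe hF i) := by
  rw [ofR, chartDer_of]
  exact of_congr _ _ fun x hx =>
    pd_ofReal (differentiableAt_comp_symm he hU hF (hUe hx) hx) i

end LocalFun

/-! ### The Poisson frame of an open subset of a chart domain -/

section Frame

variable {d : ℕ} {M : Type u} [TopologicalSpace M] [T2Space M]
  [ChartedSpace (EuclideanSpace ℝ (Fin d)) M] [IsManifold (𝓡 d) ∞ M] {𝕜 : Type v} [RCLike 𝕜]
  (D : TorsionFreeConnection d M) (P : PoissonTensor d M)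
  {e : OpenPartialHomeomorph M (EuclideanSpace ℝ (Fin d))} {U : Set M}

open LocalFun

/-- The data of a Poisson tensor and a connection on an open subset of a chart domain. -/
def chartFrame (𝕜 : Type v) [RCLike 𝕜] (he : e ∈ Charts d M) (hU : IsOpen U)
    (hUe : U ⊆ e.source) : PoissonFrame (Fin d) (LocalFun 𝕜 d U) where
  del := chartDer 𝕜 he hU hUe
  del_comm i j F := ext_ev fun x hx => by
    rw [ev_chartDer he hU hUe i _ hx (G := pd e j (extend F)) fun y hy =>
        ev_chartDer he hU hUe j F hy fun y hy => ev_eq_extend hy F,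
      ev_chartDer he hU hUe j _ hx (G := pd e i (extend F)) fun y hy =>
        ev_chartDer he hU hUe i F hy fun y hy => ev_eq_extend hy F,
      pd_comm he hU hUe (contMDiffOn_extend F) hx]
  Γ k i j := ofR (christoffel D e k i j) ((contMDiffOn_christoffel D he k i j).mono hUe)
  Γ_symm k i j := ext_ev fun x hx => by
    rw [ev_ofR, ev_ofR, christoffel_symm D he (hUe hx)]
  P := .of fun i j => ofR (P.comp e i j) ((P.contMDiffOn_comp he i j).mono hUe)
  skew i j := ext_ev fun x hx => by
    simp [P.comp_skew i j x]
  jacobi a b c := ext_ev fun x hx => by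
    have h := congrArg (RCLike.ofReal (K := 𝕜)) (P.comp_jacobi he (hUe hx) a b c)
    push_cast at h
    simp only [Matrix.of_apply, chartDer_ofR, map_sum, map_add, map_mul, ev_ofR, map_zero]
    exact h

end Frame

/-! ### Curvature, the five-term formula and index sums -/

namespace PoissonFrame

open Matrix

variable {ι : Type*} [Fintype ι] {A : Type*} [CommRing A] [Algebra ℝ A] (F : PoissonFrame ι A)

/-- The components `R_{ikl}^j` of the curvature. -/
def curv (i k l j : ι) : A :=
  F.del i (F.Γ j k l) - F.del k (F.Γ j i l)
    + ∑ m, (F.Γ j i m * F.Γ m k l - F.Γ j k m * F.Γ m i l)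

/-- The third covariant derivative `∇³_{kli} f`. -/
def hess3 (f : A) (k l i : ι) : A :=
  F.del k (F.hess f l i) - ∑ m, F.Γ m k l * F.hess f m i - ∑ m, F.Γ m k i * F.hess f l m

/-- The second covariant derivative `∇²_{kl} P^{ij}`. -/
def covP2 (k l i j : ι) : A :=
  F.del k (F.covP l i j) - ∑ m, F.Γ m k l * F.covP m i j + ∑ m, F.Γ i k m * F.covP l m j
    + ∑ m, F.Γ j k m * F.covP l i m

/-- `(L_X ∇)^j_{kl} = ∇²_{kl} X^j + R_{ikl}^j X^i`. -/
theorem lie_eq_nab (X : ι → A) (j k l : ι) :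
    F.lie X j k l = F.del k (F.nab X j l) - ∑ m, F.Γ m k l * F.nab X j m
      + ∑ m, F.Γ j k m * F.nab X m l + ∑ i, F.curv i k l j * X i := by
  simp only [lie, nab, curv, of_apply, map_add, map_sum, Derivation.leibniz, smul_eq_mul,
    mul_add, add_mul, sub_mul, Finset.sum_add_distrib, Finset.sum_sub_distrib, Finset.mul_sum,
    Finset.sum_mul]
  have e1 := Finset.sum_comm (s := Finset.univ) (t := Finset.univ)
    (f := fun i m => F.Γ i k l * (F.Γ j i m * X m))
  have e2 := Finset.sum_comm (s := Finset.univ) (t := Finset.univ)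
    (f := fun i m => F.Γ j k i * (F.Γ i m l * X m))
  simp only [F.Γ_symm j _ l, F.Γ_symm _ _ l] at e1 e2 ⊢
  have e3 : ∑ i, ∑ m, X i * (F.Γ j m i * F.Γ m k l) = ∑ i, ∑ m, X i * (F.Γ j i m * F.Γ m k l) :=
    Finset.sum_congr rfl fun i _ => Finset.sum_congr rfl fun m _ => by rw [F.Γ_symm j i m]
  simp only [mul_assoc, mul_comm, mul_left_comm, F.Γ_symm _ l k] at e1 e2 e3 ⊢
  linear_combination e1 - e2 + e3

theorem nab_ham_apply (f : A) (j l : ι) :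
    F.nab (F.ham f) j l = ∑ i, (F.covP l i j * F.del i f + F.P i j * F.hess f l i) := by
  rw [F.nab_ham]
  simp only [gradP, Matrix.neg_apply, Matrix.add_apply, Matrix.mul_apply, of_apply,
    ← Finset.sum_add_distrib, ← Finset.sum_neg_distrib]
  refine Finset.sum_congr rfl fun i _ => ?_
  rw [F.covP_skew l i j, F.skew i j, ← F.hess_symm f, transpose_apply, F.hess_symm]
  ring

/-- The five-term formula for the Lie derivative of the connection along a Hamiltonian vector
field. -/
theorem lie_ham (f : A) (j k l : ι) :
    F.lie (F.ham f) j k l = ∑ i, (F.P i j * F.hess3 f k l i + F.covP k i j * F.hess f l i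
      + F.covP l i j * F.hess f k i + F.covP2 k l i j * F.del i f)
      + ∑ i, ∑ s, F.curv i k l j * F.P s i * F.del s f := by
  -- Partial derivatives are replaced by covariant ones plus Christoffel terms; the latter cancel
  -- since ∇X_f is a contraction of tensors.
  have h1 : ∀ i, F.del k (F.del i f) = F.hess f k i + ∑ m, F.Γ m k i * F.del m f := by
    intro i
    simp [hess]
  have h2 : ∀ i, F.del k (F.P i j) = F.covP k i j - ∑ m, F.Γ i k m * F.P m j
      - ∑ m, F.Γ j k m * F.P i m := by
    intro i
    simp only [covP]
    ring
  rw [lie_eq_nab]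
  simp only [nab_ham_apply, map_sum, map_add, Derivation.leibniz, smul_eq_mul, h1, h2, hess3,
    covP2, mul_add, add_mul, sub_mul, mul_sub, Finset.sum_add_distrib, Finset.sum_sub_distrib,
    Finset.mul_sum, Finset.sum_mul, ham]
  have e1 := Finset.sum_comm (s := Finset.univ) (t := Finset.univ)
    (f := fun i m => F.covP l i j * (F.Γ m k i * F.del m f))
  have e2 := Finset.sum_comm (s := Finset.univ) (t := Finset.univ)
    (f := fun i m => F.P i j * (F.Γ m k i * F.hess f l m))
  have e3 := Finset.sum_comm (s := Finset.univ) (t := Finset.univ)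
    (f := fun i m => F.Γ m k l * (F.covP m i j * F.del i f))
  have e4 := Finset.sum_comm (s := Finset.univ) (t := Finset.univ)
    (f := fun i m => F.Γ m k l * (F.P i j * F.hess f m i))
  have e5 := Finset.sum_comm (s := Finset.univ) (t := Finset.univ)
    (f := fun i m => F.Γ j k m * (F.covP l i m * F.del i f))
  have e6 := Finset.sum_comm (s := Finset.univ) (t := Finset.univ)
    (f := fun i m => F.Γ j k m * (F.P i m * F.hess f l i))
  simp only [mul_assoc, mul_comm, mul_left_comm] at e1 e2 e3 e4 e5 e6 ⊢
  linear_combination e1 + e2 + e3 + e4 - e5 - e6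

/-- The second cochain as a sum over indices. -/
theorem c2_eq_sum (f g : A) : F.c2 f g =
    3 * ∑ k, ∑ r, ∑ l, ∑ s, F.P k r * F.P l s * (F.hess f k l * F.hess g r s)
      + 2 * ∑ k, ∑ r, ∑ l, ∑ s, F.P k r * F.covP r l s
        * (F.hess f k l * F.del s g + F.del s f * F.hess g k l)
      - ∑ k, ∑ r, ∑ l, ∑ s, F.covP l k r * F.covP k l s * (F.del r f * F.del s g) := by
  -- The trace ends in `P s l` where the formula has `P l s`; this is the origin of the negative
  -- coefficients in `c2`.
  have h1 : (F.hess f * F.P * F.hess g * F.P).trace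
      = -∑ k, ∑ r, ∑ l, ∑ s, F.P k r * F.P l s * (F.hess f k l * F.hess g r s) := by
    simp only [Matrix.trace, Matrix.diag_apply, Matrix.mul_apply, Finset.sum_mul,
      ← Finset.sum_neg_distrib]
    calc _ = ∑ l, ∑ s, ∑ r, ∑ k, F.hess f l k * F.P k r * F.hess g r s * F.P s l := rfl
      _ = ∑ l, ∑ s, ∑ k, ∑ r, F.hess f l k * F.P k r * F.hess g r s * F.P s l :=
        Finset.sum_congr rfl fun l _ => Finset.sum_congr rfl fun s _ => Finset.sum_comm
      _ = ∑ l, ∑ k, ∑ s, ∑ r, F.hess f l k * F.P k r * F.hess g r s * F.P s l :=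
        Finset.sum_congr rfl fun l _ => Finset.sum_comm
      _ = ∑ l, ∑ k, ∑ r, ∑ s, F.hess f l k * F.P k r * F.hess g r s * F.P s l :=
        Finset.sum_congr rfl fun l _ => Finset.sum_congr rfl fun s _ => Finset.sum_comm
      _ = ∑ k, ∑ l, ∑ r, ∑ s, F.hess f l k * F.P k r * F.hess g r s * F.P s l := Finset.sum_comm
      _ = ∑ k, ∑ r, ∑ l, ∑ s, F.hess f l k * F.P k r * F.hess g r s * F.P s l :=
        Finset.sum_congr rfl fun l _ => Finset.sum_comm
      _ = _ := by
        refine Finset.sum_congr rfl fun k _ => Finset.sum_congr rfl fun r _ =>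
          Finset.sum_congr rfl fun l _ => Finset.sum_congr rfl fun s _ => ?_
        rw [F.skew s l, ← F.hess_symm f, transpose_apply, F.hess_symm]
        ring
  have h2 : ∀ f g, (F.hess f * F.gradP g * F.P).trace
      = -∑ k, ∑ r, ∑ l, ∑ s, F.P k r * F.covP r l s * (F.hess f k l * F.del s g) := by
    intro f g
    simp only [Matrix.trace, Matrix.diag_apply, Matrix.mul_apply, Finset.sum_mul,
      ← Finset.sum_neg_distrib, gradP, of_apply, Finset.mul_sum]
    refine Finset.sum_congr rfl fun k _ => Finset.sum_congr rfl fun r _ =>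
      Finset.sum_congr rfl fun l _ => Finset.sum_congr rfl fun s _ => ?_
    rw [F.skew r k]
    ring
  have h3 : (F.gradP f * F.gradP g).trace
      = ∑ k, ∑ r, ∑ l, ∑ s, F.covP l k r * F.covP k l s * (F.del r f * F.del s g) := by
    simp only [Matrix.trace, Matrix.diag_apply, Matrix.mul_apply, gradP, of_apply,
      Finset.sum_mul_sum]
    refine Finset.sum_congr rfl fun k _ => Finset.sum_comm.trans ?_
    refine Finset.sum_congr rfl fun r _ =>
      Finset.sum_congr rfl fun l _ => Finset.sum_congr rfl fun s _ => ?_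
    ring
  rw [c2, h1, h2, h2, h3]
  simp only [mul_add, Finset.sum_add_distrib]
  simp only [mul_comm (F.hess g _ _)]
  ring

end PoissonFrame

section Components

variable {d : ℕ} {M : Type u} [TopologicalSpace M]
  [ChartedSpace (EuclideanSpace ℝ (Fin d)) M] [IsManifold (𝓡 d) ∞ M] {𝕜 : Type v} [RCLike 𝕜]
  (D : TorsionFreeConnection d M) (P : PoissonTensor d M)
  {e : OpenPartialHomeomorph M (EuclideanSpace ℝ (Fin d))} {U : Set M}

/-! ### Components of the covariant derivatives -/

theorem contMDiffOn_covD [T2Space M] {V : Type*} [NormedAddCommGroup V] [NormedSpace ℝ V]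
    (he : e ∈ Charts d M)
    (hU : IsOpen U) (hUe : U ⊆ e.source) {q p : ℕ} {T : CompTensor d M V q p}
    (hT : ∀ l u, ContMDiffOn (𝓡 d) 𝓘(ℝ, V) ∞ (T l u) U) (l : Fin (q + 1) → Fin d)
    (u : Fin p → Fin d) : ContMDiffOn (𝓡 d) 𝓘(ℝ, V) ∞ (covD D e T l u) U := by
  have hΓ : ∀ k i j, ContMDiffOn (𝓡 d) 𝓘(ℝ, ℝ) ∞ (christoffel D e k i j) U :=
    fun k i j => (contMDiffOn_christoffel D he k i j).mono hUe
  refine ((contMDiffOn_pd he hU hUe (hT _ _) _).sub ?_).add ?_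
  · exact contMDiffOn_finsetSum fun a _ => contMDiffOn_finsetSum fun m _ =>
      (hΓ _ _ _).smul (hT _ _)
  · exact contMDiffOn_finsetSum fun a _ => contMDiffOn_finsetSum fun m _ =>
      (hΓ _ _ _).smul (hT _ _)

theorem contMDiffOn_covPoisson [T2Space M] (he : e ∈ Charts d M) (hU : IsOpen U)
    (hUe : U ⊆ e.source) :
    ∀ (m : ℕ) l u, ContMDiffOn (𝓡 d) 𝓘(ℝ, ℝ) ∞ (covPoisson D P e m l u) U
  | 0, _, u => (P.contMDiffOn_comp he (u 0) (u 1)).mono hUe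
  | m + 1, l, u => contMDiffOn_covD D he hU hUe (contMDiffOn_covPoisson he hU hUe m) l u

theorem contMDiffOn_curvature [T2Space M] (he : e ∈ Charts d M) (hU : IsOpen U)
    (hUe : U ⊆ e.source) (i k l j : Fin d) :
    ContMDiffOn (𝓡 d) 𝓘(ℝ, ℝ) ∞ (curvature D e i k l j) U := by
  have hΓ : ∀ k i j, ContMDiffOn (𝓡 d) 𝓘(ℝ, ℝ) ∞ (christoffel D e k i j) U :=
    fun k i j => (contMDiffOn_christoffel D he k i j).mono hUe
  exact ((contMDiffOn_pd he hU hUe (hΓ _ _ _) _).sub (contMDiffOn_pd he hU hUe (hΓ _ _ _) _)).add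
    (contMDiffOn_finsetSum fun m _ => ((hΓ _ _ _).mul (hΓ _ _ _)).sub ((hΓ _ _ _).mul (hΓ _ _ _)))

theorem covFun_one (f : M → 𝕜) (l : Fin 1 → Fin d) (u : Fin 0 → Fin d) :
    covFun D e f 1 l u = pd e (l 0) f := by
  funext x
  simp [covFun, covD]

theorem covFun_two (f : M → 𝕜) (k l : Fin d) (u : Fin 0 → Fin d) (x : M) :
    covFun D e f 2 ![k, l] u x = pd e k (pd e l f) x
      - ∑ m, (christoffel D e m k l x : 𝕜) * pd e m f x := by
  rw [covFun, covD]
  simp [covFun_one, RCLike.real_smul_eq_coe_mul]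

theorem covFun_three (f : M → 𝕜) (k l i : Fin d) (u : Fin 0 → Fin d) (x : M) :
    covFun D e f 3 ![k, l, i] u x = pd e k (covFun D e f 2 ![l, i] u) x
      - ∑ m, (christoffel D e m k l x : 𝕜) * covFun D e f 2 ![m, i] u x
      - ∑ m, (christoffel D e m k i x : 𝕜) * covFun D e f 2 ![l, m] u x := by
  have ht : Fin.tail ![k, l, i] = ![l, i] := rfl
  have h0 : ∀ m, Function.update ![l, i] 0 m = ![m, i] := fun m => by
    ext a; fin_cases a <;> rfl
  have h1 : ∀ m, Function.update ![l, i] 1 m = ![l, m] := fun m => by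
    ext a; fin_cases a <;> rfl
  rw [covFun, covD]
  simp [ht, h0, h1, Fin.sum_univ_two, RCLike.real_smul_eq_coe_mul, sub_sub]

theorem covPoisson_one (r l s : Fin d) (x : M) :
    covPoisson D P e 1 ![r] ![l, s] x = pd e r (P.comp e l s) x
      + ∑ m, christoffel D e l r m x * P.comp e m s x
      + ∑ m, christoffel D e s r m x * P.comp e l m x := by
  rw [covPoisson, covD]
  simp [covPoisson, Fin.sum_univ_two, add_assoc]

theorem covPoisson_two (k l i j : Fin d) (x : M) :
    covPoisson D P e 2 ![k, l] ![i, j] x = pd e k (covPoisson D P e 1 ![l] ![i, j]) x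
      - ∑ m, christoffel D e m k l x * covPoisson D P e 1 ![m] ![i, j] x
      + ∑ m, christoffel D e i k m x * covPoisson D P e 1 ![l] ![m, j] x
      + ∑ m, christoffel D e j k m x * covPoisson D P e 1 ![l] ![i, m] x := by
  have ht : Fin.tail ![k, l] = ![l] := rfl
  have h : ∀ m, Function.update ![l] 0 m = ![m] := fun m => by
    ext a; fin_cases a; rfl
  have h0 : ∀ m, Function.update ![i, j] 0 m = ![m, j] := fun m => by
    ext a; fin_cases a <;> rfl
  have h1 : ∀ m, Function.update ![i, j] 1 m = ![i, m] := fun m => by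
    ext a; fin_cases a <;> rfl
  rw [covPoisson, covD]
  simp [ht, h, h0, h1, Fin.sum_univ_two, add_assoc]

end Components

section Link

variable {d : ℕ} {M : Type u} [TopologicalSpace M] [T2Space M]
  [ChartedSpace (EuclideanSpace ℝ (Fin d)) M] [IsManifold (𝓡 d) ∞ M] {𝕜 : Type v} [RCLike 𝕜]
  (D : TorsionFreeConnection d M) (P : PoissonTensor d M)
  {e : OpenPartialHomeomorph M (EuclideanSpace ℝ (Fin d))} {U : Set M}
  (he : e ∈ Charts d M) (hU : IsOpen U) (hUe : U ⊆ e.source)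
  {f g : M → 𝕜} (hf : ContMDiffOn (𝓡 d) 𝓘(ℝ, 𝕜) ∞ f U) (hg : ContMDiffOn (𝓡 d) 𝓘(ℝ, 𝕜) ∞ g U)

open LocalFun

/-! ### The components as elements of the algebra of functions on `U` -/

local notation "𝔽" => chartFrame D P 𝕜 he hU hUe

theorem ev_Γ {x : M} (hx : x ∈ U) (k i j : Fin d) :
    ev hx ((𝔽).Γ k i j) = (christoffel D e k i j x : 𝕜) := rfl

theorem ev_P {x : M} (hx : x ∈ U) (i j : Fin d) :
    ev hx ((𝔽).P i j) = (P.comp e i j x : 𝕜) := rfl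

theorem ev_del (i : Fin d) (F : LocalFun 𝕜 d U) {x : M} (hx : x ∈ U) {G : M → 𝕜}
    (hG : ∀ (y : M) (hy : y ∈ U), ev hy F = G y) : ev hx ((𝔽).del i F) = pd e i G x :=
  ev_chartDer he hU hUe i F hx hG

theorem ev_del_ofReal (i : Fin d) (F : LocalFun 𝕜 d U) {x : M} (hx : x ∈ U) {G : M → ℝ}
    (hGs : ContMDiffOn (𝓡 d) 𝓘(ℝ, ℝ) ∞ G U)
    (hG : ∀ (y : M) (hy : y ∈ U), ev hy F = (G y : 𝕜)) :
    ev hx ((𝔽).del i F) = ((pd e i G x : ℝ) : 𝕜) :=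
  (ev_chartDer he hU hUe i F hx hG).trans
    (pd_ofReal (differentiableAt_comp_symm he hU hGs (hUe hx) hx) i)

theorem ev_del_of (i : Fin d) {x : M} (hx : x ∈ U) :
    ev hx ((𝔽).del i (of f hf)) = covFun D e f 1 ![i] ![] x := by
  rw [covFun_one, ev_del D P he hU hUe i _ hx (G := f) fun _ _ => rfl]
  rfl

theorem ev_hess (k l : Fin d) {x : M} (hx : x ∈ U) :
    ev hx ((𝔽).hess (of f hf) k l) = covFun D e f 2 ![k, l] ![] x := by
  have h1 : ∀ (i : Fin d) (y : M) (hy : y ∈ U), ev hy ((𝔽).del i (of f hf)) = pd e i f y :=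
    fun i y hy => ev_del D P he hU hUe i _ hy fun _ _ => rfl
  rw [covFun_two, PoissonFrame.hess, Matrix.of_apply, map_sub, map_sum,
    ev_del D P he hU hUe k _ hx (h1 l)]
  simp only [map_mul, h1, ev_Γ]

theorem ev_hess3 (k l i : Fin d) {x : M} (hx : x ∈ U) :
    ev hx ((𝔽).hess3 (of f hf) k l i) = covFun D e f 3 ![k, l, i] ![] x := by
  rw [covFun_three, PoissonFrame.hess3, map_sub, map_sub, map_sum, map_sum,
    ev_del D P he hU hUe k _ hx fun y hy => ev_hess D P he hU hUe hf l i hy]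
  simp only [map_mul, ev_hess, ev_Γ]

theorem ev_covP (r l s : Fin d) {x : M} (hx : x ∈ U) :
    ev hx ((𝔽).covP r l s) = ((covPoisson D P e 1 ![r] ![l, s] x : ℝ) : 𝕜) := by
  rw [covPoisson_one, PoissonFrame.covP, map_add, map_add, map_sum, map_sum,
    ev_del_ofReal D P he hU hUe r _ hx ((P.contMDiffOn_comp he l s).mono hUe) fun _ _ => rfl]
  push_cast
  simp only [map_mul, ev_P, ev_Γ]

theorem ev_covP2 (k l i j : Fin d) {x : M} (hx : x ∈ U) :
    ev hx ((𝔽).covP2 k l i j) = ((covPoisson D P e 2 ![k, l] ![i, j] x : ℝ) : 𝕜) := by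
  rw [covPoisson_two, PoissonFrame.covP2, map_add, map_add, map_sub, map_sum, map_sum, map_sum,
    ev_del_ofReal D P he hU hUe k _ hx (contMDiffOn_covPoisson D P he hU hUe 1 ![l] ![i, j])
      fun y hy => ev_covP D P he hU hUe l i j hy]
  push_cast
  simp only [map_mul, ev_covP, ev_Γ]

theorem ev_curv (i k l j : Fin d) {x : M} (hx : x ∈ U) :
    ev hx ((𝔽).curv i k l j) = ((curvature D e i k l j x : ℝ) : 𝕜) := by
  have hΓ : ∀ k i j, ContMDiffOn (𝓡 d) 𝓘(ℝ, ℝ) ∞ (christoffel D e k i j) U :=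
    fun k i j => (contMDiffOn_christoffel D he k i j).mono hUe
  rw [curvature, PoissonFrame.curv, map_add, map_sub, map_sum,
    ev_del_ofReal D P he hU hUe i _ hx (hΓ j k l) fun _ _ => rfl,
    ev_del_ofReal D P he hU hUe k _ hx (hΓ j i l) fun _ _ => rfl]
  push_cast
  simp only [map_sub, map_mul, ev_Γ]

theorem ev_lie_ham (j k l : Fin d) {x : M} (hx : x ∈ U) :
    ev hx ((𝔽).lie ((𝔽).ham (of f hf)) j k l) = lieConn D P e f j k l x := by
  rw [PoissonFrame.lie_ham, lieConn]
  simp only [map_add, map_sum, map_mul, ev_hess3, ev_hess, ev_covP, ev_covP2, ev_curv, ev_P,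
    ev_del_of]

theorem ev_c3 {x : M} (hx : x ∈ U) :
    ev hx ((𝔽).c3 (of f hf) (of g hg)) = 6 * formulaC3 D P e f g x := by
  rw [PoissonFrame.c3, PoissonFrame.pair, formulaC3]
  simp only [map_neg, map_sum, map_mul, ev_lie_ham, ev_P]
  ring

theorem ev_c2 {x : M} (hx : x ∈ U) :
    ev hx ((𝔽).c2 (of f hf) (of g hg)) = 6 * formulaC2 D P e f g x := by
  rw [PoissonFrame.c2_eq_sum, formulaC2]
  simp only [map_add, map_sub, map_sum, map_mul, ev_hess, ev_covP, ev_P, ev_del_of, map_ofNat]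
  ring

end Link

section VectorFields

variable {d : ℕ} {M : Type u} [TopologicalSpace M] [T2Space M]
  [ChartedSpace (EuclideanSpace ℝ (Fin d)) M] [IsManifold (𝓡 d) ∞ M]
  (D : TorsionFreeConnection d M) (P : PoissonTensor d M)
  {e : OpenPartialHomeomorph M (EuclideanSpace ℝ (Fin d))}

/-! ### Vector fields with given components -/

/-- The vector field with components `a` in the chart `e`. -/
def chartField (e : OpenPartialHomeomorph M (EuclideanSpace ℝ (Fin d))) (a : Fin d → M → ℝ)
    (x : M) : TangentSpace (𝓡 d) x := ∑ i, a i x • coordVector e i x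

theorem coordCovector_chartField (he : e ∈ Charts d M) {x : M} (hx : x ∈ e.source)
    (a : Fin d → M → ℝ) (j : Fin d) : coordCovector e j x (chartField e a x) = a j x := by
  simp [chartField, coordCovector_coordVector he hx]

theorem dAt_chartField (he : e ∈ Charts d M) {x : M} (hx : x ∈ e.source)
    (a : Fin d → M → ℝ) {F : M → ℝ} (hF : MDifferentiableAt (𝓡 d) 𝓘(ℝ, ℝ) F x) :
    dAt F x (chartField e a x) = ∑ i, a i x * pd e i F x := by
  simp [chartField, dAt_coordVector he hx hF]

theorem mdifferentiableAt_smul_coordVector (he : e ∈ Charts d M) {x : M} (hx : x ∈ e.source)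
    {a : M → ℝ} (ha : MDifferentiableAt (𝓡 d) 𝓘(ℝ, ℝ) a x) (i : Fin d) :
    MDifferentiableAt (𝓡 d) (𝓡 d).tangent (T% (a • coordVector e i)) x :=
  ha.smul_section (mdifferentiableAt_coordVector he hx i)

theorem chartField_eq_sum (a : Fin d → M → ℝ) :
    chartField e a = ∑ i, a i • coordVector e i := by
  funext x
  simp [chartField]

theorem mdifferentiableAt_chartField (he : e ∈ Charts d M) {x : M} (hx : x ∈ e.source)
    {a : Fin d → M → ℝ} (ha : ∀ i, MDifferentiableAt (𝓡 d) 𝓘(ℝ, ℝ) (a i) x) :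
    MDifferentiableAt (𝓡 d) (𝓡 d).tangent (T% (chartField e a)) x :=
  MDifferentiableAt.sum_section fun i _ => mdifferentiableAt_smul_coordVector he hx (ha i) i

theorem cov_sum {ι : Type*} (s : Finset ι) {Y : ι → ∀ x : M, TangentSpace (𝓡 d) x} {x : M}
    (hY : ∀ i, MDifferentiableAt (𝓡 d) (𝓡 d).tangent (T% (Y i)) x) :
    D.cov (∑ i ∈ s, Y i) x = ∑ i ∈ s, D.cov (Y i) x := by
  classical
  induction s using Finset.induction_on with
  | empty => simp [(D.cov.isCovariantDerivativeOn (s := univ)).zero]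
  | insert i s hi ih =>
    have h : MDifferentiableAt (𝓡 d) (𝓡 d).tangent (T% (∑ i ∈ s, Y i)) x := by
      have := MDifferentiableAt.sum_section (s := s) fun i _ => hY i
      simpa only [Finset.sum_apply] using this
    rw [Finset.sum_insert hi, Finset.sum_insert hi, ← ih]
    exact (D.cov.isCovariantDerivativeOn (s := univ)).add (hY i) h

theorem cov_chartField (he : e ∈ Charts d M) {x : M} (hx : x ∈ e.source)
    {a : Fin d → M → ℝ} (ha : ∀ i, MDifferentiableAt (𝓡 d) 𝓘(ℝ, ℝ) (a i) x)
    (v : TangentSpace (𝓡 d) x) :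
    D.cov (chartField e a) x v
      = ∑ i, (a i x • D.cov (coordVector e i) x v + dAt (a i) x v • coordVector e i x) := by
  rw [chartField_eq_sum, cov_sum D _ fun i => mdifferentiableAt_smul_coordVector he hx (ha i) i,
    sum_apply]
  refine Finset.sum_congr rfl fun i _ => ?_
  rw [(D.cov.isCovariantDerivativeOn (s := univ)).leibniz
    (mdifferentiableAt_coordVector he hx i) (ha i)]
  rfl

theorem mlieBracket_sum {ι : Type*} (s : Finset ι) (X : ∀ x : M, TangentSpace (𝓡 d) x)
    {Y : ι → ∀ x : M, TangentSpace (𝓡 d) x} {x : M}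
    (hY : ∀ i, MDifferentiableAt (𝓡 d) (𝓡 d).tangent (T% (Y i)) x) :
    VectorField.mlieBracket (𝓡 d) X (∑ i ∈ s, Y i) x
      = ∑ i ∈ s, VectorField.mlieBracket (𝓡 d) X (Y i) x := by
  classical
  induction s using Finset.induction_on with
  | empty => simp
  | insert i s hi ih =>
    have h : MDifferentiableAt (𝓡 d) (𝓡 d).tangent (T% (∑ i ∈ s, Y i)) x := by
      have := MDifferentiableAt.sum_section (s := s) fun i _ => hY i
      simpa only [Finset.sum_apply] using this
    rw [Finset.sum_insert hi, Finset.sum_insert hi, ← ih]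
    exact VectorField.mlieBracket_add_right (hY i) h

theorem mlieBracket_chartField (he : e ∈ Charts d M) {x : M} (hx : x ∈ e.source)
    (X : ∀ x : M, TangentSpace (𝓡 d) x)
    {a : Fin d → M → ℝ} (ha : ∀ i, MDifferentiableAt (𝓡 d) 𝓘(ℝ, ℝ) (a i) x) :
    VectorField.mlieBracket (𝓡 d) X (chartField e a) x
      = ∑ i, (dAt (a i) x (X x) • coordVector e i x
        + a i x • VectorField.mlieBracket (𝓡 d) X (coordVector e i) x) := by
  rw [chartField_eq_sum, mlieBracket_sum _ _
    fun i => mdifferentiableAt_smul_coordVector he hx (ha i) i]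
  refine Finset.sum_congr rfl fun i _ => ?_
  rw [VectorField.mlieBracket_smul_right (ha i) (mdifferentiableAt_coordVector he hx i)]
  rfl

theorem mlieBracket_chartField_coordVector (he : e ∈ Charts d M) {x : M} (hx : x ∈ e.source)
    {a : Fin d → M → ℝ} (ha : ∀ i, MDifferentiableAt (𝓡 d) 𝓘(ℝ, ℝ) (a i) x) (k : Fin d) :
    VectorField.mlieBracket (𝓡 d) (chartField e a) (coordVector e k) x
      = chartField e (fun i y => -pd e k (a i) y) x := by
  rw [VectorField.mlieBracket_swap_apply, mlieBracket_chartField he hx _ ha, chartField]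
  simp [mlieBracket_coordVector he hx, dAt_coordVector he hx (ha _)]

/-! ### The Lie derivative of the connection -/

/-- For X = a^i ∂_i one has [X, ∂_m] = -(∂_m a^i) ∂_i. Expanding the three terms of L_X ∇ by the
Leibniz rules gives the expression that defines `PoissonFrame.lie`. -/
theorem coordCovector_lieDerivConnection (he : e ∈ Charts d M) {x : M} (hx : x ∈ e.source)
    {X : ∀ x : M, TangentSpace (𝓡 d) x} {a : Fin d → M → ℝ}
    (ha : ∀ i, ContMDiffOn (𝓡 d) 𝓘(ℝ, ℝ) ∞ (a i) e.source)
    (hX : ∀ y ∈ e.source, X y = chartField e a y) (j k l : Fin d) :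
    coordCovector e j x (lieDerivConnection D X (coordVector e k) (coordVector e l) x)
      = pd e k (pd e l (a j)) x + ∑ i, (a i x * pd e i (christoffel D e j k l) x
        - christoffel D e i k l x * pd e i (a j) x + christoffel D e j i l x * pd e k (a i) x
        + christoffel D e j k i x * pd e l (a i) x) := by
  have had : ∀ y ∈ e.source, ∀ i, MDifferentiableAt (𝓡 d) 𝓘(ℝ, ℝ) (a i) y := fun y hy i =>
    contMDiffOn_mdifferentiableAt e.open_source hy (ha i)
  have hpd : ∀ i l, MDifferentiableAt (𝓡 d) 𝓘(ℝ, ℝ) (fun y => -pd e l (a i) y) x := fun i l =>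
    contMDiffOn_mdifferentiableAt e.open_source hx
      (contMDiffOn_pd he e.open_source le_rfl (ha i) l).neg
  have hΓ : ∀ m, MDifferentiableAt (𝓡 d) 𝓘(ℝ, ℝ) (christoffel D e m k l) x := fun m =>
    contMDiffOn_mdifferentiableAt e.open_source hx (contMDiffOn_christoffel D he m k l)
  have hbr : ∀ m, ∀ y ∈ e.source, VectorField.mlieBracket (𝓡 d) X (coordVector e m) y
      = chartField e (fun i y => -pd e m (a i) y) y := fun m y hy =>
    (EventuallyEq.mlieBracket_vectorField_eq
      (eventually_of_mem (e.open_source.mem_nhds hy) hX) .rfl).trans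
      (mlieBracket_chartField_coordVector he hy (had y hy) m)
  -- The bracket is differentiated once more by ∇, so its formula is required near x and not only at
  -- x.
  have hbr' : ∀ m, VectorField.mlieBracket (𝓡 d) X (coordVector e m) =ᶠ[𝓝 x]
      chartField e (fun i y => -pd e m (a i) y) := fun m =>
    eventually_of_mem (e.open_source.mem_nhds hx) (hbr m)
  have hmd := mdifferentiableAt_chartField he hx fun i => hpd i l
  have hcov : D.cov (VectorField.mlieBracket (𝓡 d) X (coordVector e l)) x
      = D.cov (chartField e (fun i y => -pd e l (a i) y)) x := by
    refine cov_congr D (hmd.congr_of_eventuallyEq ?_) hmd (hbr' l)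
    filter_upwards [hbr' l] with y hy
    rw [hy]
  have hΓf : (fun y => D.cov (coordVector e l) y (coordVector e k y)) =ᶠ[𝓝 x]
      chartField e (fun m => christoffel D e m k l) :=
    eventually_of_mem (e.open_source.mem_nhds hx) fun y hy => cov_coordVector D he hy k l
  have hB : VectorField.mlieBracket (𝓡 d) X
      (fun y => D.cov (coordVector e l) y (coordVector e k y)) x
      = VectorField.mlieBracket (𝓡 d) X (chartField e fun m => christoffel D e m k l) x :=
    EventuallyEq.mlieBracket_vectorField_eq .rfl hΓf
  rw [lieDerivConnection, hB, hcov, hbr k x hx,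
    mlieBracket_chartField he hx X hΓ, cov_chartField D he hx fun i => hpd i l, hX x hx]
  have hn : pd e k (fun y => -pd e l (a j) y) x = -pd e k (pd e l (a j)) x :=
    pd_clm (-ContinuousLinearMap.id ℝ ℝ) (differentiableAt_comp_symm he e.open_source
      (contMDiffOn_pd he e.open_source le_rfl (ha j) l) hx hx) k
  have h1 : coordCovector e j x (D.cov (coordVector e l) x
      (chartField e (fun i y => -pd e k (a i) y) x))
      = -∑ i, christoffel D e j i l x * pd e k (a i) x := by
    simp only [chartField, map_sum, map_smul, smul_eq_mul, ← Finset.sum_neg_distrib]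
    refine Finset.sum_congr rfl fun i _ => ?_
    change -pd e k (a i) x * christoffel D e j i l x = _
    ring
  have h2 : ∀ i, coordCovector e j x (D.cov (coordVector e i) x (coordVector e k x))
      = christoffel D e j k i x := fun i => rfl
  simp only [map_sub, map_sum, map_add, map_smul, smul_eq_mul, hbr _ x hx,
    coordCovector_chartField he hx, coordCovector_coordVector he hx, dAt_chartField he hx _ (hΓ _),
    dAt_coordVector he hx (hpd _ _), h1, h2, mul_ite, mul_one, mul_zero, Finset.sum_add_distrib,
    Finset.sum_sub_distrib, Finset.sum_ite_eq', Finset.mem_univ, if_true, hn, neg_mul, mul_neg,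
    Finset.sum_neg_distrib]
  simp only [mul_comm (pd e l _ x)]
  ring

theorem PoissonTensor.dual_hamiltonian (f : M → ℝ) (x : M)
    (α : Module.Dual ℝ (TangentSpace (𝓡 d) x)) :
    α (P.hamiltonian f x) = P.toFun x (dAt f x) α := by
  have := (Module.evalEquiv ℝ (TangentSpace (𝓡 d) x)).apply_symm_apply (P.toFun x (dAt f x))
  exact congrArg (fun L => L α) this

theorem PoissonTensor.hamiltonian_eq (he : e ∈ Charts d M) (f : M → ℝ) {x : M}
    (hx : x ∈ e.source) :
    P.hamiltonian f x = chartField e (fun j => P.realBracket f fun y => e y j) x := by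
  rw [eq_sum_coordVector he hx (P.hamiltonian f x), chartField]
  simp only [P.dual_hamiltonian]
  rfl

-- The components of X_f are the brackets {f, x^j}, that is, the values of `PoissonFrame.ham`. Both
-- sides are then `PoissonFrame.lie` evaluated at x, one through vector fields and the other through
-- the five-term formula.
open LocalFun in
theorem coordCovector_lieDerivConnection_hamiltonian (he : e ∈ Charts d M) {x : M}
    (hx : x ∈ e.source) {f : M → ℝ} (hf : ContMDiffOn (𝓡 d) 𝓘(ℝ, ℝ) ∞ f e.source)
    (j k l : Fin d) :
    coordCovector e j x
      (lieDerivConnection D (P.hamiltonian f) (coordVector e k) (coordVector e l) x)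
      = lieConn D P e f j k l x := by
  have hX : ∀ j, ContMDiffOn (𝓡 d) 𝓘(ℝ, ℝ) ∞ (P.realBracket f fun y => e y j) e.source :=
    fun j => P.contMDiffOn_realBracket e.open_source hf (contMDiffOn_coord he j)
  have hham : ∀ j (y : M) (hy : y ∈ e.source),
      ev hy ((chartFrame D P ℝ he e.open_source le_rfl).ham (of f hf) j)
        = P.realBracket f (fun y => e y j) y := by
    intro j y hy
    rw [P.realBracket_eq_sum he hy (contMDiffOn_mdifferentiableAt e.open_source hy hf)
      (contMDiffOn_mdifferentiableAt e.open_source hy (contMDiffOn_coord he j))]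
    simp only [PoissonFrame.ham, map_sum, map_mul, ev_P, ev_del_of, covFun_one, pd_coord hy]
    simp
  rw [coordCovector_lieDerivConnection D he hx hX (fun y hy => P.hamiltonian_eq he f hy),
    ← ev_lie_ham D P he e.open_source le_rfl hf j k l hx, PoissonFrame.lie]
  have h1 : ∀ (i j : Fin d) (y : M) (hy : y ∈ e.source),
      ev hy ((chartFrame D P ℝ he e.open_source le_rfl).del i
        ((chartFrame D P ℝ he e.open_source le_rfl).ham (of f hf) j))
        = pd e i (P.realBracket f fun y => e y j) y :=
    fun i j y hy => ev_del D P he e.open_source le_rfl i _ hy (hham j)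
  have h2 : ∀ i, ev hx ((chartFrame D P ℝ he e.open_source le_rfl).del i
      ((chartFrame D P ℝ he e.open_source le_rfl).Γ j k l)) = pd e i (christoffel D e j k l) x :=
    fun i => ev_del D P he e.open_source le_rfl i _ hx fun _ _ => rfl
  rw [map_add, ev_del D P he e.open_source le_rfl k _ hx (h1 l j)]
  simp only [map_sum, map_add, map_sub, map_mul, h1, h2, hham, ev_Γ]
  rfl

end VectorFields

section Transition

variable {d : ℕ} {M : Type u} [TopologicalSpace M] [T2Space M]
  [ChartedSpace (EuclideanSpace ℝ (Fin d)) M] [IsManifold (𝓡 d) ∞ M] {𝕜 : Type v} [RCLike 𝕜]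
  (D : TorsionFreeConnection d M) (P : PoissonTensor d M)
  {e e' : OpenPartialHomeomorph M (EuclideanSpace ℝ (Fin d))} {U : Set M}

open LocalFun

/-! ### The Poisson bracket in a chart -/

theorem mul_eq_re_im (z w : 𝕜) : z * w =
    ((RCLike.re z * RCLike.re w - RCLike.im z * RCLike.im w : ℝ) : 𝕜)
      + RCLike.I * ((RCLike.re z * RCLike.im w + RCLike.im z * RCLike.re w : ℝ) : 𝕜) := by
  rw [← RCLike.mul_re, ← RCLike.mul_im, mul_comm RCLike.I, RCLike.re_add_im]

/-- The bracket is defined by real and imaginary parts. These are real-linear, hence commute with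
partial derivatives, and the four real brackets recombine by complex multiplication. -/
theorem ev_ad (he : e ∈ Charts d M) (hU : IsOpen U) (hUe : U ⊆ e.source) {f g : M → 𝕜}
    (hf : ContMDiffOn (𝓡 d) 𝓘(ℝ, 𝕜) ∞ f U) (hg : ContMDiffOn (𝓡 d) 𝓘(ℝ, 𝕜) ∞ g U) {x : M}
    (hx : x ∈ U) :
    ev hx ((chartFrame D P 𝕜 he hU hUe).ad (of f hf) (of g hg)) = P.bracket f g x := by
  have hL : ∀ (L : 𝕜 →L[ℝ] ℝ) {f : M → 𝕜}, ContMDiffOn (𝓡 d) 𝓘(ℝ, 𝕜) ∞ f U →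
      MDifferentiableAt (𝓡 d) 𝓘(ℝ, ℝ) (fun y => L (f y)) x ∧
        ∀ i, pd e i (fun y => L (f y)) x = L (pd e i f x) := fun L f hf =>
    ⟨contMDiffOn_mdifferentiableAt hU hx (L.contMDiff.comp_contMDiffOn hf), fun i =>
      pd_clm L (differentiableAt_comp_symm he hU hf (hUe hx) hx) i⟩
  have key : ∀ L L' : 𝕜 →L[ℝ] ℝ, P.realBracket (fun y => L (f y)) (fun y => L' (g y)) x
      = ∑ i, ∑ j, P.comp e i j x * (L (pd e i f x) * L' (pd e j g x)) := by
    intro L L'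
    rw [P.realBracket_eq_sum he (hUe hx) (hL L hf).1 (hL L' hg).1]
    simp only [(hL L hf).2, (hL L' hg).2]
  have h1 := key RCLike.reCLM RCLike.reCLM
  have h2 := key RCLike.reCLM RCLike.imCLM
  have h3 := key RCLike.imCLM RCLike.reCLM
  have h4 := key RCLike.imCLM RCLike.imCLM
  simp only [RCLike.reCLM_apply, RCLike.imCLM_apply] at h1 h2 h3 h4
  rw [PoissonTensor.bracket]
  simp only [h1, h2, h3, h4]
  rw [PoissonFrame.ad_eq_sum]
  simp only [map_sum, map_mul, ev_P, ev_del_of, covFun_one, Matrix.cons_val_fin_one]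
  simp only [mul_eq_re_im (pd e _ f x) (pd e _ g x)]
  push_cast
  simp only [mul_add, mul_sub, Finset.sum_add_distrib, Finset.sum_sub_distrib, Finset.mul_sum]
  simp only [mul_left_comm RCLike.I]

/-! ### Change of charts -/

theorem pd_change {V : Type*} [NormedAddCommGroup V] [NormedSpace ℝ V] (he : e ∈ Charts d M)
    (he' : e' ∈ Charts d M) {x : M} (hx : x ∈ e.source) (hx' : x ∈ e'.source) {F : M → V}
    (hF : MDifferentiableAt (𝓡 d) 𝓘(ℝ, V) F x) (k : Fin d) :
    pd e k F x = ∑ a, pd e k (fun y => e' y a) x • pd e' a F x := by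
  rw [← mvfderiv_coordVector he hx hF, eq_sum_coordVector he' hx' (coordVector e k x), map_sum]
  refine Finset.sum_congr rfl fun a _ => ?_
  rw [map_smul, mvfderiv_coordVector he' hx' hF, coordCovector, dAt_coordVector he hx
    (contMDiffOn_mdifferentiableAt e'.open_source hx' (contMDiffOn_coord he' a))]

/-- Expand ∂_l of the first chart in the coordinate fields of the second near x, differentiate
covariantly along ∂_k, and compare the c-th components. -/
theorem christoffel_change (he : e ∈ Charts d M)
    (he' : e' ∈ Charts d M) {x : M} (hx : x ∈ e.source) (hx' : x ∈ e'.source) (c k l : Fin d) :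
    ∑ a, ∑ b, pd e k (fun y => e' y a) x * (pd e l (fun y => e' y b) x
        * christoffel D e' c a b x)
      = ∑ j, pd e j (fun y => e' y c) x * christoffel D e j k l x
        - pd e k (pd e l fun y => e' y c) x := by
  have hc : ∀ a, MDifferentiableAt (𝓡 d) 𝓘(ℝ, ℝ) (fun y => e' y a) x := fun a =>
    contMDiffOn_mdifferentiableAt e'.open_source hx' (contMDiffOn_coord he' a)
  have hO : IsOpen (e.source ∩ e'.source) := e.open_source.inter e'.open_source
  have hJ : ∀ b, MDifferentiableAt (𝓡 d) 𝓘(ℝ, ℝ) (pd e l fun y => e' y b) x := fun b =>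
    contMDiffOn_mdifferentiableAt hO ⟨hx, hx'⟩ (contMDiffOn_pd he hO inter_subset_left
      ((contMDiffOn_coord he' b).mono inter_subset_right) l)
  have hv : ∀ y ∈ e.source ∩ e'.source, coordVector e l y
      = chartField e' (fun b => pd e l fun y => e' y b) y := fun y hy => by
    rw [eq_sum_coordVector he' hy.2 (coordVector e l y), chartField]
    refine Finset.sum_congr rfl fun a _ => ?_
    rw [coordCovector, dAt_coordVector he hy.1
      (contMDiffOn_mdifferentiableAt e'.open_source hy.2 (contMDiffOn_coord he' a))]
  have h1 : D.cov (coordVector e l) x (coordVector e k x)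
      = D.cov (chartField e' (fun b => pd e l fun y => e' y b)) x (coordVector e k x) := by
    rw [cov_congr D (mdifferentiableAt_coordVector he hx l)
      (mdifferentiableAt_chartField he' hx' hJ) (eventually_of_mem (hO.mem_nhds ⟨hx, hx'⟩) hv)]
  have h2 := congrArg (coordCovector e' c x) h1
  rw [cov_coordVector D he hx, cov_chartField D he' hx' hJ] at h2
  have h3 : ∀ b, coordCovector e' c x (D.cov (coordVector e' b) x (coordVector e k x))
      = ∑ a, pd e k (fun y => e' y a) x * christoffel D e' c a b x := by
    intro b
    rw [eq_sum_coordVector he' hx' (coordVector e k x)]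
    simp only [map_sum, map_smul, smul_eq_mul, coordCovector, dAt_coordVector he hx (hc _)]
    rfl
  have h4 : ∀ j, coordCovector e' c x (coordVector e j x) = pd e j (fun y => e' y c) x :=
    fun j => dAt_coordVector he hx (hc c) j
  simp only [map_sum, map_smul, map_add, smul_eq_mul, h3, h4, dAt_coordVector he hx (hJ _),
    coordCovector_coordVector he' hx', mul_ite, mul_one, mul_zero, Finset.sum_add_distrib,
    Finset.sum_ite_eq', Finset.mem_univ, if_true] at h2
  rw [Finset.sum_comm]
  simp only [Finset.mul_sum, mul_comm (pd e _ (fun y => e' y c) x)] at h2 ⊢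
  rw [h2]
  simp only [mul_left_comm (pd e k _ x)]
  ring

theorem ev_del_ofR (he : e ∈ Charts d M) (hU : IsOpen U) (hUe : U ⊆ e.source) (k : Fin d)
    {F : M → ℝ} (hF : ContMDiffOn (𝓡 d) 𝓘(ℝ, ℝ) ∞ F U) {x : M} (hx : x ∈ U) :
    ev hx ((chartFrame D P 𝕜 he hU hUe).del k (ofR F hF)) = ((pd e k F x : ℝ) : 𝕜) :=
  ev_del_ofReal D P he hU hUe k _ hx hF fun _ _ => rfl

/-- The transition between two charts. -/
def chartTransition (𝕜 : Type v) [RCLike 𝕜] (he : e ∈ Charts d M) (he' : e' ∈ Charts d M) :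
    PoissonFrame.Transition
      (chartFrame D P 𝕜 he (e.open_source.inter e'.open_source) inter_subset_left)
      (chartFrame D P 𝕜 he' (e.open_source.inter e'.open_source) inter_subset_right) where
  y a := ofR (fun y => e' y a) ((contMDiffOn_coord he' a).mono inter_subset_right)
  K := .of fun a k => ofR (pd e' a fun y => e y k) (contMDiffOn_pd he'
    (e.open_source.inter e'.open_source) inter_subset_right
      ((contMDiffOn_coord he k).mono inter_subset_left) a)
  del_eq k f := ext_ev fun x hx => by
    have hO : IsOpen (e.source ∩ e'.source) := e.open_source.inter e'.open_source
    simp only [map_sum, map_mul]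
    rw [ev_del D P he hO inter_subset_left k _ hx fun y hy => ev_eq_extend hy f,
      pd_change he he' hx.1 hx.2 (contMDiffOn_mdifferentiableAt hO hx (contMDiffOn_extend f))]
    refine Finset.sum_congr rfl fun a _ => ?_
    rw [ev_del D P he' hO inter_subset_right a _ hx fun y hy => ev_eq_extend hy f,
      ev_del_ofR, RCLike.real_smul_eq_coe_mul]
  del'_y a b := ext_ev fun x hx => by
    rw [ev_del_ofR, pd_coord hx.2]
    split_ifs <;> simp
  inv := Matrix.ext fun k l => ext_ev fun x hx => by
    -- Applied to the coordinates of `e` itself, the chain rule says that the two Jacobian matrices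
    -- are inverse to each other.
    have h := pd_change he he' hx.1 hx.2
      (contMDiffOn_mdifferentiableAt e.open_source hx.1 (contMDiffOn_coord he l)) k
    rw [pd_coord hx.1] at h
    simp only [Matrix.mul_apply, Matrix.of_apply, map_sum, map_mul, ev_ofR, Matrix.one_apply]
    simp only [ev_del_ofR, ← RCLike.ofReal_mul, ← RCLike.ofReal_sum]
    simp only [smul_eq_mul] at h
    rw [← h]
    split_ifs <;> simp
  P_eq := Matrix.ext fun a b => ext_ev fun x hx => by
    have hc : ∀ a, MDifferentiableAt (𝓡 d) 𝓘(ℝ, ℝ) (fun y => e' y a) x := fun a =>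
      contMDiffOn_mdifferentiableAt e'.open_source hx.2 (contMDiffOn_coord he' a)
    rw [ev_P, P.comp_eq_realBracket, P.realBracket_eq_sum he hx.1 (hc a) (hc b)]
    simp only [Matrix.mul_apply, Matrix.transpose_apply, Matrix.of_apply, map_sum, map_mul,
      ev_del_ofR, ev_P]
    rw [Finset.sum_comm]
    refine Finset.sum_congr rfl fun j _ => ?_
    rw [Finset.sum_mul]
    exact Finset.sum_congr rfl fun i _ => by ring
  Γ_eq k l c := ext_ev fun x hx => by
    have hO : IsOpen (e.source ∩ e'.source) := e.open_source.inter e'.open_source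
    have h2 := ev_del_ofReal D P he hO inter_subset_left k _ hx
      (contMDiffOn_pd he hO inter_subset_left
        ((contMDiffOn_coord he' c).mono inter_subset_right) l)
      fun y hy => ev_del_ofR (𝕜 := 𝕜) D P he hO inter_subset_left l
        ((contMDiffOn_coord he' c).mono inter_subset_right) hy
    have h := congrArg (RCLike.ofReal (K := 𝕜)) (christoffel_change D he he' hx.1 hx.2 c k l)
    push_cast at h
    rw [map_sub, h2]
    simp only [map_sum, map_mul, ev_del_ofR, ev_Γ]
    exact h

end Transition

section DiffOp

variable {d : ℕ} {M : Type u} [TopologicalSpace M]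
  [ChartedSpace (EuclideanSpace ℝ (Fin d)) M] {𝕜 : Type v} [RCLike 𝕜]
  {e : OpenPartialHomeomorph M (EuclideanSpace ℝ (Fin d))} {N : ℕ}

/-! ### Differential operators in a chart -/

/-- `L` is a linear differential operator of order at most `N` on the domain of the chart `e`. -/
def IsDiffOp (e : OpenPartialHomeomorph M (EuclideanSpace ℝ (Fin d))) (N : ℕ)
    (L : SmoothFun 𝕜 d M → M → 𝕜) : Prop :=
  ∃ a : ∀ p : ℕ, (Fin p → Fin d) → M → 𝕜,
    (∀ p I, ContMDiffOn (𝓡 d) 𝓘(ℝ, 𝕜) ∞ (a p I) e.source) ∧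
    ∀ f : SmoothFun 𝕜 d M, ∀ x ∈ e.source,
      L f x = ∑ p ∈ Finset.range (N + 1), ∑ I : Fin p → Fin d, a p I x * iterPd e I f x

/-- `B` is a bidifferential operator of order at most `N` on the domain of the chart `e`. -/
def IsBidiffOp (e : OpenPartialHomeomorph M (EuclideanSpace ℝ (Fin d))) (N : ℕ)
    (B : SmoothFun 𝕜 d M → SmoothFun 𝕜 d M → M → 𝕜) : Prop :=
  ∃ a : ∀ p q : ℕ, (Fin p → Fin d) → (Fin q → Fin d) → M → 𝕜,
    (∀ p q I J, ContMDiffOn (𝓡 d) 𝓘(ℝ, 𝕜) ∞ (a p q I J) e.source) ∧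
    ∀ f g : SmoothFun 𝕜 d M, ∀ x ∈ e.source,
      B f g x = ∑ p ∈ Finset.range (N + 1), ∑ q ∈ Finset.range (N + 1),
        ∑ I : Fin p → Fin d, ∑ J : Fin q → Fin d,
          a p q I J x * (iterPd e I f x * iterPd e J g x)

theorem IsDiffOp.congr {L L' : SmoothFun 𝕜 d M → M → 𝕜} (h : IsDiffOp e N L)
    (h' : ∀ f, ∀ x ∈ e.source, L' f x = L f x) : IsDiffOp e N L' := by
  obtain ⟨a, ha, hL⟩ := h
  exact ⟨a, ha, fun f x hx => (h' f x hx).trans (hL f x hx)⟩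

theorem IsDiffOp.zero : IsDiffOp e N fun (_ : SmoothFun 𝕜 d M) _ => 0 :=
  ⟨fun _ _ _ => 0, fun _ _ => contMDiffOn_const, by simp⟩

theorem IsDiffOp.add {L L' : SmoothFun 𝕜 d M → M → 𝕜} (h : IsDiffOp e N L)
    (h' : IsDiffOp e N L') : IsDiffOp e N fun f x => L f x + L' f x := by
  obtain ⟨a, ha, hL⟩ := h
  obtain ⟨a', ha', hL'⟩ := h'
  refine ⟨fun p I => a p I + a' p I, fun p I => (ha p I).add (ha' p I), fun f x hx => ?_⟩
  simp only [hL f x hx, hL' f x hx, Pi.add_apply, add_mul, Finset.sum_add_distrib]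

theorem IsDiffOp.smul {L : SmoothFun 𝕜 d M → M → 𝕜} (h : IsDiffOp e N L) {c : M → 𝕜}
    (hc : ContMDiffOn (𝓡 d) 𝓘(ℝ, 𝕜) ∞ c e.source) : IsDiffOp e N fun f x => c x * L f x := by
  obtain ⟨a, ha, hL⟩ := h
  refine ⟨fun p I => c * a p I, fun p I => hc.mul (ha p I), fun f x hx => ?_⟩
  simp only [hL f x hx, Pi.mul_apply, Finset.mul_sum, mul_assoc]

theorem IsDiffOp.sum {ι : Type*} (s : Finset ι) {L : ι → SmoothFun 𝕜 d M → M → 𝕜}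
    (h : ∀ i, IsDiffOp e N (L i)) : IsDiffOp e N fun f x => ∑ i ∈ s, L i f x := by
  classical
  induction s using Finset.induction_on with
  | empty => simpa using IsDiffOp.zero
  | insert i s hi ih =>
    simp only [Finset.sum_insert hi]
    exact (h i).add ih

theorem isDiffOp_iterPd {m : ℕ} (hm : m ≤ N) (I : Fin m → Fin d) :
    IsDiffOp e N fun (f : SmoothFun 𝕜 d M) x => iterPd e I f x := by
  classical
  -- The coefficient is an indicator. Comparison takes place in the sigma type because the type of J
  -- depends on p.
  refine ⟨fun p J _ => if (⟨p, J⟩ : Σ p, Fin p → Fin d) = ⟨m, I⟩ then 1 else 0,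
    fun p J => contMDiffOn_const, fun f x _ => ?_⟩
  rw [Finset.sum_sigma', Finset.sum_eq_single ⟨m, I⟩]
  · simp
  · rintro ⟨p, J⟩ _ h
    simp [h]
  · intro h
    exact absurd (Finset.mem_sigma.mpr ⟨Finset.mem_range.mpr (Nat.lt_succ_of_le hm), Finset.mem_univ _⟩) h

theorem IsDiffOp.mono {N' : ℕ} (hN : N ≤ N') {L : SmoothFun 𝕜 d M → M → 𝕜}
    (h : IsDiffOp e N L) : IsDiffOp e N' L := by
  obtain ⟨a, ha, hL⟩ := h
  -- Summing over `Fin (N + 1)` keeps the bound on the order of each summand available.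
  have : IsDiffOp e N' fun (f : SmoothFun 𝕜 d M) x =>
      ∑ i : Fin (N + 1), ∑ I : Fin i → Fin d, a i I x * iterPd e I f x :=
    .sum _ fun i => .sum _ fun I => (isDiffOp_iterPd (by omega) I).smul (ha i I)
  refine this.congr fun f x hx => ?_
  rw [hL f x hx, Finset.sum_range]

theorem pd_iterPd (he : e ∈ Charts d M) (f : SmoothFun 𝕜 d M) {m : ℕ} (I : Fin m → Fin d)
    (i : Fin d) {x : M} (hx : x ∈ e.source) :
    DifferentiableAt ℝ (iterPd e I f ∘ e.symm) (e x) ∧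
      pd e i (iterPd e I f) x = iterPd e (Fin.cons i I : Fin (m + 1) → Fin d) f x := by
  have hc : ContDiffAt ℝ ∞ (f ∘ e.symm) (e x) :=
    contDiffAt_comp_symm he e.open_source f.contMDiff.contMDiffOn hx hx
  have hd : DifferentiableAt ℝ (iteratedFDeriv ℝ m (f ∘ e.symm)) (e x) :=
    hc.differentiableAt_iteratedFDeriv (by exact_mod_cast WithTop.coe_lt_top m)
  have heq : iterPd e I f ∘ e.symm =ᶠ[𝓝 (e x)] fun y => iteratedFDeriv ℝ m (f ∘ e.symm) y
      fun a => EuclideanSpace.single (I a) 1 := by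
    filter_upwards [e.open_target.mem_nhds (e.map_source hx)] with y hy
    simp [iterPd, e.right_inv hy]
  refine ⟨(hd.continuousMultilinear_apply_const _).congr_of_eventuallyEq heq, ?_⟩
  rw [pd, heq.fderiv_eq, fderiv_continuousMultilinear_apply_const_apply hd, iterPd,
    iteratedFDeriv_succ_apply_left]
  rfl

/-- By the Leibniz rule each term splits in two: in one the order rises by one, in the other the
smooth coefficient is differentiated. -/
theorem IsDiffOp.pd (he : e ∈ Charts d M) {L : SmoothFun 𝕜 d M → M → 𝕜} (h : IsDiffOp e N L)
    (i : Fin d) : IsDiffOp e (N + 1) fun f x => pd e i (L f) x := by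
  obtain ⟨a, ha, hL⟩ := h
  have : IsDiffOp e (N + 1) fun (f : SmoothFun 𝕜 d M) x =>
      ∑ p : Fin (N + 1), ∑ I : Fin p → Fin d,
        (a p I x * iterPd e (Fin.cons i I : Fin (p + 1) → Fin d) f x
          + UnivStar.pd e i (a p I) x * iterPd e I f x) :=
    .sum _ fun p => .sum _ fun I => ((isDiffOp_iterPd (by omega) _).smul (ha p I)).add
      ((isDiffOp_iterPd (by omega) I).smul (contMDiffOn_pd he e.open_source le_rfl (ha p I) i))
  refine this.congr fun f x hx => ?_
  have hda : ∀ p I, DifferentiableAt ℝ (a p I ∘ e.symm) (e x) := fun p I =>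
    differentiableAt_comp_symm he e.open_source (ha p I) hx hx
  have hterm : ∀ (p : ℕ) (I : Fin p → Fin d),
      DifferentiableAt ℝ ((a p I * iterPd e I f) ∘ e.symm) (e x) := fun p I =>
    (hda p I).mul (pd_iterPd he f I i hx).1
  have hsum : L f =ᶠ[𝓝 x] fun y => ∑ p : Fin (N + 1), ∑ I : Fin p → Fin d,
      (a p I * iterPd e I f) y := by
    filter_upwards [e.open_source.mem_nhds hx] with y hy
    rw [hL f y hy, Finset.sum_range]
    rfl
  rw [pd_congr hx hsum]
  have : (fun y => ∑ p : Fin (N + 1), ∑ I : Fin p → Fin d, (a p I * iterPd e I f) y) ∘ e.symm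
      = fun z => ∑ p : Fin (N + 1), ∑ I : Fin p → Fin d, ((a p I * iterPd e I f) ∘ e.symm) z := rfl
  have hp : ∀ p : Fin (N + 1), DifferentiableAt ℝ (fun z => ∑ I : Fin p → Fin d,
      ((a p I * iterPd e I f) ∘ e.symm) z) (e x) := fun p => .fun_sum fun I _ => hterm p I
  rw [UnivStar.pd, this, fderiv_fun_sum fun p _ => hp p, sum_apply]
  refine Finset.sum_congr rfl fun p _ => ?_
  rw [fderiv_fun_sum fun I _ => hterm p I, sum_apply]
  refine Finset.sum_congr rfl fun I _ => ?_
  refine (pd_mul (hda p I) (pd_iterPd he f I i hx).1 i).trans ?_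
  rw [(pd_iterPd he f I i hx).2, e.left_inv hx, mul_comm (iterPd e I f x)]

theorem isDiffOp_covFun [T2Space M] [IsManifold (𝓡 d) ∞ M] (D : TorsionFreeConnection d M)
    (he : e ∈ Charts d M) :
    ∀ (m : ℕ) l u, IsDiffOp e m fun (f : SmoothFun 𝕜 d M) x => covFun D e f m l u x
  | 0, _, _ => (isDiffOp_iterPd le_rfl ![]).congr fun f x hx => by
      simp [covFun, iterPd, e.left_inv hx]
  | m + 1, l, u => by
    have hΓ : ∀ k i j, ContMDiffOn (𝓡 d) 𝓘(ℝ, 𝕜) ∞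
        (fun x => ((-christoffel D e k i j x : ℝ) : 𝕜)) e.source :=
      fun k i j => contMDiffOn_ofReal (contMDiffOn_christoffel D he k i j).neg
    refine (((isDiffOp_covFun D he m (Fin.tail l) u).pd he (l 0)).add (.sum Finset.univ fun a =>
      .sum Finset.univ fun k => ((isDiffOp_covFun D he m (Function.update (Fin.tail l) a k) u).mono
        (Nat.le_succ m)).smul (hΓ k (l 0) (l a.succ)))).congr fun f x hx => ?_
    simp [covFun, covD, RCLike.real_smul_eq_coe_mul, sub_eq_add_neg]

/-! ### Bidifferential operators in a chart -/

theorem IsBidiffOp.congr {B B' : SmoothFun 𝕜 d M → SmoothFun 𝕜 d M → M → 𝕜}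
    (h : IsBidiffOp e N B)
    (h' : ∀ f g, ∀ x ∈ e.source, B' f g x = B f g x) : IsBidiffOp e N B' := by
  obtain ⟨a, ha, hB⟩ := h
  exact ⟨a, ha, fun f g x hx => (h' f g x hx).trans (hB f g x hx)⟩

theorem IsBidiffOp.zero : IsBidiffOp e N fun (_ _ : SmoothFun 𝕜 d M) _ => 0 :=
  ⟨fun _ _ _ _ _ => 0, fun _ _ _ _ => contMDiffOn_const, by simp⟩

theorem IsBidiffOp.add {B B' : SmoothFun 𝕜 d M → SmoothFun 𝕜 d M → M → 𝕜}
    (h : IsBidiffOp e N B) (h' : IsBidiffOp e N B') :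
    IsBidiffOp e N fun f g x => B f g x + B' f g x := by
  obtain ⟨a, ha, hB⟩ := h
  obtain ⟨a', ha', hB'⟩ := h'
  refine ⟨fun p q I J => a p q I J + a' p q I J, fun p q I J => (ha p q I J).add (ha' p q I J),
    fun f g x hx => ?_⟩
  simp only [hB f g x hx, hB' f g x hx, Pi.add_apply, add_mul, Finset.sum_add_distrib]

theorem IsBidiffOp.smul {B : SmoothFun 𝕜 d M → SmoothFun 𝕜 d M → M → 𝕜}
    (h : IsBidiffOp e N B) {c : M → 𝕜} (hc : ContMDiffOn (𝓡 d) 𝓘(ℝ, 𝕜) ∞ c e.source) :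
    IsBidiffOp e N fun f g x => c x * B f g x := by
  obtain ⟨a, ha, hB⟩ := h
  refine ⟨fun p q I J => c * a p q I J, fun p q I J => hc.mul (ha p q I J), fun f g x hx => ?_⟩
  simp only [hB f g x hx, Pi.mul_apply, Finset.mul_sum, mul_assoc]

theorem IsBidiffOp.sum {ι : Type*} (s : Finset ι)
    {B : ι → SmoothFun 𝕜 d M → SmoothFun 𝕜 d M → M → 𝕜}
    (h : ∀ i, IsBidiffOp e N (B i)) : IsBidiffOp e N fun f g x => ∑ i ∈ s, B i f g x := by
  classical
  induction s using Finset.induction_on with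
  | empty => simpa using IsBidiffOp.zero
  | insert i s hi ih =>
    simp only [Finset.sum_insert hi]
    exact (h i).add ih

theorem IsDiffOp.mul {L L' : SmoothFun 𝕜 d M → M → 𝕜} (h : IsDiffOp e N L)
    (h' : IsDiffOp e N L') : IsBidiffOp e N fun f g x => L f x * L' g x := by
  obtain ⟨a, ha, hL⟩ := h
  obtain ⟨a', ha', hL'⟩ := h'
  refine ⟨fun p q I J => a p I * a' q J, fun p q I J => (ha p I).mul (ha' q J),
    fun f g x hx => ?_⟩
  simp only [hL f x hx, hL' g x hx, Finset.sum_mul_sum, Pi.mul_apply]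
  exact Finset.sum_congr rfl fun p _ => Finset.sum_congr rfl fun q _ =>
    Finset.sum_congr rfl fun I _ => Finset.sum_congr rfl fun J _ => by ring

end DiffOp

/-! ### The explicit cochains as bidifferential operators -/

section Formulas

variable {d : ℕ} {M : Type u} [TopologicalSpace M] [T2Space M]
  [ChartedSpace (EuclideanSpace ℝ (Fin d)) M] [IsManifold (𝓡 d) ∞ M] {𝕜 : Type v} [RCLike 𝕜]
  (D : TorsionFreeConnection d M) (P : PoissonTensor d M)
  {e : OpenPartialHomeomorph M (EuclideanSpace ℝ (Fin d))}

theorem isBidiffOp_formulaC2 (he : e ∈ Charts d M) :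
    IsBidiffOp e 2 fun (f g : SmoothFun 𝕜 d M) x => formulaC2 D P e f g x := by
  have hP : ∀ m l u, ContMDiffOn (𝓡 d) 𝓘(ℝ, ℝ) ∞ (covPoisson D P e m l u) e.source :=
    contMDiffOn_covPoisson D P he e.open_source le_rfl
  have hc : ∀ i j, ContMDiffOn (𝓡 d) 𝓘(ℝ, ℝ) ∞ (P.comp e i j) e.source := P.contMDiffOn_comp he
  have h1 : ∀ i, IsDiffOp e 2 fun (f : SmoothFun 𝕜 d M) x => covFun D e f 1 ![i] ![] x :=
    fun i => (isDiffOp_covFun D he 1 ![i] ![]).mono (by norm_num)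
  have h2 : ∀ i j, IsDiffOp e 2 fun (f : SmoothFun 𝕜 d M) x => covFun D e f 2 ![i, j] ![] x :=
    fun i j => isDiffOp_covFun D he 2 ![i, j] ![]
  have hk : ∀ c : 𝕜, ContMDiffOn (𝓡 d) 𝓘(ℝ, 𝕜) ∞ (fun _ => c) e.source :=
    fun c => contMDiffOn_const
  refine ((((IsBidiffOp.sum Finset.univ fun k => .sum Finset.univ fun r => .sum Finset.univ fun l =>
    .sum Finset.univ fun s => ((h2 k l).mul (h2 r s)).smul
      (contMDiffOn_ofReal ((hc k r).mul (hc l s)))).smul (hk (1 / 2))).add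
    ((IsBidiffOp.sum Finset.univ fun k => .sum Finset.univ fun r => .sum Finset.univ fun l =>
    .sum Finset.univ fun s => (((h2 k l).mul (h1 s)).add ((h1 s).mul (h2 k l))).smul
      (contMDiffOn_ofReal ((hc k r).mul (hP 1 ![r] ![l, s])))).smul (hk (1 / 3)))).add
    ((IsBidiffOp.sum Finset.univ fun k => .sum Finset.univ fun r => .sum Finset.univ fun l =>
    .sum Finset.univ fun s => ((h1 r).mul (h1 s)).smul
      (contMDiffOn_ofReal ((hP 1 ![l] ![k, r]).mul (hP 1 ![k] ![l, s])))).smul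
      (hk (-(1 / 6))))).congr fun f g x _ => ?_
  rw [formulaC2, neg_mul, ← sub_eq_add_neg]
  rfl

theorem isDiffOp_lieConn (he : e ∈ Charts d M) (j k l : Fin d) :
    IsDiffOp e 3 fun (f : SmoothFun 𝕜 d M) x => lieConn D P e f j k l x := by
  have hP : ∀ m l u, ContMDiffOn (𝓡 d) 𝓘(ℝ, 𝕜) ∞ (fun x => (covPoisson D P e m l u x : 𝕜))
      e.source := fun m l u =>
    contMDiffOn_ofReal (contMDiffOn_covPoisson D P he e.open_source le_rfl m l u)
  have h1 : ∀ i, IsDiffOp e 3 fun (f : SmoothFun 𝕜 d M) x => covFun D e f 1 ![i] ![] x :=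
    fun i => (isDiffOp_covFun D he 1 ![i] ![]).mono (by norm_num)
  have h2 : ∀ i j, IsDiffOp e 3 fun (f : SmoothFun 𝕜 d M) x => covFun D e f 2 ![i, j] ![] x :=
    fun i j => (isDiffOp_covFun D he 2 ![i, j] ![]).mono (by norm_num)
  have h3 : ∀ i j k, IsDiffOp e 3 fun (f : SmoothFun 𝕜 d M) x =>
      covFun D e f 3 ![i, j, k] ![] x := fun i j k => isDiffOp_covFun D he 3 ![i, j, k] ![]
  exact (IsDiffOp.sum Finset.univ fun i =>
    ((((h3 k l i).smul (contMDiffOn_ofReal (P.contMDiffOn_comp he i j))).add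
      ((h2 l i).smul (hP 1 ![k] ![i, j]))).add ((h2 k i).smul (hP 1 ![l] ![i, j]))).add
      ((h1 i).smul (hP 2 ![k, l] ![i, j]))).add
    (.sum Finset.univ fun i => .sum Finset.univ fun s => (h1 s).smul (contMDiffOn_ofReal
      ((contMDiffOn_curvature D he e.open_source le_rfl i k l j).mul (P.contMDiffOn_comp he s i))))

theorem isBidiffOp_formulaC3 (he : e ∈ Charts d M) :
    IsBidiffOp e 3 fun (f g : SmoothFun 𝕜 d M) x => formulaC3 D P e f g x :=
  (IsBidiffOp.sum Finset.univ fun l => .sum Finset.univ fun s => .sum Finset.univ fun j =>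
    .sum Finset.univ fun k => ((isDiffOp_lieConn D P he j k l).mul
      (isDiffOp_lieConn D P he k j s)).smul (contMDiffOn_ofReal (P.contMDiffOn_comp he l s))).smul
    contMDiffOn_const

open LocalFun in
theorem bracket_eq_sum (he : e ∈ Charts d M) {U : Set M} (hU : IsOpen U) (hUe : U ⊆ e.source)
    {f g : M → 𝕜} (hf : ContMDiffOn (𝓡 d) 𝓘(ℝ, 𝕜) ∞ f U) (hg : ContMDiffOn (𝓡 d) 𝓘(ℝ, 𝕜) ∞ g U)
    (D : TorsionFreeConnection d M) {x : M} (hx : x ∈ U) : P.bracket f g x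
      = ∑ i, ∑ j, (P.comp e i j x : 𝕜)
        * (covFun D e f 1 ![i] ![] x * covFun D e g 1 ![j] ![] x) := by
  rw [← ev_ad D P he hU hUe hf hg hx, PoissonFrame.ad_eq_sum]
  simp only [map_sum, map_mul, ev_P, ev_del_of]

theorem isBidiffOp_bracket (he : e ∈ Charts d M) (D : TorsionFreeConnection d M) :
    IsBidiffOp e 1 fun (f g : SmoothFun 𝕜 d M) x => P.bracket f g x :=
  (IsBidiffOp.sum Finset.univ fun i => .sum Finset.univ fun j =>
    ((isDiffOp_covFun D he 1 ![i] ![]).mul (isDiffOp_covFun D he 1 ![j] ![])).smul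
      (contMDiffOn_ofReal (P.contMDiffOn_comp he i j))).congr fun f g _ hx =>
    bracket_eq_sum P he e.open_source le_rfl f.contMDiff.contMDiffOn g.contMDiff.contMDiffOn D hx

end Formulas

/-! ### From the Hochschild identities to power series -/

section Associativity

variable {d : ℕ} {M : Type u} [TopologicalSpace M] [ChartedSpace (EuclideanSpace ℝ (Fin d)) M]
  {𝕜 : Type v} [RCLike 𝕜]

/-- Associativity up to order three follows from the Hochschild identities. -/
theorem star_assoc_of_hochschild {C : ℕ → SmoothFun 𝕜 d M → SmoothFun 𝕜 d M → SmoothFun 𝕜 d M}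
    (h0 : ∀ f g, C 0 f g = f * g)
    (hl : ∀ r f f' g, C r (f + f') g = C r f g + C r f' g)
    (hr : ∀ r f g g', C r f (g + g') = C r f g + C r f g')
    (h1 : ∀ f g h, C 1 (f * g) h + C 1 f g * h = C 1 f (g * h) + f * C 1 g h)
    (h2 : ∀ f g h, C 2 (f * g) h + C 1 (C 1 f g) h + C 2 f g * h
      = C 2 f (g * h) + C 1 f (C 1 g h) + f * C 2 g h)
    (h3 : ∀ f g h, C 3 (f * g) h + C 2 (C 1 f g) h + C 1 (C 2 f g) h + C 3 f g * h
      = C 3 f (g * h) + C 2 f (C 1 g h) + C 1 f (C 2 g h) + f * C 3 g h)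
    (F G H : PowerSeries (SmoothFun 𝕜 d M)) (n : ℕ) (hn : n ≤ 3) :
    PowerSeries.coeff n (star C (star C F G) H) = PowerSeries.coeff n (star C F (star C G H)) := by
  set f := fun i => PowerSeries.coeff i F with hf
  set g := fun i => PowerSeries.coeff i G with hg
  set h := fun i => PowerSeries.coeff i H with hh
  have e1 := fun i j k => h1 (f i) (g j) (h k)
  have e2 := fun i j k => h2 (f i) (g j) (h k)
  have e3 := h3 (f 0) (g 0) (h 0)
  simp only [hf, hg, hh] at e1 e2 e3
  simp only [star, PowerSeries.coeff_mk]
  -- The associator of F, G, H at ν^n is the sum, over i + j + k ≤ n, of the identity of order n - i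
  -- - j - k on the coefficients f i, g j, h k. The identity of order zero is associativity of the
  -- product, and no cochain beyond C₃ enters.
  interval_cases n <;>
    simp only [Finset.Nat.antidiagonal_succ, Finset.Nat.antidiagonal_zero, Finset.map_singleton,
      Finset.sum_cons, Finset.sum_singleton, Finset.map_cons, h0, hl, hr,
      Function.Embedding.coeFn_mk, Function.Embedding.prodMap, Prod.map,
      Function.Embedding.refl_apply, mul_add, add_mul, Nat.succ_eq_add_one, zero_add]
  · rw [mul_assoc]
  · linear_combination e1 0 0 0
  · norm_num only
    linear_combination e2 0 0 0 + e1 1 0 0 + e1 0 1 0 + e1 0 0 1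
  · norm_num only
    linear_combination e3 + e2 1 0 0 + e2 0 1 0 + e2 0 0 1 + e1 2 0 0 + e1 0 2 0 + e1 0 0 2
      + e1 1 1 0 + e1 1 0 1 + e1 0 1 1

end Associativity

section Cochains

variable {d : ℕ} {M : Type u} [TopologicalSpace M] [T2Space M]
  [ChartedSpace (EuclideanSpace ℝ (Fin d)) M] [IsManifold (𝓡 d) ∞ M] {𝕜 : Type v} [RCLike 𝕜]
  (D : TorsionFreeConnection d M) (P : PoissonTensor d M)
  {e : OpenPartialHomeomorph M (EuclideanSpace ℝ (Fin d))}

open LocalFun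

/-! ### The cochains -/

theorem chartAt_mem_charts (x : M) : chartAt (EuclideanSpace ℝ (Fin d)) x ∈ Charts d M :=
  IsManifold.chart_mem_maximalAtlas x

theorem mem_source_chartAt (x : M) : x ∈ (chartAt (EuclideanSpace ℝ (Fin d)) x).source :=
  mem_chart_source _ x

/-- The smooth function given by compatible expressions in all charts. -/
def glue (φ : OpenPartialHomeomorph M (EuclideanSpace ℝ (Fin d)) → M → 𝕜)
    (hs : ∀ e ∈ Charts d M, ContMDiffOn (𝓡 d) 𝓘(ℝ, 𝕜) ∞ (φ e) e.source)
    (hi : ∀ e ∈ Charts d M, ∀ e' ∈ Charts d M, ∀ x ∈ e.source ∩ e'.source, φ e x = φ e' x) :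
    SmoothFun 𝕜 d M :=
  ⟨fun x => φ (chartAt _ x) x, fun x =>
    ((hs _ (chartAt_mem_charts x)).contMDiffAt
      ((chartAt _ x).open_source.mem_nhds (mem_source_chartAt x))).congr_of_eventuallyEq
      (eventually_of_mem ((chartAt _ x).open_source.mem_nhds (mem_source_chartAt x)) fun y hy =>
        hi _ (chartAt_mem_charts y) _ (chartAt_mem_charts x) y ⟨mem_source_chartAt y, hy⟩)⟩

theorem glue_apply (φ : OpenPartialHomeomorph M (EuclideanSpace ℝ (Fin d)) → M → 𝕜)
    (hs : ∀ e ∈ Charts d M, ContMDiffOn (𝓡 d) 𝓘(ℝ, 𝕜) ∞ (φ e) e.source)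
    (hi : ∀ e ∈ Charts d M, ∀ e' ∈ Charts d M, ∀ x ∈ e.source ∩ e'.source, φ e x = φ e' x)
    (he : e ∈ Charts d M) {x : M} (hx : x ∈ e.source) : glue φ hs hi x = φ e x :=
  hi _ (chartAt_mem_charts x) _ he x ⟨mem_source_chartAt x, hx⟩

/-- The restriction of a smooth function to a chart domain. -/
def restr {U : Set M} (f : SmoothFun 𝕜 d M) : LocalFun 𝕜 d U := of f f.contMDiff.contMDiffOn

theorem contMDiffOn_of_ev {U : Set M} (F : LocalFun 𝕜 d U) {G : M → 𝕜}
    (h : ∀ (x : M) (hx : x ∈ U), G x = ev hx F) : ContMDiffOn (𝓡 d) 𝓘(ℝ, 𝕜) ∞ G U :=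
  (contMDiffOn_extend F).congr fun x hx => (h x hx).trans (ev_eq_extend hx F)

theorem eq_of_six_mul {a b : 𝕜} (h : 6 * a = 6 * b) : a = b :=
  mul_left_cancel₀ (by norm_num) h

/-- The Poisson bracket as an operation on smooth functions. -/
def cochainOne (f g : SmoothFun 𝕜 d M) : SmoothFun 𝕜 d M :=
  glue (fun _ => P.bracket f g)
    -- The bracket does not involve the Christoffel symbols; the connection only completes P to a
    -- frame, in which smoothness is visible.
    (fun e he => contMDiffOn_of_ev ((chartFrame D P 𝕜 he e.open_source le_rfl).ad
      (restr f) (restr g)) fun _ hx => (ev_ad D P he e.open_source le_rfl _ _ hx).symm)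
    fun _ _ _ _ _ _ => rfl

/-- The second cochain. -/
def cochainTwo (f g : SmoothFun 𝕜 d M) : SmoothFun 𝕜 d M :=
  glue (fun e => formulaC2 D P e f g)
    (fun e he => contMDiffOn_of_ev ((6⁻¹ : ℝ) • (chartFrame D P 𝕜 he e.open_source le_rfl).c2
      (restr f) (restr g)) fun x hx => by
        rw [map_smul, restr, restr, ev_c2, RCLike.real_smul_eq_coe_mul, RCLike.ofReal_inv,
          RCLike.ofReal_ofNat, inv_mul_cancel_left₀ (by norm_num)])
    -- Both chart formulas are compared on the overlap, where the transition identity holds for six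
    -- times the cochain.
    fun e he e' he' x hx => eq_of_six_mul <| by
      have := congrArg (ev hx) ((chartTransition D P 𝕜 he he').c2_eq (restr f) (restr g))
      rwa [restr, restr, ev_c2, ev_c2] at this

/-- The third cochain. -/
def cochainThree (f g : SmoothFun 𝕜 d M) : SmoothFun 𝕜 d M :=
  glue (fun e => formulaC3 D P e f g)
    (fun e he => contMDiffOn_of_ev ((6⁻¹ : ℝ) • (chartFrame D P 𝕜 he e.open_source le_rfl).c3
      (restr f) (restr g)) fun x hx => by
        rw [map_smul, restr, restr, ev_c3, RCLike.real_smul_eq_coe_mul, RCLike.ofReal_inv,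
          RCLike.ofReal_ofNat, inv_mul_cancel_left₀ (by norm_num)])
    fun e he e' he' x hx => eq_of_six_mul <| by
      have := congrArg (ev hx) ((chartTransition D P 𝕜 he he').c3_eq (restr f) (restr g))
      rwa [restr, restr, ev_c3, ev_c3] at this

theorem cochainOne_apply (f g : SmoothFun 𝕜 d M) (x : M) :
    cochainOne D P f g x = P.bracket f g x := rfl

theorem cochainTwo_apply (he : e ∈ Charts d M) (f g : SmoothFun 𝕜 d M) {x : M}
    (hx : x ∈ e.source) : cochainTwo D P f g x = formulaC2 D P e f g x := glue_apply _ _ _ he hx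

theorem cochainThree_apply (he : e ∈ Charts d M) (f g : SmoothFun 𝕜 d M) {x : M}
    (hx : x ∈ e.source) : cochainThree D P f g x = formulaC3 D P e f g x := glue_apply _ _ _ he hx

theorem restr_cochainOne (he : e ∈ Charts d M) (f g : SmoothFun 𝕜 d M) :
    restr (cochainOne D P f g)
      = (chartFrame D P 𝕜 he e.open_source le_rfl).ad (restr f) (restr g) :=
  ext_ev fun _ hx => (ev_ad D P he e.open_source le_rfl _ _ hx).symm

theorem restr_cochainTwo (he : e ∈ Charts d M) (f g : SmoothFun 𝕜 d M) :
    (6 : ℝ) • restr (cochainTwo D P f g)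
      = (chartFrame D P 𝕜 he e.open_source le_rfl).c2 (restr f) (restr g) :=
  ext_ev fun x hx => by
    rw [map_smul, restr, restr, restr, ev_c2, ev_of, cochainTwo_apply D P he f g hx,
      RCLike.real_smul_eq_coe_mul, RCLike.ofReal_ofNat]

theorem restr_cochainThree (he : e ∈ Charts d M) (f g : SmoothFun 𝕜 d M) :
    (6 : ℝ) • restr (cochainThree D P f g)
      = (chartFrame D P 𝕜 he e.open_source le_rfl).c3 (restr f) (restr g) :=
  ext_ev fun x hx => by
    rw [map_smul, restr, restr, restr, ev_c3, ev_of, cochainThree_apply D P he f g hx,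
      RCLike.real_smul_eq_coe_mul, RCLike.ofReal_ofNat]

/-- Identities of smooth functions are checked chart by chart. The factor 6 is built in because the
frame identities concern `c2` and `c3`. -/
theorem eq_of_restr {f g : SmoothFun 𝕜 d M}
    (h : ∀ e ∈ Charts d M, (6 : ℝ) • (restr f : LocalFun 𝕜 d e.source) = (6 : ℝ) • restr g) :
    f = g := by
  refine ContMDiffMap.ext fun x => ?_
  have := congrArg (ev (mem_source_chartAt x))
    (smul_right_injective _ (by norm_num) (h _ (chartAt_mem_charts x)))
  exact this

theorem restr_mul {U : Set M} (f g : SmoothFun 𝕜 d M) :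
    (restr (f * g) : LocalFun 𝕜 d U) = restr f * restr g := rfl

theorem restr_add {U : Set M} (f g : SmoothFun 𝕜 d M) :
    (restr (f + g) : LocalFun 𝕜 d U) = restr f + restr g := rfl

theorem _root_.UnivStar.PoissonFrame.ad_smul {ι : Type*} [Fintype ι] {A : Type*} [CommRing A]
    [Algebra ℝ A] (F : PoissonFrame ι A) (r : ℝ) (f g : A) :
    F.ad (r • f) g = r • F.ad f g := by
  rw [F.ad_skew, Derivation.map_smul, F.ad_skew f g, smul_neg]

theorem cochainOne_add (f f' g : SmoothFun 𝕜 d M) :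
    cochainOne D P (f + f') g = cochainOne D P f g + cochainOne D P f' g :=
  eq_of_restr fun e he => by
    simp only [restr_add, restr_cochainOne D P he, PoissonFrame.ad_add]

theorem cochainOne_skew (f g : SmoothFun 𝕜 d M) : cochainOne D P f g + cochainOne D P g f = 0 :=
  eq_of_restr fun e he => by
    rw [restr_add, restr_cochainOne D P he, restr_cochainOne D P he, PoissonFrame.ad_skew,
      neg_add_cancel]
    rfl

theorem cochainTwo_add (f f' g : SmoothFun 𝕜 d M) :
    cochainTwo D P (f + f') g = cochainTwo D P f g + cochainTwo D P f' g :=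
  eq_of_restr fun e he => by
    simp only [restr_add, smul_add, restr_cochainTwo D P he, PoissonFrame.c2_add]

theorem cochainTwo_symm (f g : SmoothFun 𝕜 d M) : cochainTwo D P f g = cochainTwo D P g f :=
  eq_of_restr fun e he => by
    simp only [restr_cochainTwo D P he, PoissonFrame.c2_symm _ (restr f)]

theorem cochainThree_add (f f' g : SmoothFun 𝕜 d M) :
    cochainThree D P (f + f') g = cochainThree D P f g + cochainThree D P f' g :=
  eq_of_restr fun e he => by
    simp only [restr_add, smul_add, restr_cochainThree D P he, PoissonFrame.c3_add]

theorem cochainThree_skew (f g : SmoothFun 𝕜 d M) :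
    cochainThree D P f g + cochainThree D P g f = 0 :=
  eq_of_restr fun e he => by
    rw [restr_add, smul_add, restr_cochainThree D P he, restr_cochainThree D P he,
      PoissonFrame.c3_skew, neg_add_cancel]
    exact (smul_zero (6 : ℝ)).symm

theorem hochschild_one (f g h : SmoothFun 𝕜 d M) :
    cochainOne D P (f * g) h + cochainOne D P f g * h
      = cochainOne D P f (g * h) + f * cochainOne D P g h :=
  eq_of_restr fun e he => by
    simp only [restr_add, restr_mul, restr_cochainOne D P he, PoissonFrame.ad_mul,
      Derivation.leibniz, smul_eq_mul]
    congr 1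
    ring

theorem hochschild_two (f g h : SmoothFun 𝕜 d M) :
    cochainTwo D P (f * g) h + cochainOne D P (cochainOne D P f g) h + cochainTwo D P f g * h
      = cochainTwo D P f (g * h) + cochainOne D P f (cochainOne D P g h)
        + f * cochainTwo D P g h :=
  eq_of_restr fun e he => by
    have := (chartFrame D P 𝕜 he e.open_source le_rfl).assoc_two (restr f) (restr g) (restr h)
    -- In `assoc_two` the double brackets carry 6 as a ring element, while the cochains carry it as
    -- a real scalar.
    have h6 : ∀ x : LocalFun 𝕜 d e.source, 6 * x = (6 : ℝ) • x := fun x => by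
      rw [Algebra.smul_def, map_ofNat]
    simpa only [← restr_mul, ← restr_cochainOne D P he, ← restr_cochainTwo D P he, h6,
      smul_mul_assoc, mul_smul_comm, ← smul_add, ← restr_add] using this

theorem hochschild_three (f g h : SmoothFun 𝕜 d M) :
    cochainThree D P (f * g) h + cochainTwo D P (cochainOne D P f g) h
        + cochainOne D P (cochainTwo D P f g) h + cochainThree D P f g * h
      = cochainThree D P f (g * h) + cochainTwo D P f (cochainOne D P g h)
        + cochainOne D P f (cochainTwo D P g h) + f * cochainThree D P g h :=
  eq_of_restr fun e he => by
    have := (chartFrame D P 𝕜 he e.open_source le_rfl).assoc_three (restr f) (restr g) (restr h)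
    simpa only [← restr_mul, ← restr_cochainOne D P he, ← restr_cochainTwo D P he,
      ← restr_cochainThree D P he, PoissonFrame.ad_smul, Derivation.map_smul, smul_mul_assoc,
      mul_smul_comm, ← smul_add, ← restr_add] using this

end Cochains

section StarProduct

variable {d : ℕ} {M : Type u} [TopologicalSpace M] [T2Space M]
  [ChartedSpace (EuclideanSpace ℝ (Fin d)) M] [IsManifold (𝓡 d) ∞ M] {𝕜 : Type v} [RCLike 𝕜]
  (D : TorsionFreeConnection d M) (P : PoissonTensor d M)
  {e : OpenPartialHomeomorph M (EuclideanSpace ℝ (Fin d))}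

/-! ### The star product -/

theorem covFun_const (c : 𝕜) : ∀ (m : ℕ) l u, covFun D e (fun _ : M => c) (m + 1) l u = 0
  | 0, l, u => by
    funext x
    rw [covFun_one, pd_const]
    rfl
  | m + 1, l, u => by
    funext x
    rw [covFun, covD]
    simp only [covFun_const c m]
    have : pd e (l 0) (0 : M → 𝕜) x = 0 := pd_const 0 _ x
    simp [this]

theorem covFun_mapConst (c : 𝕜) (m : ℕ) (l : Fin (m + 1) → Fin d) (u : Fin 0 → Fin d) (x : M) :
    covFun D e (ContMDiffMap.const c : SmoothFun 𝕜 d M) (m + 1) l u x = 0 :=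
  congrFun (covFun_const D c m l u) x

theorem cochainOne_const (c : 𝕜) (g : SmoothFun 𝕜 d M) :
    cochainOne D P (ContMDiffMap.const c) g = 0 := by
  refine ContMDiffMap.ext fun x => ?_
  rw [cochainOne_apply, bracket_eq_sum P (chartAt_mem_charts x) (chartAt _ x).open_source le_rfl
    (ContMDiffMap.contMDiff _).contMDiffOn g.contMDiff.contMDiffOn D (mem_source_chartAt x)]
  simp [covFun_mapConst]

theorem cochainTwo_const (c : 𝕜) (g : SmoothFun 𝕜 d M) :
    cochainTwo D P (ContMDiffMap.const c) g = 0 := by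
  refine ContMDiffMap.ext fun x => ?_
  rw [cochainTwo_apply D P (chartAt_mem_charts x) _ _ (mem_source_chartAt x), formulaC2]
  simp [covFun_mapConst]

theorem cochainThree_const (c : 𝕜) (g : SmoothFun 𝕜 d M) :
    cochainThree D P (ContMDiffMap.const c) g = 0 := by
  refine ContMDiffMap.ext fun x => ?_
  rw [cochainThree_apply D P (chartAt_mem_charts x) _ _ (mem_source_chartAt x), formulaC3]
  simp [covFun_mapConst, lieConn]

/-- The cochains of the universal star product. -/
def cochain (𝕜 : Type v) [RCLike 𝕜] (r : ℕ) : BidiffFamily.{u} 𝕜 := fun _ _ _ _ _ _ D P f g =>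
  match r with
  | 0 => f * g
  | 1 => cochainOne D P f g
  | 2 => cochainTwo D P f g
  | 3 => cochainThree D P f g
  | _ => 0

theorem isStarProduct_cochain : IsStarProductUpTo 3 P fun r => cochain 𝕜 r d M D P where
  zero_order _ _ := rfl
  assoc F G H n hn := by
    refine star_assoc_of_hochschild (fun _ _ => rfl) ?_ ?_ (hochschild_one D P)
      (hochschild_two D P) (hochschild_three D P) F G H n hn
    · intro r f f' g
      match r with
      | 0 => exact add_mul f f' g
      | 1 => exact cochainOne_add D P f f' g
      | 2 => exact cochainTwo_add D P f f' g
      | 3 => exact cochainThree_add D P f f' g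
      | _ + 4 => exact (add_zero 0).symm
    · intro r f g g'
      match r with
      | 0 => exact mul_add f g g'
      | 1 =>
        -- Additivity in the second argument follows from that in the first, here by skewness and
        -- for the second cochain by symmetry.
        have h := fun g => eq_neg_of_add_eq_zero_left (cochainOne_skew D P f g)
        change cochainOne D P f (g + g') = cochainOne D P f g + cochainOne D P f g'
        rw [h, h, h, cochainOne_add, neg_add]
      | 2 =>
        change cochainTwo D P f (g + g') = cochainTwo D P f g + cochainTwo D P f g'
        rw [cochainTwo_symm, cochainTwo_add, cochainTwo_symm D P g, cochainTwo_symm D P g']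
      | 3 =>
        have h := fun g => eq_neg_of_add_eq_zero_left (cochainThree_skew D P f g)
        change cochainThree D P f (g + g') = cochainThree D P f g + cochainThree D P f g'
        rw [h, h, h, cochainThree_add, neg_add]
      | _ + 4 => exact (add_zero 0).symm
  first_order f g x := by
    change cochainOne D P f g x - cochainOne D P g f x = 2 * cochainOne D P f g x
    have := congrArg (fun F : SmoothFun 𝕜 d M => F x) (cochainOne_skew D P f g)
    have h : cochainOne D P f g x + cochainOne D P g f x = 0 := this
    linear_combination -h
  bidifferential r h1 h3 := by
    interval_cases r
    · exact ⟨1, fun e he => isBidiffOp_bracket P he D⟩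
    · exact ⟨2, fun e he => (isBidiffOp_formulaC2 D P he).congr fun f g x hx =>
        cochainTwo_apply D P he f g hx⟩
    · exact ⟨3, fun e he => (isBidiffOp_formulaC3 D P he).congr fun f g x hx =>
        cochainThree_apply D P he f g hx⟩
  const_left r h1 h3 c g := by
    interval_cases r
    exacts [cochainOne_const D P c g, cochainTwo_const D P c g, cochainThree_const D P c g]
  const_right r h1 h3 c f := by
    interval_cases r
    · have h := cochainOne_skew D P f (ContMDiffMap.const c)
      rwa [cochainOne_const, add_zero] at h
    · exact (cochainTwo_symm D P _ _).trans (cochainTwo_const D P c f)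
    · have h := cochainThree_skew D P f (ContMDiffMap.const c)
      rwa [cochainThree_const, add_zero] at h

/-! ### Homogeneity in the Poisson tensor -/

theorem covD_mul_left {q p : ℕ} (t : ℝ) (T : CompTensor d M ℝ q p) :
    covD D e (fun l u x => t * T l u x) = fun l u x => t * covD D e T l u x := by
  funext l u x
  have : pd e (l 0) (fun y => t * T (Fin.tail l) u y) x = t * pd e (l 0) (T (Fin.tail l) u) x := by
    have h : (fun y => t * T (Fin.tail l) u y) ∘ e.symm = t • (T (Fin.tail l) u ∘ e.symm) := rfl
    rw [pd, h, fderiv_const_smul_field]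
    rfl
  simp only [covD, this, smul_eq_mul, mul_add, mul_sub, Finset.mul_sum, mul_left_comm t]

theorem covPoisson_scale (t : ℝ) :
    ∀ m, covPoisson D (P.scale t) e m = fun l u x => t * covPoisson D P e m l u x
  | 0 => rfl
  | m + 1 => by rw [covPoisson, covPoisson_scale t m, covD_mul_left, covPoisson]

theorem comp_scale (t : ℝ) (i j : Fin d) (x : M) :
    (P.scale t).comp e i j x = t * P.comp e i j x := rfl

theorem bracket_scale (t : ℝ) (f g : M → 𝕜) (x : M) :
    (P.scale t).bracket f g x = (t : 𝕜) ^ 1 * P.bracket f g x := by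
  have : ∀ f g : M → ℝ, (P.scale t).realBracket f g x = t * P.realBracket f g x :=
    fun _ _ => rfl
  simp only [PoissonTensor.bracket, this]
  push_cast
  ring

theorem formulaC2_scale (t : ℝ) (f g : M → 𝕜) (x : M) :
    formulaC2 D (P.scale t) e f g x = (t : 𝕜) ^ 2 * formulaC2 D P e f g x := by
  simp only [formulaC2, covPoisson_scale, comp_scale, mul_add, mul_sub, Finset.mul_sum]
  congr 1
  · congr 1 <;> refine Finset.sum_congr rfl fun k _ => Finset.sum_congr rfl fun r _ =>
      Finset.sum_congr rfl fun l _ => Finset.sum_congr rfl fun s _ => ?_ <;> push_cast <;> ring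
  · refine Finset.sum_congr rfl fun k _ => Finset.sum_congr rfl fun r _ =>
      Finset.sum_congr rfl fun l _ => Finset.sum_congr rfl fun s _ => ?_
    push_cast
    ring

theorem lieConn_scale (t : ℝ) (f : M → 𝕜) (j k l : Fin d) (x : M) :
    lieConn D (P.scale t) e f j k l x = (t : 𝕜) * lieConn D P e f j k l x := by
  simp only [lieConn, covPoisson_scale, comp_scale, mul_add, Finset.mul_sum]
  push_cast
  simp only [mul_assoc, mul_left_comm _ (t : 𝕜)]

theorem formulaC3_scale (t : ℝ) (f g : M → 𝕜) (x : M) :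
    formulaC3 D (P.scale t) e f g x = (t : 𝕜) ^ 3 * formulaC3 D P e f g x := by
  simp only [formulaC3, lieConn_scale, comp_scale, Finset.mul_sum]
  refine Finset.sum_congr rfl fun k _ => Finset.sum_congr rfl fun r _ =>
    Finset.sum_congr rfl fun l _ => Finset.sum_congr rfl fun s _ => ?_
  push_cast
  ring

end StarProduct

theorem isPolynomialOfDegree_cochain (𝕜 : Type v) [RCLike 𝕜] (r : ℕ) (h1 : 1 ≤ r) (h3 : r ≤ 3) :
    IsPolynomialOfDegree r (cochain.{u} 𝕜 r) := by
  intro d M _ _ _ _ D P t f g x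
  interval_cases r
  · exact bracket_scale P t f g x
  · exact formulaC2_scale D P t f g x
  · exact formulaC3_scale D P t f g x

/-! ### Symmetrised covariant derivatives -/

namespace PoissonFrame

variable {ι : Type*} [Fintype ι] {A : Type*} [CommRing A] [Algebra ℝ A] (F : PoissonFrame ι A)

theorem hess_comm (f : A) (k l : ι) : F.hess f k l = F.hess f l k := by
  conv_lhs => rw [← F.hess_symm f, Matrix.transpose_apply]

theorem hess3_comm (f : A) (k l i : ι) : F.hess3 f k l i = F.hess3 f k i l := by
  simp only [hess3, F.hess_comm f l, F.hess_comm f _ i]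
  ring

/-- The Ricci identity for the differential of a function. -/
theorem hess3_swap (f : A) (k l i : ι) :
    F.hess3 f l k i = F.hess3 f k l i + ∑ s, F.curv k l i s * F.del s f := by
  have h1 : ∀ k i, F.del k (F.del i f) = F.hess f k i + ∑ m, F.Γ m k i * F.del m f := by
    intro k i
    simp [hess]
  have h2 : ∀ k l i, F.del k (F.hess f l i) = F.del k (F.del l (F.del i f))
      - ∑ m, (F.Γ m l i * F.del k (F.del m f) + F.del m f * F.del k (F.Γ m l i)) := by
    intro k l i
    simp only [hess, Matrix.of_apply, map_sub, map_sum, Derivation.leibniz, smul_eq_mul]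
  simp only [hess3, h2, F.del_comm l k, curv]
  simp only [h1 _ _, mul_add, add_mul, sub_mul, Finset.sum_add_distrib, Finset.sum_sub_distrib,
    Finset.mul_sum, Finset.sum_mul, F.Γ_symm _ l k]
  have e1 := Finset.sum_comm (s := Finset.univ) (t := Finset.univ)
    (f := fun i' m => F.Γ i' l i * (F.Γ m k i' * F.del m f))
  have e2 := Finset.sum_comm (s := Finset.univ) (t := Finset.univ)
    (f := fun i' m => F.Γ i' k i * (F.Γ m l i' * F.del m f))
  simp only [mul_assoc, mul_comm, mul_left_comm] at e1 e2 ⊢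
  linear_combination e1 - e2

/-- ∇³f is symmetric in its last two indices, so the six permutations reduce to the three choices of
the first index; each change of the first index costs a curvature term. -/
theorem three_mul_hess3 (f : A) (k l i : ι) :
    3 * F.hess3 f k l i = F.hess3 f k l i + F.hess3 f l k i + F.hess3 f i k l
      - ∑ s, (F.curv k l i s + F.curv k i l s) * F.del s f := by
  rw [F.hess3_swap f k l i, F.hess3_swap f k i l, F.hess3_comm f k i l]
  simp only [add_mul, Finset.sum_add_distrib]
  ring

end PoissonFrame

section Symmetrised

open LocalFun Equiv

variable {d : ℕ} {M : Type u} [TopologicalSpace M] [T2Space M]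
  [ChartedSpace (EuclideanSpace ℝ (Fin d)) M] [IsManifold (𝓡 d) ∞ M] {𝕜 : Type v} [RCLike 𝕜]
  (D : TorsionFreeConnection d M) (P : PoissonTensor d M)
  {e : OpenPartialHomeomorph M (EuclideanSpace ℝ (Fin d))} (f : SmoothFun 𝕜 d M)

theorem covFun_one_eq_symCovFun (i : Fin d) (x : M) :
    covFun D e f 1 ![i] ![] x = symCovFun D e f 1 ![i] x := by
  simp [symCovFun, covFun_one]

/-- The Hessian of a torsionfree connection is symmetric; the Poisson tensor supplies a frame in
which `hess_comm` applies. -/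
theorem covFun_two_eq_symCovFun (P : PoissonTensor d M) (he : e ∈ Charts d M) (k l : Fin d) {x : M}
    (hx : x ∈ e.source) : covFun D e f 2 ![k, l] ![] x = symCovFun D e f 2 ![k, l] x := by
  have hu : (Finset.univ : Finset (Perm (Fin 2))) = {1, swap 0 1} := by decide
  have h0 : ![k, l] ∘ (1 : Perm (Fin 2)) = ![k, l] := rfl
  have h1 : ![k, l] ∘ swap (0 : Fin 2) 1 = ![l, k] := by ext a; fin_cases a <;> rfl
  have hs : covFun D e f 2 ![k, l] ![] x = covFun D e f 2 ![l, k] ![] x := by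
    have hf := f.contMDiff.contMDiffOn (s := e.source)
    rw [← ev_hess D P he e.open_source le_rfl hf k l hx, PoissonFrame.hess_comm, ev_hess]
  rw [symCovFun, hu, Finset.sum_insert (by decide), Finset.sum_singleton, h0, h1, hs, ← two_mul]
  norm_num [Nat.factorial]
  ring

/-- C₃ contains ∇³f, which is not an admissible factor. The correction is a contraction of the
curvature with df and so is admissible. -/
theorem covFun_three_eq_symCovFun (P : PoissonTensor d M) (he : e ∈ Charts d M) (k l i : Fin d)
    {x : M} (hx : x ∈ e.source) :
    covFun D e f 3 ![k, l, i] ![] x = symCovFun D e f 3 ![k, l, i] x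
      - (1 / 3) * ∑ s, ((curvature D e k l i s x : 𝕜) + (curvature D e k i l s x : 𝕜))
        * symCovFun D e f 1 ![s] x := by
  have hf := f.contMDiff.contMDiffOn (s := e.source)
  have hu : (Finset.univ : Finset (Perm (Fin 3))) = {1, swap 1 2, swap 0 1,
      swap 1 2 * swap 0 1, swap 0 2, swap 1 2 * swap 0 2} := by decide
  have h0 : ![k, l, i] ∘ (1 : Perm (Fin 3)) = ![k, l, i] := rfl
  have h1 : ![k, l, i] ∘ swap (1 : Fin 3) 2 = ![k, i, l] := by ext a; fin_cases a <;> rfl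
  have h2 : ![k, l, i] ∘ swap (0 : Fin 3) 1 = ![l, k, i] := by ext a; fin_cases a <;> rfl
  have h3 : ![k, l, i] ∘ (swap 1 2 * swap 0 1 : Perm (Fin 3)) = ![i, k, l] := by
    ext a; fin_cases a <;> rfl
  have h4 : ![k, l, i] ∘ swap (0 : Fin 3) 2 = ![i, l, k] := by ext a; fin_cases a <;> rfl
  have h5 : ![k, l, i] ∘ (swap 1 2 * swap 0 2 : Perm (Fin 3)) = ![l, i, k] := by
    ext a; fin_cases a <;> rfl
  have hc : ∀ k l i, covFun D e f 3 ![k, i, l] ![] x = covFun D e f 3 ![k, l, i] ![] x := by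
    intro k l i
    rw [← ev_hess3 D P he e.open_source le_rfl hf k i l hx, PoissonFrame.hess3_comm, ev_hess3]
  have ht := congrArg (ev hx)
    ((chartFrame D P 𝕜 he e.open_source le_rfl).three_mul_hess3 (of f hf) k l i)
  simp only [map_sub, map_add, map_sum, map_mul, map_ofNat, ev_hess3, ev_curv, ev_del_of,
    covFun_one_eq_symCovFun] at ht
  -- The six permutations coincide in pairs by the symmetry in the last two indices.
  have h6 : symCovFun D e f 3 ![k, l, i] x = 6⁻¹ * (2 * (covFun D e f 3 ![k, l, i] ![] x
      + covFun D e f 3 ![l, k, i] ![] x + covFun D e f 3 ![i, k, l] ![] x)) := by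
    rw [symCovFun, hu, Finset.sum_insert (by decide), Finset.sum_insert (by decide),
      Finset.sum_insert (by decide), Finset.sum_insert (by decide), Finset.sum_insert (by decide),
      Finset.sum_singleton, h0, h1, h2, h3, h4, h5, hc k l i, hc i k l, hc l k i]
    norm_num [Nat.factorial]
    ring
  rw [h6]
  linear_combination (1 / 3) * ht

end Symmetrised

/-! ### Universal expressions -/

/-- The values at one point of the components of `∇^m P`, `∇^m R` and of the symmetrised covariant
derivatives of `n` functions. -/
structure JetData (𝕜 : Type v) (n d : ℕ) where
  P : ∀ m : ℕ, (Fin m → Fin d) → (Fin 2 → Fin d) → 𝕜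
  R : ∀ m : ℕ, (Fin (m + 3) → Fin d) → (Fin 1 → Fin d) → 𝕜
  F : Fin n → ∀ m : ℕ, (Fin m → Fin d) → 𝕜

section Universal

variable {𝕜 : Type v} [RCLike 𝕜] {n : ℕ}

/-- The component of a factor of a monomial, in terms of the jets. -/
def UnivMonomial.jetFactor (W : UnivMonomial n) {d : ℕ} (J : JetData 𝕜 n d) :
    ∀ w : Vertex W.nP W.nR n, (Fin (lowerArity W.derP W.derR W.ord w) → Fin d) →
      (Fin (upperArity w) → Fin d) → 𝕜
  | .inl a => J.P (W.derP a)
  | .inr (.inl b) => J.R (W.derR b)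
  | .inr (.inr c) => fun l _ => J.F c (W.ord c) l

/-- The value of a monomial, in terms of the jets. -/
def UnivMonomial.jetEval (W : UnivMonomial n) {d : ℕ} (J : JetData 𝕜 n d) : 𝕜 :=
  ∑ idx : ((w : Vertex W.nP W.nR n) × Fin (lowerArity W.derP W.derR W.ord w)) → Fin d,
    ∏ w : Vertex W.nP W.nR n, W.jetFactor J w
      (fun a => idx ⟨w, a⟩) (fun b => idx (W.contraction.symm ⟨w, b⟩))

/-- An expression in the jets which is a universal polynomial of no-loop type. -/
def IsUniversalExpr (V : ∀ d, JetData 𝕜 n d → 𝕜) : Prop :=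
  ∃ U : UnivPoly n, (∀ c ∈ U, c.2.NoLoop) ∧
    ∀ d (J : JetData 𝕜 n d), V d J = (U.map fun c => (c.1 : 𝕜) * c.2.jetEval J).sum

theorem IsUniversalExpr.congr {V V' : ∀ d, JetData 𝕜 n d → 𝕜} (h : IsUniversalExpr V)
    (hV : ∀ d J, V' d J = V d J) : IsUniversalExpr V' := by
  obtain ⟨U, hU, h⟩ := h
  exact ⟨U, hU, fun d J => (hV d J).trans (h d J)⟩

theorem IsUniversalExpr.add {V V' : ∀ d, JetData 𝕜 n d → 𝕜} (h : IsUniversalExpr V)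
    (h' : IsUniversalExpr V') : IsUniversalExpr fun d J => V d J + V' d J := by
  obtain ⟨U, hU, h⟩ := h
  obtain ⟨U', hU', h'⟩ := h'
  refine ⟨U ++ U', fun c hc => (List.mem_append.1 hc).elim (hU c) (hU' c), fun d J => ?_⟩
  simp only [List.map_append, List.sum_append, h, h']

theorem IsUniversalExpr.smul {V : ∀ d, JetData 𝕜 n d → 𝕜} (h : IsUniversalExpr V) (t : ℝ) :
    IsUniversalExpr fun d J => (t : 𝕜) * V d J := by
  obtain ⟨U, hU, h⟩ := h
  refine ⟨U.map fun c => (t * c.1, c.2), ?_, fun d J => ?_⟩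
  · rintro c hc
    obtain ⟨b, hb, rfl⟩ := List.mem_map.1 hc
    exact hU b hb
  · simp only [h, List.map_map, ← List.sum_map_mul_left, Function.comp_def, RCLike.ofReal_mul,
      mul_assoc]

theorem IsUniversalExpr.sum {κ : Type*} (s : Finset κ) {V : κ → ∀ d, JetData 𝕜 n d → 𝕜}
    (h : ∀ a ∈ s, IsUniversalExpr (V a)) : IsUniversalExpr fun d J => ∑ a ∈ s, V a d J := by
  classical
  induction s using Finset.induction_on with
  | empty => exact ⟨[], by simp, fun d J => by simp⟩
  | insert a s ha ih =>
    refine ((h a (by simp)).add (ih fun b hb => h b (by simp [hb]))).congr fun d J => ?_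
    rw [Finset.sum_insert ha]

/-! ### Contraction diagrams -/

/-- A complete contraction of factors `∇^m P`, `R` and `∇^{sym} f_c`, with no factor contracted
with itself; the contracted pairs of indices are labelled by `L`. -/
structure Diagram (n : ℕ) where
  VP : Type
  VR : Type
  L : Type
  [fintypeVP : Fintype VP]
  [fintypeVR : Fintype VR]
  [fintypeL : Fintype L]
  [decidableEqL : DecidableEq L]
  derP : VP → ℕ
  ord : Fin n → ℕ
  low : ((Σ a, Fin (derP a)) ⊕ ((Σ _ : VR, Fin 3) ⊕ (Σ c, Fin (ord c)))) ≃ L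
  up : ((Σ _ : VP, Fin 2) ⊕ (Σ _ : VR, Fin 1)) ≃ L
  noLoopP : ∀ a i j, low (.inl ⟨a, i⟩) ≠ up (.inl ⟨a, j⟩)
  noLoopR : ∀ b i j, low (.inr (.inl ⟨b, i⟩)) ≠ up (.inr ⟨b, j⟩)

attribute [instance] Diagram.fintypeVP Diagram.fintypeVR Diagram.fintypeL Diagram.decidableEqL

namespace Diagram

variable (T : Diagram n)

/-- The value of a contraction diagram. -/
def value {d : ℕ} (J : JetData 𝕜 n d) : 𝕜 :=
  ∑ idx : T.L → Fin d,
    (∏ a, J.P (T.derP a) (fun i => idx (T.low (.inl ⟨a, i⟩))) (fun j => idx (T.up (.inl ⟨a, j⟩)))) *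
    ((∏ b, J.R 0 (fun i => idx (T.low (.inr (.inl ⟨b, i⟩)))) (fun j => idx (T.up (.inr ⟨b, j⟩)))) *
      ∏ c, J.F c (T.ord c) (fun i => idx (T.low (.inr (.inr ⟨c, i⟩)))))

/-- The positions of the lower indices, with the factors numbered. -/
def lowerEquiv :
    ((w : Vertex (Fintype.card T.VP) (Fintype.card T.VR) n) ×
      Fin (lowerArity (T.derP ∘ (Fintype.equivFin T.VP).symm) (fun _ => 0) T.ord w)) ≃ T.L :=
  (Equiv.sumSigmaDistrib _).trans <|
    (Equiv.sumCongr
      (Equiv.sigmaCongrLeft (β := fun a => Fin (T.derP a)) (Fintype.equivFin T.VP).symm)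
      ((Equiv.sumSigmaDistrib _).trans (Equiv.sumCongr
        (Equiv.sigmaCongrLeft (β := fun _ => Fin 3) (Fintype.equivFin T.VR).symm)
        (Equiv.refl _)))).trans T.low

/-- The positions of the upper indices, with the factors numbered. -/
def upperEquiv :
    ((w : Vertex (Fintype.card T.VP) (Fintype.card T.VR) n) × Fin (upperArity w)) ≃ T.L :=
  (Equiv.sumSigmaDistrib _).trans <|
    (Equiv.sumCongr
      (Equiv.sigmaCongrLeft (β := fun _ => Fin 2) (Fintype.equivFin T.VP).symm)
      ((Equiv.sumSigmaDistrib _).trans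
        (haveI : IsEmpty (Σ c : Fin n, Fin (upperArity
            (.inr (.inr c) : Vertex (Fintype.card T.VP) (Fintype.card T.VR) n))) :=
          ⟨fun s => s.2.elim0⟩
        (Equiv.sumEmpty _ _).trans
          (Equiv.sigmaCongrLeft (β := fun _ => Fin 1) (Fintype.equivFin T.VR).symm)))).trans T.up

/-- The monomial of a contraction diagram. -/
def monomial : UnivMonomial n where
  nP := Fintype.card T.VP
  nR := Fintype.card T.VR
  derP := T.derP ∘ (Fintype.equivFin T.VP).symm
  derR _ := 0
  ord := T.ord
  contraction := T.lowerEquiv.trans T.upperEquiv.symm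

/-- The contraction joins slots with equal labels, so a loop would be a common label of a lower and
an upper slot of one factor. This is excluded for P and R, and functions have no upper slots. -/
theorem noLoop_monomial : T.monomial.NoLoop := by
  rintro ⟨w, i⟩ h
  have key : ∀ t : (w : Vertex (Fintype.card T.VP) (Fintype.card T.VR) n) × Fin (upperArity w),
      t.1 = w → T.lowerEquiv ⟨w, i⟩ ≠ T.upperEquiv t := by
    rintro ⟨w', j⟩ (h : w' = w)
    subst h
    match w', i, j with
    | .inl a, i, j => exact T.noLoopP _ i j
    | .inr (.inl b), i, j => exact T.noLoopR _ i j
    | .inr (.inr c), i, j => exact j.elim0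
  exact key _ h (T.upperEquiv.apply_symm_apply _).symm

/-- Labels and lower slots correspond bijectively, so assigning values to either is the same; the
product over all factors splits by their type. -/
theorem jetEval_monomial {d : ℕ} (J : JetData 𝕜 n d) : T.monomial.jetEval J = T.value J := by
  refine (Fintype.sum_equiv (Equiv.arrowCongr T.lowerEquiv.symm (Equiv.refl (Fin d)))
    _ _ fun φ => ?_).symm
  have hup : ∀ t, (Equiv.arrowCongr T.lowerEquiv.symm (Equiv.refl (Fin d)) φ)
      (T.monomial.contraction.symm t) = φ (T.upperEquiv t) := fun t =>
    congrArg φ (T.lowerEquiv.apply_symm_apply _)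
  simp only [hup]
  symm
  rw [Fintype.prod_sum_type, Fintype.prod_sum_type]
  congr 1
  · exact Equiv.prod_comp (Fintype.equivFin T.VP).symm fun a =>
      J.P (T.derP a) (fun i => φ (T.low (.inl ⟨a, i⟩))) (fun j => φ (T.up (.inl ⟨a, j⟩)))
  · congr 1
    exact Equiv.prod_comp (Fintype.equivFin T.VR).symm fun b =>
      J.R 0 (fun i => φ (T.low (.inr (.inl ⟨b, i⟩)))) (fun j => φ (T.up (.inr ⟨b, j⟩)))

theorem isUniversalExpr_value : IsUniversalExpr (𝕜 := 𝕜) fun _ J => T.value J :=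
  ⟨[(1, T.monomial)], by simpa using T.noLoop_monomial,
    fun d J => by simp [jetEval_monomial]⟩

end Diagram

end Universal

/-! ### Jets of the geometric data -/

section Link

variable {d : ℕ} {M : Type u} [TopologicalSpace M] [ChartedSpace (EuclideanSpace ℝ (Fin d)) M]
  [IsManifold (𝓡 d) ∞ M] {𝕜 : Type v} [RCLike 𝕜]

/-- The jets of a connection, a Poisson tensor and functions, in a chart. -/
def jetData {n : ℕ} (D : TorsionFreeConnection d M) (P : PoissonTensor d M)
    (e : OpenPartialHomeomorph M (EuclideanSpace ℝ (Fin d))) (f : Fin n → M → 𝕜) (x : M) :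
    JetData 𝕜 n d where
  P m l u := (covPoisson D P e m l u x : 𝕜)
  R m l u := (covCurvature D e m l u x : 𝕜)
  F c m l := symCovFun D e (f c) m l x

theorem UnivMonomial.eval_eq_jetEval {n : ℕ} (W : UnivMonomial n) (D : TorsionFreeConnection d M)
    (P : PoissonTensor d M) (e : OpenPartialHomeomorph M (EuclideanSpace ℝ (Fin d)))
    (f : Fin n → M → 𝕜) (x : M) : W.eval D P e f x = W.jetEval (jetData D P e f x) :=
  Finset.sum_congr rfl fun _ _ => Finset.prod_congr rfl fun w _ =>
    match w with
    | .inl _ => rfl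
    | .inr (.inl _) => rfl
    | .inr (.inr _) => rfl

end Link

/-- Universality is proved for formal jets, with no manifold involved; one polynomial then serves
all manifolds and charts at once. -/
theorem IsUniversalExpr.isUniversalNoLoop {𝕜 : Type v} [RCLike 𝕜] {C : BidiffFamily.{u} 𝕜}
    {V : ∀ d, JetData 𝕜 2 d → 𝕜} (h : IsUniversalExpr V)
    (hC : ∀ (d : ℕ) (M : Type u) [TopologicalSpace M] [T2Space M]
      [ChartedSpace (EuclideanSpace ℝ (Fin d)) M] [IsManifold (𝓡 d) ∞ M]
      (D : TorsionFreeConnection d M) (P : PoissonTensor d M) (f g : SmoothFun 𝕜 d M),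
      ∀ e ∈ Charts d M, ∀ x ∈ e.source,
        C d M D P f g x = V d (jetData D P e ![f, g] x)) : IsUniversalNoLoop C := by
  obtain ⟨U, hU, h⟩ := h
  refine ⟨U, hU, fun d M _ _ _ _ D P f g e he x hx => ?_⟩
  rw [hC d M D P f g e he x hx, h, UnivPoly.eval]
  simp only [UnivMonomial.eval_eq_jetEval]

/-! ### The cochains of degree one and two are universal -/

theorem sum_arrow_two {κ A : Type*} [Fintype κ] [AddCommMonoid A] (G : κ → κ → A) :
    ∑ φ : Fin 2 → κ, G (φ 0) (φ 1) = ∑ i, ∑ j, G i j := by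
  rw [← (Fin.consEquiv fun _ : Fin 2 => κ).sum_comp, Fintype.sum_prod_type]
  refine Finset.sum_congr rfl fun i _ => ?_
  rw [← (Equiv.funUnique (Fin 1) κ).symm.sum_comp]
  rfl

theorem sum_arrow_three {κ A : Type*} [Fintype κ] [AddCommMonoid A] (G : κ → κ → κ → A) :
    ∑ φ : Fin 3 → κ, G (φ 0) (φ 1) (φ 2) = ∑ i, ∑ j, ∑ k, G i j k := by
  rw [← (Fin.consEquiv fun _ : Fin 3 => κ).sum_comp, Fintype.sum_prod_type]
  exact Finset.sum_congr rfl fun i _ => sum_arrow_two (G i)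

theorem sum_arrow_four {κ A : Type*} [Fintype κ] [AddCommMonoid A] (G : κ → κ → κ → κ → A) :
    ∑ φ : Fin 4 → κ, G (φ 0) (φ 1) (φ 2) (φ 3) = ∑ i, ∑ j, ∑ k, ∑ l, G i j k l := by
  rw [← (Fin.consEquiv fun _ : Fin 4 => κ).sum_comp, Fintype.sum_prod_type]
  exact Finset.sum_congr rfl fun i _ => sum_arrow_three (G i)

/-- A contraction diagram without curvature, given by tables of labels. -/
def Diagram.ofTables {a m n : ℕ} (derP : Fin a → ℕ) (ord : Fin n → ℕ)
    (lowP : ∀ b, Fin (derP b) → Fin m) (lowF : ∀ c, Fin (ord c) → Fin m)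
    (upP : Fin a → Fin 2 → Fin m)
    (hlow : Function.Bijective (Sum.elim (fun s : Σ b, Fin (derP b) => lowP s.1 s.2)
      fun s : Σ c, Fin (ord c) => lowF s.1 s.2))
    (hup : Function.Bijective fun s : Σ _ : Fin a, Fin 2 => upP s.1 s.2)
    (hP : ∀ b i j, lowP b i ≠ upP b j) : Diagram n where
  VP := Fin a
  VR := Empty
  L := Fin m
  derP := derP
  ord := ord
  low := (Equiv.sumCongr (Equiv.refl _) (Equiv.emptySum _ _)).trans (Equiv.ofBijective _ hlow)
  up := (Equiv.sumEmpty _ _).trans (Equiv.ofBijective _ hup)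
  noLoopP := hP
  noLoopR b := b.elim

theorem Diagram.ofTables_value {𝕜 : Type v} [RCLike 𝕜] {a m n : ℕ} (derP : Fin a → ℕ)
    (ord : Fin n → ℕ) (lowP : ∀ b, Fin (derP b) → Fin m) (lowF : ∀ c, Fin (ord c) → Fin m)
    (upP : Fin a → Fin 2 → Fin m) (hlow hup hP) {d : ℕ} (J : JetData 𝕜 n d) :
    (Diagram.ofTables derP ord lowP lowF upP hlow hup hP).value J = ∑ φ : Fin m → Fin d,
      (∏ b, J.P (derP b) (fun i => φ (lowP b i)) fun j => φ (upP b j)) *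
        ∏ c, J.F c (ord c) fun i => φ (lowF c i) := by
  exact Finset.sum_congr rfl fun φ _ => congrArg _ (one_mul _)

section Expr

variable {𝕜 : Type v} [RCLike 𝕜]

theorem isUniversalExpr_PFF : IsUniversalExpr (𝕜 := 𝕜) (n := 2) fun d J =>
    ∑ i : Fin d, ∑ j : Fin d, J.P 0 ![] ![i, j] * (J.F 0 1 ![i] * J.F 1 1 ![j]) := by
  refine (Diagram.isUniversalExpr_value (Diagram.ofTables (a := 1) (m := 2) ![0] ![1, 1]
    (fun | 0 => ![]) (fun | 0 => ![0] | 1 => ![1]) ![![0, 1]] (by decide) (by decide)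
    (by decide))).congr fun d J => ?_
  rw [Diagram.ofTables_value, ← sum_arrow_two]
  refine Finset.sum_congr rfl fun φ _ => ?_
  rw [Fin.prod_univ_one, Fin.prod_univ_two]
  refine congrArg₂ _ (congrArg₂ (J.P 0) ?_ ?_)
    (congrArg₂ _ (congrArg (J.F 0 1) ?_) (congrArg (J.F 1 1) ?_)) <;>
  · funext i
    fin_cases i <;> rfl

theorem isUniversalExpr_PPF₂F₂ : IsUniversalExpr (𝕜 := 𝕜) (n := 2) fun d J =>
    ∑ k : Fin d, ∑ r : Fin d, ∑ l : Fin d, ∑ s : Fin d,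
      J.P 0 ![] ![k, r] * J.P 0 ![] ![l, s] * (J.F 0 2 ![k, l] * J.F 1 2 ![r, s]) := by
  -- The labels 0, 1, 2, 3 stand for k, r, l, s, here and in the next three diagrams. The tables
  -- list the labels on the lower slots of the two factors P, on the two functions, and on the upper
  -- slots of P.
  refine (Diagram.isUniversalExpr_value (Diagram.ofTables (a := 2) (m := 4) ![0, 0] ![2, 2]
    (fun | 0 => ![] | 1 => ![]) (fun | 0 => ![0, 2] | 1 => ![1, 3]) ![![0, 1], ![2, 3]]
    (by decide) (by decide) (by decide))).congr fun d J => ?_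
  rw [Diagram.ofTables_value, ← sum_arrow_four]
  refine Finset.sum_congr rfl fun φ _ => ?_
  rw [Fin.prod_univ_two, Fin.prod_univ_two]
  refine congrArg₂ _ (congrArg₂ _ (congrArg₂ (J.P 0) ?_ ?_)
    (congrArg₂ (J.P 0) ?_ ?_))
    (congrArg₂ _ (congrArg (J.F 0 2) ?_) (congrArg (J.F 1 2) ?_)) <;>
  · funext i
    fin_cases i <;> rfl

theorem isUniversalExpr_PDPF₂F₁ : IsUniversalExpr (𝕜 := 𝕜) (n := 2) fun d J =>
    ∑ k : Fin d, ∑ r : Fin d, ∑ l : Fin d, ∑ s : Fin d,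
      J.P 0 ![] ![k, r] * J.P 1 ![r] ![l, s] * (J.F 0 2 ![k, l] * J.F 1 1 ![s]) := by
  refine (Diagram.isUniversalExpr_value (Diagram.ofTables (a := 2) (m := 4) ![0, 1] ![2, 1]
    (fun | 0 => ![] | 1 => ![1]) (fun | 0 => ![0, 2] | 1 => ![3]) ![![0, 1], ![2, 3]]
    (by decide) (by decide) (by decide))).congr fun d J => ?_
  rw [Diagram.ofTables_value, ← sum_arrow_four]
  refine Finset.sum_congr rfl fun φ _ => ?_
  rw [Fin.prod_univ_two, Fin.prod_univ_two]
  refine congrArg₂ _ (congrArg₂ _ (congrArg₂ (J.P 0) ?_ ?_)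
    (congrArg₂ (J.P 1) ?_ ?_))
    (congrArg₂ _ (congrArg (J.F 0 2) ?_) (congrArg (J.F 1 1) ?_)) <;>
  · funext i
    fin_cases i <;> rfl

theorem isUniversalExpr_PDPF₁F₂ : IsUniversalExpr (𝕜 := 𝕜) (n := 2) fun d J =>
    ∑ k : Fin d, ∑ r : Fin d, ∑ l : Fin d, ∑ s : Fin d,
      J.P 0 ![] ![k, r] * J.P 1 ![r] ![l, s] * (J.F 0 1 ![s] * J.F 1 2 ![k, l]) := by
  refine (Diagram.isUniversalExpr_value (Diagram.ofTables (a := 2) (m := 4) ![0, 1] ![1, 2]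
    (fun | 0 => ![] | 1 => ![1]) (fun | 0 => ![3] | 1 => ![0, 2]) ![![0, 1], ![2, 3]]
    (by decide) (by decide) (by decide))).congr fun d J => ?_
  rw [Diagram.ofTables_value, ← sum_arrow_four]
  refine Finset.sum_congr rfl fun φ _ => ?_
  rw [Fin.prod_univ_two, Fin.prod_univ_two]
  refine congrArg₂ _ (congrArg₂ _ (congrArg₂ (J.P 0) ?_ ?_)
    (congrArg₂ (J.P 1) ?_ ?_))
    (congrArg₂ _ (congrArg (J.F 0 1) ?_) (congrArg (J.F 1 2) ?_)) <;>
  · funext i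
    fin_cases i <;> rfl

theorem isUniversalExpr_DPDPF₁F₁ : IsUniversalExpr (𝕜 := 𝕜) (n := 2) fun d J =>
    ∑ k : Fin d, ∑ r : Fin d, ∑ l : Fin d, ∑ s : Fin d,
      J.P 1 ![l] ![k, r] * J.P 1 ![k] ![l, s] * (J.F 0 1 ![r] * J.F 1 1 ![s]) := by
  refine (Diagram.isUniversalExpr_value (Diagram.ofTables (a := 2) (m := 4) ![1, 1] ![1, 1]
    (fun | 0 => ![2] | 1 => ![0]) (fun | 0 => ![1] | 1 => ![3]) ![![0, 1], ![2, 3]]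
    (by decide) (by decide) (by decide))).congr fun d J => ?_
  rw [Diagram.ofTables_value, ← sum_arrow_four]
  refine Finset.sum_congr rfl fun φ _ => ?_
  rw [Fin.prod_univ_two, Fin.prod_univ_two]
  refine congrArg₂ _ (congrArg₂ _ (congrArg₂ (J.P 1) ?_ ?_)
    (congrArg₂ (J.P 1) ?_ ?_))
    (congrArg₂ _ (congrArg (J.F 0 1) ?_) (congrArg (J.F 1 1) ?_)) <;>
  · funext i
    fin_cases i <;> rfl

theorem isUniversalNoLoop_cochain_one : IsUniversalNoLoop (cochain.{u} 𝕜 1) := by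
  refine isUniversalExpr_PFF.isUniversalNoLoop fun d M _ _ _ _ D P f g e he x hx => ?_
  refine (bracket_eq_sum P he e.open_source le_rfl f.contMDiff.contMDiffOn
    g.contMDiff.contMDiffOn D hx).trans ?_
  simp only [covFun_one_eq_symCovFun]
  rfl

theorem isUniversalNoLoop_cochain_two : IsUniversalNoLoop (cochain.{u} 𝕜 2) := by
  refine (((isUniversalExpr_PPF₂F₂.smul (1 / 2)).add
    ((isUniversalExpr_PDPF₂F₁.add isUniversalExpr_PDPF₁F₂).smul (1 / 3))).add
      (isUniversalExpr_DPDPF₁F₁.smul (-(1 / 6)))).isUniversalNoLoop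
        fun d M _ _ _ _ D P f g e he x hx => ?_
  refine (cochainTwo_apply D P he f g hx).trans ?_
  simp only [formulaC2, covFun_one_eq_symCovFun, covFun_two_eq_symCovFun D _ P he _ _ hx, jetData,
    covPoisson, mul_add, Finset.sum_add_distrib, RCLike.ofReal_mul,
    RCLike.ofReal_neg, RCLike.ofReal_div, RCLike.ofReal_one, RCLike.ofReal_ofNat]
  simp
  ring

end Expr

/-! ### The cochain of degree three is universal -/

/-- A contraction of one factor `∇^m P`, of factors `R` and of one factor `∇^{sym} f`, with two free
lower indices and one free upper index; the contracted pairs of indices are labelled by `I`. -/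
structure OpenDiagram where
  VR : Type
  I : Type
  [fintypeVR : Fintype VR]
  [fintypeI : Fintype I]
  [decidableEqI : DecidableEq I]
  derP : ℕ
  ord : ℕ
  low : (Fin derP ⊕ ((Σ _ : VR, Fin 3) ⊕ Fin ord)) ≃ (Fin 2 ⊕ I)
  up : (Fin 2 ⊕ (Σ _ : VR, Fin 1)) ≃ (Unit ⊕ I)
  noLoopP : ∀ i j a, low (.inl i) = .inr a → up (.inl j) ≠ .inr a
  noLoopR : ∀ b i j a, low (.inr (.inl ⟨b, i⟩)) = .inr a → up (.inr ⟨b, j⟩) ≠ .inr a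

attribute [instance] OpenDiagram.fintypeVR OpenDiagram.fintypeI OpenDiagram.decidableEqI

namespace OpenDiagram

variable {𝕜 : Type v} [RCLike 𝕜]

/-- The summand of the value of an open diagram, for given values of all indices. -/
def summand (T : OpenDiagram) {n d : ℕ} (J : JetData 𝕜 n d) (c : Fin n) (lo : Fin 2 → Fin d)
    (hi : Fin d) (φ : T.I → Fin d) : 𝕜 :=
  J.P T.derP (fun i => Sum.elim lo φ (T.low (.inl i)))
      (fun j => Sum.elim (fun _ => hi) φ (T.up (.inl j))) *
    ((∏ b, J.R 0 (fun i => Sum.elim lo φ (T.low (.inr (.inl ⟨b, i⟩))))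
        (fun j => Sum.elim (fun _ => hi) φ (T.up (.inr ⟨b, j⟩)))) *
      J.F c T.ord (fun i => Sum.elim lo φ (T.low (.inr (.inr i)))))

/-- The value of an open diagram, for given values of the free indices. -/
def value (T : OpenDiagram) {n d : ℕ} (J : JetData 𝕜 n d) (c : Fin n) (lo : Fin 2 → Fin d)
    (hi : Fin d) : 𝕜 :=
  ∑ φ : T.I → Fin d, T.summand J c lo hi φ

variable (T : Fin 2 → OpenDiagram)

/-- The order of the derivative of `P` in the factors of a pairing of open diagrams. -/
def pairDer : Option (Fin 2) → ℕ
  | none => 0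
  | some c => (T c).derP

/-- The lower indices of a pairing, sorted by the open diagrams to which they belong. -/
def pairLowerSlots : ((Σ a, Fin (pairDer T a)) ⊕
    ((Σ _ : (Σ c, (T c).VR), Fin 3) ⊕ (Σ c, Fin (T c).ord))) ≃
    Σ c, (Fin (T c).derP ⊕ ((Σ _ : (T c).VR, Fin 3) ⊕ Fin (T c).ord)) where
  toFun
    | .inl ⟨none, i⟩ => i.elim0
    | .inl ⟨some c, i⟩ => ⟨c, .inl i⟩
    | .inr (.inl ⟨⟨c, b⟩, i⟩) => ⟨c, .inr (.inl ⟨b, i⟩)⟩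
    | .inr (.inr ⟨c, i⟩) => ⟨c, .inr (.inr i)⟩
  invFun
    | ⟨c, .inl i⟩ => .inl ⟨some c, i⟩
    | ⟨c, .inr (.inl ⟨b, i⟩)⟩ => .inr (.inl ⟨⟨c, b⟩, i⟩)
    | ⟨c, .inr (.inr i)⟩ => .inr (.inr ⟨c, i⟩)
  left_inv := by
    rintro (⟨_ | c, i⟩ | ⟨⟨c, b⟩, i⟩ | ⟨c, i⟩)
    · exact i.elim0
    all_goals rfl
  right_inv := by
    rintro ⟨c, i | ⟨b, i⟩ | i⟩ <;> rfl

/-- The upper indices of a pairing, sorted by the open diagrams to which they belong. -/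
def pairUpperSlots : ((Σ _ : Option (Fin 2), Fin 2) ⊕ (Σ _ : (Σ c, (T c).VR), Fin 1)) ≃
    (Fin 2 ⊕ Σ c, (Fin 2 ⊕ (Σ _ : (T c).VR, Fin 1))) where
  toFun
    | .inl ⟨none, i⟩ => .inl i
    | .inl ⟨some c, i⟩ => .inr ⟨c, .inl i⟩
    | .inr ⟨⟨c, b⟩, i⟩ => .inr ⟨c, .inr ⟨b, i⟩⟩
  invFun
    | .inl i => .inl ⟨none, i⟩
    | .inr ⟨c, .inl i⟩ => .inl ⟨some c, i⟩
    | .inr ⟨c, .inr ⟨b, i⟩⟩ => .inr ⟨⟨c, b⟩, i⟩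
  left_inv := by
    rintro (⟨_ | c, i⟩ | ⟨⟨c, b⟩, i⟩) <;> rfl
  right_inv := by
    rintro (i | ⟨c, i | ⟨b, i⟩⟩) <;> rfl

/-- The labels of the lower indices of a pairing: the free lower indices and the labels of the two
open diagrams. -/
def pairLowerLabels : (Σ c, (Fin 2 ⊕ (T c).I)) ≃ ((Fin 2 × Fin 2) ⊕ Σ c, (T c).I) where
  toFun
    | ⟨c, .inl i⟩ => .inl (c, i)
    | ⟨c, .inr a⟩ => .inr ⟨c, a⟩
  invFun
    | .inl (c, i) => ⟨c, .inl i⟩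
    | .inr ⟨c, a⟩ => ⟨c, .inr a⟩
  left_inv := by
    rintro ⟨c, i | a⟩ <;> rfl
  right_inv := by
    rintro (⟨c, i⟩ | ⟨c, a⟩) <;> rfl

/-- The labels of the upper indices of a pairing: the free lower indices of the two open diagrams, the first of which
meets the free upper index of the other diagram, and the second of which meets the additional
factor `P`, and the labels of the two open diagrams. -/
def pairUpperLabels : (Fin 2 ⊕ Σ c, (Unit ⊕ (T c).I)) ≃ ((Fin 2 × Fin 2) ⊕ Σ c, (T c).I) where
  toFun
    | .inl i => .inl (i, 1)
    | .inr ⟨c, .inl _⟩ => .inl (c.rev, 0)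
    | .inr ⟨c, .inr a⟩ => .inr ⟨c, a⟩
  invFun
    | .inl (i, 1) => .inl i
    | .inl (c, 0) => .inr ⟨c.rev, .inl ()⟩
    | .inr ⟨c, a⟩ => .inr ⟨c, .inr a⟩
  left_inv := by
    rintro (i | ⟨c, i | a⟩)
    · rfl
    · fin_cases c <;> rfl
    · rfl
  right_inv := by
    rintro (⟨c, i⟩ | ⟨c, a⟩)
    · fin_cases i <;> fin_cases c <;> rfl
    · rfl

/-- The complete contraction `P^{ls} A^j_{kl} B^k_{js}` of two open diagrams `A` and `B`. -/
def pair : Diagram 2 where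
  VP := Option (Fin 2)
  VR := Σ c, (T c).VR
  L := (Fin 2 × Fin 2) ⊕ Σ c, (T c).I
  derP := pairDer T
  ord c := (T c).ord
  low := (pairLowerSlots T).trans <| (Equiv.sigmaCongrRight fun c => (T c).low).trans
    (pairLowerLabels T)
  up := (pairUpperSlots T).trans <| (Equiv.sumCongr (Equiv.refl _)
    (Equiv.sigmaCongrRight fun c => (T c).up)).trans (pairUpperLabels T)
  noLoopP := by
    rintro (_ | c) i j
    · exact i.elim0
    · have h := (T c).noLoopP i j
      change Fin (T c).derP at i
      change pairLowerLabels T ⟨c, (T c).low (.inl i)⟩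
        ≠ pairUpperLabels T (.inr ⟨c, (T c).up (.inl j)⟩)
      -- Free lower slots of the open diagram c carry external labels (c, ·), and its free upper
      -- slot carries (c.rev, 0) with c.rev ≠ c. Hence equal labels would be internal, where the
      -- open diagram has no loop.
      rcases hl : (T c).low (.inl i) with l | a <;> rcases hu : (T c).up (.inl j) with l' | a'
      · intro h'
        have := congrArg Prod.fst (Sum.inl.inj h')
        revert this
        change c ≠ c.rev
        fin_cases c <;> decide
      · exact Sum.inl_ne_inr
      · exact Sum.inr_ne_inl
      · intro h'
        have := eq_of_heq (Sigma.mk.inj (Sum.inr.inj h')).2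
        exact h a hl (hu.trans (congrArg Sum.inr this.symm))
  noLoopR := by
    rintro ⟨c, b⟩ i j
    have h := (T c).noLoopR b i j
    change pairLowerLabels T ⟨c, (T c).low (.inr (.inl ⟨b, i⟩))⟩
      ≠ pairUpperLabels T (.inr ⟨c, (T c).up (.inr ⟨b, j⟩)⟩)
    rcases hl : (T c).low (.inr (.inl ⟨b, i⟩)) with l | a <;>
      rcases hu : (T c).up (.inr ⟨b, j⟩) with l' | a'
    · intro h'
      have := congrArg Prod.fst (Sum.inl.inj h')
      revert this
      change c ≠ c.rev
      fin_cases c <;> decide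
    · exact Sum.inl_ne_inr
    · exact Sum.inr_ne_inl
    · intro h'
      have := eq_of_heq (Sigma.mk.inj (Sum.inr.inj h')).2
      exact h a hl (hu.trans (congrArg Sum.inr this.symm))

theorem pair_value {d : ℕ} (J : JetData 𝕜 2 d) : (pair T).value J =
    ∑ l, ∑ s, ∑ j, ∑ k, J.P 0 ![] ![l, s] *
      ((T 0).value J 0 ![k, l] j * (T 1).value J 1 ![j, s] k) := by
  -- An assignment of values to labels splits into E on the four external labels and ψ on the
  -- internal labels of the two open diagrams.
  have h1 : (pair T).value J = ∑ E : Fin 2 × Fin 2 → Fin d, ∑ ψ : ∀ c, (T c).I → Fin d,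
      J.P 0 ![] ![E (0, 1), E (1, 1)] *
        ∏ c, (T c).summand J c ![E (c, 0), E (c, 1)] (E (c.rev, 0)) (ψ c) := by
    rw [← Fintype.sum_prod_type']
    refine Fintype.sum_equiv ((Equiv.sumArrowEquivProdArrow _ _ _).trans
      (Equiv.prodCongr (Equiv.refl _) (Equiv.piCurry fun c (_ : (T c).I) => Fin d))) _ _ fun φ => ?_
    have hlow : ∀ c s, φ (pairLowerLabels T ⟨c, s⟩) = Sum.elim
        ![φ (.inl (c, 0)), φ (.inl (c, 1))] (fun a => φ (.inr ⟨c, a⟩)) s := by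
      rintro c (i | a)
      · fin_cases i <;> rfl
      · rfl
    have hup : ∀ c s, φ (pairUpperLabels T (.inr ⟨c, s⟩)) = Sum.elim
        (fun _ => φ (.inl (c.rev, 0))) (fun a => φ (.inr ⟨c, a⟩)) s := by
      rintro c (i | a) <;> rfl
    simp only [summand, Finset.prod_mul_distrib]
    conv_rhs => rw [← mul_assoc]
    refine congrArg₂ _ ((Fintype.prod_option _).trans (congrArg₂ _ (congrArg₂ (J.P 0) ?_ ?_)
      (Finset.prod_congr rfl fun c _ => congrArg₂ (J.P _) (funext fun i => hlow c _)
        (funext fun j => hup c _)))) (congrArg₂ _ ((Fintype.prod_sigma _).trans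
      (Finset.prod_congr rfl fun c _ => Finset.prod_congr rfl fun b _ =>
        congrArg₂ (J.R 0) (funext fun i => hlow c _) (funext fun j => hup c _)))
      (Finset.prod_congr rfl fun c _ => congrArg (J.F c _) (funext fun i => hlow c _)))
    · exact Subsingleton.elim _ _
    · funext i
      fin_cases i <;> rfl
  -- For fixed external values the internal sums are independent, and the sum of products is a
  -- product of sums.
  have h2 : ∀ E : Fin 2 × Fin 2 → Fin d, (∑ ψ : ∀ c, (T c).I → Fin d,
      J.P 0 ![] ![E (0, 1), E (1, 1)] *
        ∏ c, (T c).summand J c ![E (c, 0), E (c, 1)] (E (c.rev, 0)) (ψ c)) =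
      J.P 0 ![] ![E (0, 1), E (1, 1)] * ((T 0).value J 0 ![E (0, 0), E (0, 1)] (E (1, 0)) *
        (T 1).value J 1 ![E (1, 0), E (1, 1)] (E (0, 0))) := by
    intro E
    have h := (Finset.prod_univ_sum (fun c => (Finset.univ : Finset ((T c).I → Fin d)))
      fun c φ => (T c).summand J c ![E (c, 0), E (c, 1)] (E (c.rev, 0)) φ).symm
    rw [Fintype.piFinset_univ, Fin.prod_univ_two] at h
    rw [← Finset.mul_sum]
    exact congrArg _ h
  rw [h1, Finset.sum_congr rfl fun E _ => h2 E, ← sum_arrow_four]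
  -- The external labels (0,1), (1,1), (1,0), (0,0) are l, s, j, k, in the order of summation.
  let q : Fin 2 × Fin 2 ≃ Fin 4 :=
    ⟨fun p => ![![3, 0], ![2, 1]] p.1 p.2, ![(0, 1), (1, 1), (1, 0), (0, 0)], by decide, by decide⟩
  exact Fintype.sum_equiv (Equiv.arrowCongr q (Equiv.refl (Fin d))) _ _ fun _ => rfl

end OpenDiagram

/-- An open diagram, given by tables of labels. -/
def OpenDiagram.ofTables (r m p q : ℕ) (lowP : Fin p → Fin 2 ⊕ Fin m)
    (lowR : Fin r → Fin 3 → Fin 2 ⊕ Fin m) (lowF : Fin q → Fin 2 ⊕ Fin m)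
    (upP : Fin 2 → Unit ⊕ Fin m) (upR : Fin r → Unit ⊕ Fin m)
    (hlow : Function.Bijective
      (Sum.elim lowP (Sum.elim (fun s : Σ _ : Fin r, Fin 3 => lowR s.1 s.2) lowF)))
    (hup : Function.Bijective (Sum.elim upP fun s : Σ _ : Fin r, Fin 1 => upR s.1))
    (hP : ∀ i j a, lowP i = .inr a → upP j ≠ .inr a)
    (hR : ∀ b i a, lowR b i = .inr a → upR b ≠ .inr a) : OpenDiagram where
  VR := Fin r
  I := Fin m
  derP := p
  ord := q
  low := Equiv.ofBijective _ hlow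
  up := Equiv.ofBijective _ hup
  noLoopP := hP
  noLoopR b i _ := hR b i

/-- The summands of the components of the Lie derivative of a connection in the direction of a
Hamiltonian vector field, in terms of symmetrised covariant derivatives. -/
def lieDiagram : Fin 7 → OpenDiagram
  -- The free labels `.inl 0`, `.inl 1` are k, l below and `.inl ()` is j above; `.inr 0` is i and
  -- `.inr 1` is s. Diagrams 1 and 2 are the corrections from symmetrising ∇³f, with coefficient
  -- -1/3 each; the others are the five terms of the formula.
  | 0 => .ofTables 0 1 0 3 ![] ![] ![.inl 0, .inl 1, .inr 0] ![.inr 0, .inl ()] ![]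
    (by decide) (by decide) (by decide) (by decide)
  | 1 => .ofTables 1 2 0 1 ![] ![![.inl 0, .inl 1, .inr 0]] ![.inr 1] ![.inr 0, .inl ()] ![.inr 1]
    (by decide) (by decide) (by decide) (by decide)
  | 2 => .ofTables 1 2 0 1 ![] ![![.inl 0, .inr 0, .inl 1]] ![.inr 1] ![.inr 0, .inl ()] ![.inr 1]
    (by decide) (by decide) (by decide) (by decide)
  | 3 => .ofTables 0 1 1 2 ![.inl 0] ![] ![.inl 1, .inr 0] ![.inr 0, .inl ()] ![]
    (by decide) (by decide) (by decide) (by decide)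
  | 4 => .ofTables 0 1 1 2 ![.inl 1] ![] ![.inl 0, .inr 0] ![.inr 0, .inl ()] ![]
    (by decide) (by decide) (by decide) (by decide)
  | 5 => .ofTables 0 1 2 1 ![.inl 0, .inl 1] ![] ![.inr 0] ![.inr 0, .inl ()] ![]
    (by decide) (by decide) (by decide) (by decide)
  | 6 => .ofTables 1 2 0 1 ![] ![![.inr 0, .inl 0, .inl 1]] ![.inr 1] ![.inr 1, .inr 0] ![.inl ()]
    (by decide) (by decide) (by decide) (by decide)

/-- The coefficients of the summands of the components of the Lie derivative of a connection. -/
def lieCoeff : Fin 7 → ℝ := ![1, -(1 / 3), -(1 / 3), 1, 1, 1, 1]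

/-! ### Values of the seven open diagrams -/

section Values

variable {𝕜 : Type v} [RCLike 𝕜] {n d : ℕ} (J : JetData 𝕜 n d) (c : Fin n) (k l j : Fin d)

theorem sum_arrow_one {κ A : Type*} [Fintype κ] [AddCommMonoid A] (G : κ → A) :
    ∑ φ : Fin 1 → κ, G (φ 0) = ∑ i, G i :=
  Fintype.sum_equiv (Equiv.funUnique (Fin 1) κ) _ _ fun _ => rfl

theorem lieDiagram_zero_value : (lieDiagram 0).value J c ![k, l] j =
    ∑ i, J.P 0 ![] ![i, j] * J.F c 3 ![k, l, i] := by
  rw [← sum_arrow_one]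
  refine Finset.sum_congr rfl fun (φ : Fin 1 → Fin d) _ =>
    congrArg₂ _ (congrArg₂ (J.P 0) ?_ ?_) ((one_mul _).trans (congrArg (J.F c 3) ?_)) <;>
  · funext i
    fin_cases i <;> rfl

theorem lieDiagram_one_value : (lieDiagram 1).value J c ![k, l] j =
    ∑ i, ∑ s, J.P 0 ![] ![i, j] * (J.R 0 ![k, l, i] ![s] * J.F c 1 ![s]) := by
  rw [← sum_arrow_two]
  refine Finset.sum_congr rfl fun (φ : Fin 2 → Fin d) _ =>
    congrArg₂ _ (congrArg₂ (J.P 0) ?_ ?_) (congrArg₂ _ ((Fin.prod_univ_one _).trans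
      (congrArg₂ (J.R 0) ?_ ?_)) (congrArg (J.F c 1) ?_)) <;>
  · funext (i : Fin _)
    fin_cases i <;> rfl

theorem lieDiagram_two_value : (lieDiagram 2).value J c ![k, l] j =
    ∑ i, ∑ s, J.P 0 ![] ![i, j] * (J.R 0 ![k, i, l] ![s] * J.F c 1 ![s]) := by
  rw [← sum_arrow_two]
  refine Finset.sum_congr rfl fun (φ : Fin 2 → Fin d) _ =>
    congrArg₂ _ (congrArg₂ (J.P 0) ?_ ?_) (congrArg₂ _ ((Fin.prod_univ_one _).trans
      (congrArg₂ (J.R 0) ?_ ?_)) (congrArg (J.F c 1) ?_)) <;>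
  · funext i
    fin_cases i <;> rfl

theorem lieDiagram_three_value : (lieDiagram 3).value J c ![k, l] j =
    ∑ i, J.P 1 ![k] ![i, j] * J.F c 2 ![l, i] := by
  rw [← sum_arrow_one]
  refine Finset.sum_congr rfl fun (φ : Fin 1 → Fin d) _ =>
    congrArg₂ _ (congrArg₂ (J.P 1) ?_ ?_) ((one_mul _).trans (congrArg (J.F c 2) ?_)) <;>
  · funext i
    fin_cases i <;> rfl

theorem lieDiagram_four_value : (lieDiagram 4).value J c ![k, l] j =
    ∑ i, J.P 1 ![l] ![i, j] * J.F c 2 ![k, i] := by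
  rw [← sum_arrow_one]
  refine Finset.sum_congr rfl fun (φ : Fin 1 → Fin d) _ =>
    congrArg₂ _ (congrArg₂ (J.P 1) ?_ ?_) ((one_mul _).trans (congrArg (J.F c 2) ?_)) <;>
  · funext i
    fin_cases i <;> rfl

theorem lieDiagram_five_value : (lieDiagram 5).value J c ![k, l] j =
    ∑ i, J.P 2 ![k, l] ![i, j] * J.F c 1 ![i] := by
  rw [← sum_arrow_one]
  refine Finset.sum_congr rfl fun (φ : Fin 1 → Fin d) _ =>
    congrArg₂ _ (congrArg₂ (J.P 2) ?_ ?_) ((one_mul _).trans (congrArg (J.F c 1) ?_)) <;>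
  · funext i
    fin_cases i <;> rfl

theorem lieDiagram_six_value : (lieDiagram 6).value J c ![k, l] j =
    ∑ i, ∑ s, J.P 0 ![] ![s, i] * (J.R 0 ![i, k, l] ![j] * J.F c 1 ![s]) := by
  rw [← sum_arrow_two]
  refine Finset.sum_congr rfl fun (φ : Fin 2 → Fin d) _ =>
    congrArg₂ _ (congrArg₂ (J.P 0) ?_ ?_) (congrArg₂ _ ((Fin.prod_univ_one _).trans
      (congrArg₂ (J.R 0) ?_ ?_)) (congrArg (J.F c 1) ?_)) <;>
  · funext i
    fin_cases i <;> rfl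

end Values

/-! ### The Lie derivative of the connection and the third cochain as diagrams -/

section Link

variable {d : ℕ} {M : Type u} [TopologicalSpace M] [T2Space M]
  [ChartedSpace (EuclideanSpace ℝ (Fin d)) M] [IsManifold (𝓡 d) ∞ M] {𝕜 : Type v} [RCLike 𝕜]
  (D : TorsionFreeConnection d M) (P : PoissonTensor d M)
  {e : OpenPartialHomeomorph M (EuclideanSpace ℝ (Fin d))}

/-- The five-term formula with ∇³f replaced by its symmetrisation and two curvature terms. The slot
c allows f and g to be read off from the same jet. -/
theorem lieConn_eq_sum_lieDiagram (he : e ∈ Charts d M) (f : SmoothFun 𝕜 d M) {n : ℕ}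
    {F : Fin n → M → 𝕜} {c : Fin n} (hF : F c = f) (j k l : Fin d) {x : M} (hx : x ∈ e.source) :
    lieConn D P e f j k l x = ∑ a, (lieCoeff a : 𝕜) *
      (lieDiagram a).value (jetData D P e F x) c ![k, l] j := by
  have hJ : ∀ m i, (jetData D P e F x).F c m i = symCovFun D e f m i x := fun m i => by
    rw [← hF]
    rfl
  have hP : ∀ m i u, (jetData D P e F x).P m i u = (covPoisson D P e m i u x : 𝕜) :=
    fun _ _ _ => rfl
  have hR : ∀ i k l s, (jetData D P e F x).R 0 ![i, k, l] ![s] = (curvature D e i k l s x : 𝕜) :=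
    fun _ _ _ _ => rfl
  have h0 : ∀ i j, P.comp e i j x = covPoisson D P e 0 ![] ![i, j] x := fun _ _ => rfl
  simp only [Fin.sum_univ_succ, Fin.sum_univ_zero]
  simp only [Fin.reduceSucc, lieDiagram_zero_value, lieDiagram_one_value, lieDiagram_two_value,
    lieDiagram_three_value, lieDiagram_four_value, lieDiagram_five_value, lieDiagram_six_value,
    hJ, hP, hR, lieConn, h0, covFun_one_eq_symCovFun, covFun_two_eq_symCovFun D f P he _ _ hx,
    covFun_three_eq_symCovFun D f P he _ _ _ hx]
  have h3 : ((3 : ℝ) : 𝕜) = 3 := map_ofNat (algebraMap ℝ 𝕜) 3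
  simp [h3, lieCoeff, Finset.sum_add_distrib, mul_sub, add_mul, mul_add, Finset.mul_sum, mul_assoc,
    mul_comm, mul_left_comm]
  ring

/-- C₃ is bilinear in the two Lie derivatives, so it is a combination of the pairings of the seven
open diagrams with themselves. -/
theorem isUniversalNoLoop_cochain_three : IsUniversalNoLoop (cochain.{u} 𝕜 3) := by
  refine ((IsUniversalExpr.sum Finset.univ fun (a : Fin 7) _ =>
    IsUniversalExpr.sum Finset.univ fun (b : Fin 7) _ =>
      (OpenDiagram.pair ![lieDiagram a, lieDiagram b]).isUniversalExpr_value.smul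
        (lieCoeff a * lieCoeff b)).smul (-(1 / 6))).isUniversalNoLoop
          fun d M _ _ _ _ D P f g e he x hx => ?_
  refine (cochainThree_apply D P he f g hx).trans ?_
  have hc : ((-(1 / 6) : ℝ) : 𝕜) = -(1 / 6) := by
    rw [RCLike.ofReal_neg, RCLike.ofReal_div, RCLike.ofReal_one, RCLike.ofReal_ofNat]
  -- Moves the finite sums over diagrams inside the sums over indices.
  have hsum : ∀ {A : Type v} [AddCommMonoid A] (H : Fin 7 → Fin 7 → Fin d → A),
      ∑ i, ∑ a, ∑ b, H a b i = ∑ a, ∑ b, ∑ i, H a b i := fun H =>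
    Finset.sum_comm.trans (Finset.sum_congr rfl fun a _ => Finset.sum_comm)
  simp only [OpenDiagram.pair_value, formulaC3, hc,
    lieConn_eq_sum_lieDiagram D P he f (F := ![f, g]) (c := 0) rfl _ _ _ hx,
    lieConn_eq_sum_lieDiagram D P he g (F := ![f, g]) (c := 1) rfl _ _ _ hx, Finset.mul_sum,
    Finset.sum_mul, ← hsum]
  refine Finset.sum_congr rfl fun l _ => Finset.sum_congr rfl fun s _ =>
    Finset.sum_congr rfl fun j _ => Finset.sum_congr rfl fun k _ =>
      Finset.sum_comm.trans <| Finset.sum_congr rfl fun a _ => Finset.sum_congr rfl fun b _ => ?_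
  have hP : (jetData D P e ![⇑f, ⇑g] x).P 0 ![] ![l, s] = (P.comp e l s x : 𝕜) := rfl
  rw [hP, RCLike.ofReal_mul]
  simp only [Matrix.cons_val_zero, Matrix.cons_val_one]
  ring

end Link

theorem isUniversalNoLoop_cochain (𝕜 : Type v) [RCLike 𝕜] (r : ℕ) (h1 : 1 ≤ r) (h3 : r ≤ 3) :
    IsUniversalNoLoop (cochain.{u} 𝕜 r) := by
  interval_cases r
  exacts [isUniversalNoLoop_cochain_one, isUniversalNoLoop_cochain_two,
    isUniversalNoLoop_cochain_three]

end UnivStar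

end

theorem mainTheorem5 (𝕜 : Type v) [RCLike 𝕜] :
    ∃ C : ℕ → BidiffFamily.{u} 𝕜,
      IsUniversalStarProductUpTo 3 C ∧
      (∀ (d : ℕ) (M : Type u) [TopologicalSpace M] [T2Space M]
        [ChartedSpace (EuclideanSpace ℝ (Fin d)) M] [IsManifold (𝓡 d) ∞ M]
        (D : TorsionFreeConnection d M) (P : PoissonTensor d M) (f g : SmoothFun 𝕜 d M),
        (∀ x, C 1 d M D P f g x = P.bracket f g x) ∧
        ∀ e ∈ Charts d M, ∀ x ∈ e.source,
          C 2 d M D P f g x = formulaC2 D P e f g x ∧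
          C 3 d M D P f g x = formulaC3 D P e f g x) ∧
      ∀ (d : ℕ) (M : Type u) [TopologicalSpace M] [T2Space M]
        [ChartedSpace (EuclideanSpace ℝ (Fin d)) M] [IsManifold (𝓡 d) ∞ M]
        (D : TorsionFreeConnection d M) (P : PoissonTensor d M) (f : SmoothFun ℝ d M),
        ∀ e ∈ Charts d M, ∀ x ∈ e.source, ∀ j k l : Fin d,
          coordCovector e j x
              (lieDerivConnection D (P.hamiltonian f) (coordVector e k) (coordVector e l) x) =
            lieConn D P e f j k l x := by
  refine ⟨cochain 𝕜, ⟨fun d M _ _ _ _ D P => isStarProduct_cochain D P,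
    fun r h1 h3 => isUniversalNoLoop_cochain 𝕜 r h1 h3,
    fun r h1 h3 => isPolynomialOfDegree_cochain 𝕜 r h1 h3⟩, ?_, ?_⟩
  · exact fun d M _ _ _ _ D P f g => ⟨fun x => cochainOne_apply D P f g x, fun e he x hx =>
      ⟨cochainTwo_apply D P he f g hx, cochainThree_apply D P he f g hx⟩⟩
  · exact fun d M _ _ _ _ D P f e he x hx j k l =>
      coordCovector_lieDerivConnection_hamiltonian D P he hx f.contMDiff.contMDiffOn j k l
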